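/- **Setting.** Let $s\ge 3$, $r>0$, and let $\omega$ be multiplication by $\omega(\vec p)=|\vec p|$ on $L^2(\mathbb R^s,d^sp)$. Let $\widetilde f(\vec p)=(2\pi)^{-s/2}\int e^{-i\vec p\vec x}f(\vec x)\,d^sx$, let $\mathcal O_r$ be the open ball of radius $r$ around $0$, and let $D(\mathcal O_r)$ be the smooth functions with compact support in $\mathcal O_r$. The closed subspaces $\mathcal L^{\pm}=[\omega^{\mp 1/2}\widetilde D(\mathcal O_r)]$ of $L^2(\mathbb R^s,d^sp)$ and the orthogonal projections onto them are denoted by the same symbols. Fix a real $h\in D(\mathcal O_r)$ with $\widetilde h>0$ and a number $\gamma$ with $\frac12\le\gamma<\frac{s-1}{2}$. For $E\ge 0$ let $Q_E$ be the projection onto one-particle energies $|\vec p|<E$, and put $$T_{E,\pm}=\omega^{-1/2}Q_E\mathcal L^\pm,\quad T_{h,\pm}=\omega^{-\gamma}\widetilde h^{1/2}\mathcal L^\pm,\quad T=\big(|T_{E,+}|^2+|T_{E,-}|^2+|T_{h,+}|^2+|T_{h,-}|^2\big)^{1/2}.$$ Let $(Jf)(\vec p)=\overline{f(-\vec p)}$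 (complex conjugation in configuration space) and $(U_1(x)f)(\vec p)=e^{i(|\vec p|x^0-\vec p\vec x)}f(\vec p)$ for $x=(x^0,\vec x)\in\mathbb R^{s+1}$. On the symmetric Fock space $\mathcal H$ over $L^2(\mathbb R^s,d^sp)$, with annihilation operators $a(f)$, let $U(x)$ be the second quantization of $U_1(x)$, let $P_E$ be the spectral projection of the second quantization of $\omega$ on energies lower than $E$, let $\Omega$ be the vacuum vector and $\omega_0=\langle\Omega,\cdot\,\Omega\rangle$. Let $\mathcal T_E=P_EB(\mathcal H)_*P_E$ be the space of functionals $\psi(P_E\cdot P_E)$ with $\psi$ normal, and $\mathring{\mathcal T}_E=\{\varphi-\varphi(1)\omega_0:\varphi\in\mathcal T_E\}$. Let $(\beta_x\varphi)(A)=\varphi(U(x)AU(x)^*)$. For a functional $S$ on $\mathring{\mathcal T}_E$ and $x_1,\dots,x_N\in\mathbb R^{s+1}$ set $$\|S\|_{x_1\dots x_N}=\sup_{\varphi\in\mathring{\mathcal T}_E,\ \|\varphi\|\le1}\Big(\sum_{k=1}^N|S(\beta_{x_k}\varphi)|^2\Big)^{1/2}.$$ Given an orthonormal basis $(e_j)_{j\in\mathbb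 N}$ of $L^2(\mathbb R^s,d^sp)$ with $Je_j=e_j$ and $Te_j=t_je_j$, and a pair $\overline\mu=(\mu^+,\mu^-)$ of finitely supported multiindices, put $|\overline\mu|=|\mu^+|+|\mu^-|$, $t^{\overline\mu}=\prod_jt_j^{\mu^+_j+\mu^-_j}$, $a(\mathcal Le)^{\overline\mu}=\prod_ja(\mathcal L^+e_j)^{\mu^+_j}\prod_ja(\mathcal L^-e_j)^{\mu^-_j}$, and $$S_{\overline\mu,\overline\nu}(\varphi)=\varphi\big(a^*(\mathcal Le)^{\overline\mu}a(\mathcal Le)^{\overline\nu}\big)=\varphi\big((a(\mathcal Le)^{\overline\mu}P_E)^*\,a(\mathcal Le)^{\overline\nu}P_E\big),\qquad\varphi\in\mathring{\mathcal T}_E .$$ **Proposition.** The operators $T_{E,\pm}$ and $T_{h,\pm}$ are everywhere defined and bounded. Moreover, for every $\varepsilon>0$ there is a constant $c>0$, which depends only on $s,r,\varepsilon$ and on the choice of $h$ and $\gamma$ (not on $E$, $N$, the points $x_k$, the basis, $\overline\mu$ or $\overline\nu$), such that for every $E\ge0$ the following holds. 1. If $\|e\|=1$, $Je=e$ and $Te=te$,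 then for all $x\in\mathbb R^{s+1}$ with $|\vec x|\ge|x^0|$, and both signs, $$\big|\langle\omega^{-1/2}\widetilde h\mathcal L^\pm e\,|\,U_1(x)\,\omega^{-1/2}\widetilde h\mathcal L^\pm e\rangle\big|\le\frac{c\,t^2}{(|\vec x|-|x^0|+1)^{s-2-\varepsilon}} .$$ 2. With the same constant $c$: for every basis $(e_j)$ as above, all the operators $a(\mathcal Le)^{\overline\mu}P_E$ are everywhere defined and bounded, and for all $N\ge1$, all $x_1,\dots,x_N\in\mathbb R^{s+1}$ for which $$\delta(\underline x)=\inf_{i\ne j}\big(|\vec x_i-\vec x_j|-|x_i^0-x_j^0|\big)\ge0,$$ and all $\overline\mu,\overline\nu$, $$\|S_{\overline\mu,\overline\nu}\|_{x_1\dots x_N}^2\le16\,c\,\sup_{|\vec p|\le E}|\widetilde h(\vec p)|^{-2}\;E^{|\overline\mu|+|\overline\nu|}\;t^{2(\overline\mu+\overline\nu)}\Big\{1+\frac{N-1}{(\delta(\underline x)+1)^{s-2-\varepsilon}}\Big\}.$$ (For $N=1$ the fraction is $0$.) -/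

import Mathlib

open MeasureTheory
open scoped ENNReal ContDiff ComplexConjugate InnerProductSpace

noncomputable section

namespace MasslessField

/-! ## The one-particle space -/

/-- Momentum space (and configuration space) `ℝ^s` with the Euclidean norm. -/
abbrev Mom (s : ℕ) : Type := EuclideanSpace ℝ (Fin s)

/-- Spacetime `ℝ^{s+1}`: pairs `(x⁰, x⃗)`. -/
abbrev Spacetime (s : ℕ) : Type := ℝ × EuclideanSpace ℝ (Fin s)

/-- The one-particle space `L²(ℝ^s, d^s p)`. -/
abbrev OneParticle (s : ℕ) : Type := Lp ℂ 2 (volume : Measure (Mom s))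

/-- The Fourier transform `f̃(p) = (2π)^{-s/2} ∫ e^{-ip·x} f(x) dx`. -/
def fourier {s : ℕ} (f : Mom s → ℂ) (p : Mom s) : ℂ :=
  (((2 * Real.pi) ^ (-(s : ℝ) / 2) : ℝ) : ℂ) *
    ∫ x : Mom s, Complex.exp (-(Complex.I * ((⟪p, x⟫_ℝ : ℝ) : ℂ))) * f x

/-- `f ∈ D(O_r)`: smooth, with compact support in the open ball of radius `r` at the origin. -/
structure IsTestFunction {s : ℕ} (r : ℝ) (f : Mom s → ℂ) : Prop where
  smooth : ContDiff ℝ ∞ f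
  compact : HasCompactSupport f
  supp : tsupport f ⊆ Metric.ball 0 r

/-- The signs `±` that label fields (`+`) and momenta (`-`). -/
inductive Sgn : Type
  | plus
  | minus

/-- The exponent `∓ 1/2` of `ω` in the definition of `L^±`. -/
def Sgn.exponent : Sgn → ℝ
  | Sgn.plus => -(1 / 2)
  | Sgn.minus => 1 / 2

/-- The closed subspace `L^± = [ω^{∓1/2} D̃(O_r)]` of the one-particle space. -/
def localSubspace (s : ℕ) (r : ℝ) (σ : Sgn) : Submodule ℂ (OneParticle s) :=
  (Submodule.span ℂ {g : OneParticle s | ∃ f : Mom s → ℂ, IsTestFunction r f ∧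
    ∀ᵐ p, g p = ((‖p‖ ^ σ.exponent : ℝ) : ℂ) * fourier f p}).topologicalClosure

instance (s : ℕ) (r : ℝ) (σ : Sgn) : CompleteSpace (localSubspace s r σ) :=
  (Submodule.isClosed_topologicalClosure _).completeSpace_coe

/-- The orthogonal projection onto `L^±`, denoted `L^±` as well. -/
def localProj (s : ℕ) (r : ℝ) (σ : Sgn) : OneParticle s →L[ℂ] OneParticle s :=
  (localSubspace s r σ).starProjection

/-- `B = m(p) A`: the operator `A` followed by multiplication with the function `m` is everywhere
defined, and equal to the bounded operator `B`. -/
def IsMulComp {s : ℕ} (m : Mom s → ℝ) (A B : OneParticle s →L[ℂ] OneParticle s) : Prop :=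
  ∀ f : OneParticle s, ∀ᵐ p, B f p = (m p : ℂ) * A f p

open Classical in
/-- The bounded operator `m(p) A` (and `0` if this is not a bounded operator). -/
def mulComp {s : ℕ} (m : Mom s → ℝ) (A : OneParticle s →L[ℂ] OneParticle s) :
    OneParticle s →L[ℂ] OneParticle s :=
  if H : ∃ B, IsMulComp m A B then H.choose else 0

/-- The symbol of `ω^{-1/2} Q_E`, with `Q_E` the projection on one-particle energies `< E`. -/
def symbolE {s : ℕ} (E : ℝ) (p : Mom s) : ℝ := if ‖p‖ < E then ‖p‖ ^ (-(1 / 2) : ℝ) else 0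

/-- The symbol of `ω^{-γ} h̃^{1/2}`, for `h` with `h̃ > 0`. -/
def symbolH {s : ℕ} (γ : ℝ) (h : Mom s → ℂ) (p : Mom s) : ℝ :=
  ‖p‖ ^ (-γ) * Real.sqrt (fourier h p).re

/-- `T_{E,±} = ω^{-1/2} Q_E L^±`. -/
def opTE (s : ℕ) (r E : ℝ) (σ : Sgn) : OneParticle s →L[ℂ] OneParticle s :=
  mulComp (symbolE E) (localProj s r σ)

/-- `T_{h,±} = ω^{-γ} h̃^{1/2} L^±`. -/
def opTh (s : ℕ) (r γ : ℝ) (h : Mom s → ℂ) (σ : Sgn) : OneParticle s →L[ℂ] OneParticle s :=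
  mulComp (symbolH γ h) (localProj s r σ)

/-- `|A|² = A* A`. -/
def absSq {s : ℕ} (A : OneParticle s →L[ℂ] OneParticle s) : OneParticle s →L[ℂ] OneParticle s :=
  (ContinuousLinearMap.adjoint A).comp A

/-- The square root of a positive operator. -/
def opSqrt {H : Type*} [NormedAddCommGroup H] [InnerProductSpace ℂ H] [CompleteSpace H]
    (A : H →L[ℂ] H) : H →L[ℂ] H :=
  CFC.sqrt A

/-- `T = (|T_{E,+}|² + |T_{E,-}|² + |T_{h,+}|² + |T_{h,-}|²)^{1/2}`. -/
def opT (s : ℕ) (r γ : ℝ) (h : Mom s → ℂ) (E : ℝ) : OneParticle s →L[ℂ] OneParticle s :=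
  opSqrt (absSq (opTE s r E Sgn.plus) + absSq (opTE s r E Sgn.minus)
    + absSq (opTh s r γ h Sgn.plus) + absSq (opTh s r γ h Sgn.minus))

/-- `J f = f` for the complex conjugation `J` in configuration space, which reads
`(J f)(p) = conj (f (-p))` in momentum space. -/
def IsJInvariant {s : ℕ} (f : OneParticle s) : Prop :=
  ∀ᵐ p : Mom s, conj (f (-p)) = f p

/-- The inner product `⟨ω^{-1/2} h̃ L^± e | U(x) ω^{-1/2} h̃ L^± e⟩`, where
`(U(x) f)(p) = e^{i(|p| x⁰ - p·x⃗)} f(p)`. -/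
def correlation {s : ℕ} (r : ℝ) (h : Mom s → ℂ) (σ : Sgn) (e : OneParticle s)
    (x : Spacetime s) : ℂ :=
  ∫ p : Mom s,
    conj (((‖p‖ ^ (-(1 / 2) : ℝ) : ℝ) : ℂ) * fourier h p * localProj s r σ e p) *
      (Complex.exp (Complex.I * ((‖p‖ * x.1 - ⟪p, x.2⟫_ℝ : ℝ) : ℂ)) *
        (((‖p‖ ^ (-(1 / 2) : ℝ) : ℝ) : ℂ) * fourier h p * localProj s r σ e p))

/-! ## The symmetric Fock space

The full Fock space `⨁ₙ L²(ℝ^{sn})` is realized as the `L²`-space of the disjoint union of the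
`n`-particle momentum spaces, `n = 0, 1, 2, …`; for `n = 0` this is one point of mass one. -/

/-- Momentum configurations `(n; p₁, …, pₙ)`. -/
abbrev Config (s : ℕ) : Type := Σ n : ℕ, (Fin n → Mom s)

/-- The measure on configurations: Lebesgue measure on each `ℝ^{sn}`. -/
def configMeasure (s : ℕ) : Measure (Config s) :=
  Measure.sum fun n => (volume : Measure (Fin n → Mom s)).map fun p => (⟨n, p⟩ : Config s)

/-- The full Fock space. -/
def FullFock (s : ℕ) : Type := Lp ℂ 2 (configMeasure s)

instance (s : ℕ) : NormedAddCommGroup (FullFock s) :=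
  inferInstanceAs (NormedAddCommGroup (Lp ℂ 2 (configMeasure s)))

instance (s : ℕ) : InnerProductSpace ℂ (FullFock s) :=
  inferInstanceAs (InnerProductSpace ℂ (Lp ℂ 2 (configMeasure s)))

instance (s : ℕ) : CompleteSpace (FullFock s) :=
  inferInstanceAs (CompleteSpace (Lp ℂ 2 (configMeasure s)))

/-- A vector of the full Fock space as an element of `L²`. -/
def FullFock.toL2 {s : ℕ} (Ψ : FullFock s) : Lp ℂ 2 (configMeasure s) := Ψ

/-- An element of `L²` as a vector of the full Fock space. -/
def FullFock.ofL2 {s : ℕ} (Ψ : Lp ℂ 2 (configMeasure s)) : FullFock s := Ψ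

/-- Permutation of the particles, by `σ n` in the `n`-particle sector. -/
def permute {s : ℕ} (σ : ∀ n : ℕ, Equiv.Perm (Fin n)) (X : Config s) : Config s :=
  ⟨X.1, X.2 ∘ σ X.1⟩

theorem measurable_sigmaMk {s : ℕ} (n : ℕ) :
    Measurable (fun p : Fin n → Mom s => (⟨n, p⟩ : Config s)) :=
  Measurable.of_le_map (iInf_le _ n)

theorem measurable_of_sectors {s : ℕ} {β : Type*} [MeasurableSpace β] {m : Config s → β}
    (hm : ∀ n, Measurable fun p : Fin n → Mom s => m ⟨n, p⟩) : Measurable m := by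
  intro t ht
  refine MeasurableSpace.measurableSet_iInf.2 fun n => ?_
  exact hm n ht

theorem measurable_comp_perm {s n : ℕ} (σ : Equiv.Perm (Fin n)) :
    Measurable fun p : Fin n → Mom s => p ∘ σ :=
  measurable_pi_lambda _ fun i => measurable_pi_apply (σ i)

theorem measurable_permute {s : ℕ} (σ : ∀ n : ℕ, Equiv.Perm (Fin n)) :
    Measurable (permute (s := s) σ) :=
  measurable_of_sectors fun n => (measurable_sigmaMk n).comp (measurable_comp_perm (σ n))

theorem measurePreserving_permute {s : ℕ} (σ : ∀ n : ℕ, Equiv.Perm (Fin n)) :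
    MeasurePreserving (permute (s := s) σ) (configMeasure s) (configMeasure s) := by
  refine ⟨measurable_permute σ, ?_⟩
  unfold configMeasure
  rw [Measure.map_sum (measurable_permute σ).aemeasurable]
  congr 1
  funext n
  rw [Measure.map_map (measurable_permute σ) (measurable_sigmaMk n)]
  have h1 : (permute σ ∘ fun p : Fin n → Mom s => (⟨n, p⟩ : Config s))
      = (fun p : Fin n → Mom s => (⟨n, p⟩ : Config s)) ∘ fun p => p ∘ σ n := rfl
  rw [h1, ← Measure.map_map (measurable_sigmaMk n) (measurable_comp_perm (σ n))]
  congr 1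
  exact (volume_preserving_arrowCongr' (σ n).symm (MeasurableEquiv.refl (Mom s))
    (MeasurePreserving.id _)).map_eq

/-- The unitary action of permutations on the full Fock space. -/
def permuteOp {s : ℕ} (σ : ∀ n : ℕ, Equiv.Perm (Fin n)) : FullFock s →ₗᵢ[ℂ] FullFock s :=
  Lp.compMeasurePreservingₗᵢ ℂ (permute σ) (measurePreserving_permute σ)

/-- The symmetric wave functions in the full Fock space. -/
def symmetricSubspace (s : ℕ) : Submodule ℂ (FullFock s) :=
  ⨅ σ : ∀ n : ℕ, Equiv.Perm (Fin n), LinearMap.eqLocus (permuteOp σ).toLinearMap LinearMap.id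

theorem mem_symmetricSubspace {s : ℕ} {Ψ : FullFock s} :
    Ψ ∈ symmetricSubspace s ↔ ∀ σ : ∀ n : ℕ, Equiv.Perm (Fin n),
      ∀ᵐ X ∂configMeasure s, Ψ.toL2 (permute σ X) = Ψ.toL2 X := by
  simp only [symmetricSubspace, Submodule.mem_iInf]
  refine forall_congr' fun σ => ?_
  have h2 := Lp.coeFn_compMeasurePreserving Ψ.toL2 (measurePreserving_permute (s := s) σ)
  constructor
  · intro h
    have h' : Lp.compMeasurePreserving (permute σ) (measurePreserving_permute σ) Ψ.toL2
      = Ψ.toL2 := h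
    rw [h'] at h2
    filter_upwards [h2] with X hX using hX.symm
  · intro h
    change Lp.compMeasurePreserving (permute σ) (measurePreserving_permute σ) Ψ.toL2 = Ψ.toL2
    refine Lp.ext (h2.trans ?_)
    filter_upwards [h] with X hX using hX

theorem isClosed_symmetricSubspace (s : ℕ) : IsClosed (symmetricSubspace s : Set (FullFock s)) := by
  simp only [symmetricSubspace, Submodule.coe_iInf]
  exact isClosed_iInter fun σ => isClosed_eq (permuteOp σ).continuous continuous_id

/-- The symmetric Fock space over `L²(ℝ^s, d^s p)`. -/
def Fock (s : ℕ) : Type := symmetricSubspace s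

instance (s : ℕ) : NormedAddCommGroup (Fock s) :=
  inferInstanceAs (NormedAddCommGroup (symmetricSubspace s))

instance (s : ℕ) : InnerProductSpace ℂ (Fock s) :=
  inferInstanceAs (InnerProductSpace ℂ (symmetricSubspace s))

instance (s : ℕ) : CompleteSpace (Fock s) :=
  (isClosed_symmetricSubspace s).completeSpace_coe

/-- The inclusion of the symmetric Fock space into the full Fock space. -/
def Fock.incl (s : ℕ) : Fock s →ₗᵢ[ℂ] FullFock s := (symmetricSubspace s).subtypeₗᵢ

/-- A symmetric vector of the full Fock space as a vector of the symmetric Fock space. -/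
def Fock.mk {s : ℕ} (Ψ : FullFock s) (hΨ : Ψ ∈ symmetricSubspace s) : Fock s := ⟨Ψ, hΨ⟩

/-- The bounded operators on the Fock space. -/
abbrev BddOp (s : ℕ) : Type := Fock s →L[ℂ] Fock s

/-- The value of a Fock space vector at a momentum configuration. -/
def wave {s : ℕ} (Ψ : Fock s) (X : Config s) : ℂ := (Fock.incl s Ψ).toL2 X

theorem memLp_wave {s : ℕ} (Ψ : Fock s) : MemLp (wave Ψ) 2 (configMeasure s) :=
  Lp.memLp (Fock.incl s Ψ).toL2

theorem wave_permute {s : ℕ} (Ψ : Fock s) (σ : ∀ n : ℕ, Equiv.Perm (Fin n)) :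
    ∀ᵐ X ∂configMeasure s, wave Ψ (permute σ X) = wave Ψ X :=
  mem_symmetricSubspace.1 (Subtype.property (p := fun Φ => Φ ∈ symmetricSubspace s) Ψ) σ

theorem wave_add {s : ℕ} (Ψ Φ : Fock s) :
    ∀ᵐ X ∂configMeasure s, wave (Ψ + Φ) X = wave Ψ X + wave Φ X :=
  Lp.coeFn_add (Fock.incl s Ψ).toL2 (Fock.incl s Φ).toL2

theorem wave_smul {s : ℕ} (c : ℂ) (Ψ : Fock s) :
    ∀ᵐ X ∂configMeasure s, wave (c • Ψ) X = c * wave Ψ X :=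
  Lp.coeFn_smul c (Fock.incl s Ψ).toL2

theorem wave_ext {s : ℕ} {Ψ Φ : Fock s} (h : ∀ᵐ X ∂configMeasure s, wave Ψ X = wave Φ X) :
    Ψ = Φ := by
  apply (Fock.incl s).injective
  exact Lp.ext (f := (Fock.incl s Ψ).toL2) (g := (Fock.incl s Φ).toL2) h

theorem norm_le_of_wave {s : ℕ} {Ψ Φ : Fock s}
    (h : ∀ᵐ X ∂configMeasure s, ‖wave Ψ X‖ ≤ ‖wave Φ X‖) : ‖Ψ‖ ≤ ‖Φ‖ :=
  Lp.norm_le_norm_of_ae_le (f := (Fock.incl s Ψ).toL2) (g := (Fock.incl s Φ).toL2) h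

/-- The Fock space vector with the given square-integrable symmetric wave function. -/
def Fock.ofWave {s : ℕ} (w : Config s → ℂ) (hw : MemLp w 2 (configMeasure s))
    (hs : ∀ σ, ∀ᵐ X ∂configMeasure s, w (permute σ X) = w X) : Fock s :=
  Fock.mk (FullFock.ofL2 (hw.toLp w)) (mem_symmetricSubspace.2 fun σ => by
    have h1 := hw.coeFn_toLp
    have h2 := (measurePreserving_permute (s := s) σ).quasiMeasurePreserving.ae h1
    filter_upwards [h1, h2, hs σ] with X hX1 hX2 hX3
    exact (hX2.trans hX3).trans hX1.symm)

theorem wave_ofWave {s : ℕ} (w : Config s → ℂ) (hw : MemLp w 2 (configMeasure s))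
    (hs : ∀ σ, ∀ᵐ X ∂configMeasure s, w (permute σ X) = w X) :
    ∀ᵐ X ∂configMeasure s, wave (Fock.ofWave w hw hs) X = w X :=
  hw.coeFn_toLp

/-- Symmetric measurable functions of the configuration that are bounded by one. -/
structure Multiplier (s : ℕ) where
  toFun : Config s → ℂ
  meas : Measurable toFun
  bound : ∀ X, ‖toFun X‖ ≤ 1
  symm : ∀ σ X, toFun (permute σ X) = toFun X

theorem Multiplier.memLp {s : ℕ} (m : Multiplier s) (Ψ : Fock s) :
    MemLp (fun X => m.toFun X * wave Ψ X) 2 (configMeasure s) := by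
  refine (memLp_wave Ψ).of_le (m.meas.aestronglyMeasurable.mul (memLp_wave Ψ).1)
    (Filter.Eventually.of_forall fun X => ?_)
  rw [norm_mul]
  exact mul_le_of_le_one_left (norm_nonneg _) (m.bound X)

/-- The vector with the wave function `m Ψ`. -/
def Multiplier.apply {s : ℕ} (m : Multiplier s) (Ψ : Fock s) : Fock s :=
  Fock.ofWave (fun X => m.toFun X * wave Ψ X) (m.memLp Ψ) fun σ => by
    filter_upwards [wave_permute Ψ σ] with X hX
    rw [hX, m.symm]

theorem Multiplier.wave_apply {s : ℕ} (m : Multiplier s) (Ψ : Fock s) :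
    ∀ᵐ X ∂configMeasure s, wave (m.apply Ψ) X = m.toFun X * wave Ψ X :=
  wave_ofWave _ _ _

/-- Multiplication by a multiplier, as a bounded operator on the Fock space. -/
def Multiplier.op {s : ℕ} (m : Multiplier s) : BddOp s :=
  LinearMap.mkContinuous
    { toFun := m.apply
      map_add' := by
        intro Ψ Φ
        refine wave_ext ?_
        filter_upwards [m.wave_apply (Ψ + Φ), m.wave_apply Ψ, m.wave_apply Φ, wave_add Ψ Φ,
          wave_add (m.apply Ψ) (m.apply Φ)] with X h1 h2 h3 h4 h5
        rw [h1, h5, h2, h3, h4, mul_add]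
      map_smul' := by
        intro c Ψ
        refine wave_ext ?_
        filter_upwards [m.wave_apply (c • Ψ), m.wave_apply Ψ, wave_smul c Ψ,
          wave_smul c (m.apply Ψ)] with X h1 h2 h3 h4
        rw [RingHom.id_apply, h1, h4, h2, h3, mul_left_comm] }
    1 (by
      intro Ψ
      rw [one_mul]
      refine norm_le_of_wave ?_
      filter_upwards [m.wave_apply Ψ] with X hX
      change ‖wave (m.apply Ψ) X‖ ≤ _
      rw [hX, norm_mul]
      exact mul_le_of_le_one_left (norm_nonneg _) (m.bound X))

/-- The energy `|p₁| + … + |pₙ|` of a configuration. -/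
def energy {s : ℕ} (X : Config s) : ℝ := ∑ i, ‖X.2 i‖

/-- The phase `∑ⱼ (|pⱼ| x⁰ - pⱼ·x⃗)` of a configuration. -/
def phase {s : ℕ} (x : Spacetime s) (X : Config s) : ℝ := ∑ i, (‖X.2 i‖ * x.1 - ⟪X.2 i, x.2⟫_ℝ)

theorem measurable_energy {s : ℕ} : Measurable (energy (s := s)) :=
  measurable_of_sectors fun n => by
    have h : Measurable fun p : Fin n → Mom s => ∑ i, ‖p i‖ :=
      Finset.measurable_fun_sum _ fun i _ => (measurable_pi_apply i).norm
    exact h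

theorem measurable_phase {s : ℕ} (x : Spacetime s) : Measurable (phase x) :=
  measurable_of_sectors fun n => by
    have h : Measurable fun p : Fin n → Mom s => ∑ i, (‖p i‖ * x.1 - ⟪p i, x.2⟫_ℝ) := by
      refine Finset.measurable_fun_sum _ fun i _ => ?_
      have h' : Measurable fun p : Fin n → Mom s => p i := measurable_pi_apply i
      exact (h'.norm.mul_const _).sub (h'.inner measurable_const)
    exact h

/-- The spectral projection `P_E` of the Hamiltonian (the second quantization of `ω`) on energies
lower than `E`. -/
def specProj (s : ℕ) (E : ℝ) : BddOp s :=
  Multiplier.op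
    { toFun := Set.indicator {X | energy X < E} 1
      meas := measurable_one.indicator (measurableSet_lt measurable_energy measurable_const)
      bound := fun X => by
        by_cases hX : X ∈ {X : Config s | energy X < E} <;> simp [hX]
      symm := fun σ X => by
        have h : energy (permute σ X) = energy X :=
          Equiv.sum_comp (σ X.1) fun i => ‖X.2 i‖
        simp only [Set.indicator, Set.mem_ofPred_eq, h, Pi.one_apply] }

/-- The unitary operator `U(x)` of translation by `x`, the second quantization of `U₁(x)`. -/
def translation {s : ℕ} (x : Spacetime s) : BddOp s :=
  Multiplier.op
    { toFun := fun X => Complex.exp (Complex.I * (phase x X : ℂ))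
      meas := Complex.measurable_exp.comp
        (measurable_const.mul (Complex.measurable_ofReal.comp (measurable_phase x)))
      bound := fun X => by rw [mul_comm, Complex.norm_exp_ofReal_mul_I]
      symm := fun σ X => by
        have h : phase x (permute σ X) = phase x X :=
          Equiv.sum_comp (σ X.1) fun i => (‖X.2 i‖ * x.1 - ⟪X.2 i, x.2⟫_ℝ)
        rw [h] }

/-- `Φ = a(f) Ψ`, that is, `Ψ` is in the domain of `a(f)` and
`Φ_n(p₁, …, pₙ) = √(n+1) ∫ conj (f(q)) Ψ_{n+1}(q, p₁, …, pₙ) dq`. -/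
def IsAnnihilated {s : ℕ} (f : OneParticle s) (Ψ Φ : Fock s) : Prop :=
  ∀ n : ℕ, ∀ᵐ p : Fin n → Mom s,
    wave Φ ⟨n, p⟩ =
      (Real.sqrt (n + 1) : ℂ) * ∫ q : Mom s, conj (f q) * wave Ψ ⟨n + 1, Fin.cons q p⟩

/-- `Φ = a(f₁) ⋯ a(f_k) Ψ` (the order of the factors is immaterial). -/
def IsAnnihilatedList {s : ℕ} : List (OneParticle s) → Fock s → Fock s → Prop
  | [], Ψ, Φ => Φ = Ψ
  | f :: l, Ψ, Φ => ∃ Φ', IsAnnihilatedList l Ψ Φ' ∧ IsAnnihilated f Φ' Φ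

/-- `B = a(f₁) ⋯ a(f_k) P_E`: the right-hand side is everywhere defined, and equal to the bounded
operator `B`. -/
def IsAnnihilator {s : ℕ} (E : ℝ) (l : List (OneParticle s)) (B : BddOp s) : Prop :=
  ∀ Ψ : Fock s, IsAnnihilatedList l (specProj s E Ψ) (B Ψ)

open Classical in
/-- The bounded operator `a(f₁) ⋯ a(f_k) P_E` (and `0` if this is not a bounded operator). -/
def annihilator {s : ℕ} (E : ℝ) (l : List (OneParticle s)) : BddOp s :=
  if H : ∃ B, IsAnnihilator E l B then H.choose else 0

/-! ## Functionals -/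

/-- The bounded functionals on `B(H)`. -/
abbrev Functional (s : ℕ) : Type := BddOp s →L[ℂ] ℂ

/-- The normal functionals, i.e. the elements of `B(H)_*`. -/
def IsNormal {s : ℕ} (φ : Functional s) : Prop :=
  ∃ u v : ℕ → Fock s, Summable (fun n => ‖u n‖ ^ 2) ∧ Summable (fun n => ‖v n‖ ^ 2) ∧
    ∀ A : BddOp s, HasSum (fun n => ⟪v n, A (u n)⟫_ℂ) (φ A)

theorem vacuum_measurableSet (s : ℕ) : MeasurableSet {X : Config s | X.1 = 0} := by
  have h : Measurable (fun X : Config s => X.1) := measurable_of_sectors fun n => measurable_const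
  exact h (measurableSet_singleton 0)

theorem vacuum_measure_ne_top (s : ℕ) : configMeasure s {X : Config s | X.1 = 0} ≠ ⊤ := by
  have h : configMeasure s {X : Config s | X.1 = 0} = 1 := by
    unfold configMeasure
    rw [Measure.sum_apply _ (vacuum_measurableSet s), tsum_eq_single 0]
    · rw [Measure.map_apply (measurable_sigmaMk 0) (vacuum_measurableSet s)]
      simp [volume_pi]
    · intro n hn
      rw [Measure.map_apply (measurable_sigmaMk n) (vacuum_measurableSet s)]
      simp [hn]
  rw [h]
  exact ENNReal.one_ne_top

/-- The Fock vacuum `Ω = (1, 0, 0, …)`. -/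
def vacuum (s : ℕ) : Fock s :=
  Fock.ofWave (Set.indicator {X | X.1 = 0} fun _ => 1)
    (memLp_indicator_const 2 (vacuum_measurableSet s) 1 (Or.inr (vacuum_measure_ne_top s)))
    fun _ => Filter.Eventually.of_forall fun _ => rfl

/-- The vacuum state `ω₀(A) = ⟨Ω, A Ω⟩`. -/
def vacuumState (s : ℕ) : Functional s :=
  (innerSL ℂ (vacuum s)).comp (ContinuousLinearMap.apply ℂ (Fock s) (vacuum s))

/-- `𝒯_E = P_E B(H)_* P_E`, the functionals `A ↦ ψ(P_E A P_E)` with `ψ` normal. -/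
def energyFunctionals (s : ℕ) (E : ℝ) : Set (Functional s) :=
  {φ | ∃ ψ : Functional s, IsNormal ψ ∧
    φ = ψ.comp (ContinuousLinearMap.mulLeftRight ℂ (BddOp s) (specProj s E) (specProj s E))}

/-- `𝒯̊_E = {φ - φ(1) ω₀ | φ ∈ 𝒯_E}`. -/
def centeredFunctionals (s : ℕ) (E : ℝ) : Set (Functional s) :=
  {χ | ∃ φ ∈ energyFunctionals s E, χ = φ - φ 1 • vacuumState s}

/-- The dual action of translations, `(β_x φ)(A) = φ(α_x(A))` with `α_x(A) = U(x) A U(x)*`. -/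
def dualTranslation {s : ℕ} (x : Spacetime s) (φ : Functional s) : Functional s :=
  φ.comp (ContinuousLinearMap.mulLeftRight ℂ (BddOp s) (translation x)
    (ContinuousLinearMap.adjoint (translation x)))

/-- The norm `‖Π‖_{x₁…x_N} = sup (∑ₖ |Π(β_{xₖ} v)|²)^{1/2}`, the supremum being over the unit ball
of the space `V` of functionals, with values in `[0, ∞]`. -/
def multiNorm {s N : ℕ} (V : Set (Functional s)) (x : Fin N → Spacetime s)
    (Pi : Functional s → ℂ) : ℝ≥0∞ :=
  ⨆ v ∈ {v : Functional s | v ∈ V ∧ ‖v‖ ≤ 1},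
    (∑ k, ‖Pi (dualTranslation (x k) v)‖ₑ ^ 2) ^ (1 / 2 : ℝ)

/-! ## Multiindices and the functionals `S_{μ̄,ν̄}` -/

/-- Pairs of multiindices `μ̄ = (μ⁺, μ⁻)`. -/
abbrev MultiPair : Type := Sgn → (ℕ →₀ ℕ)

/-- `|μ̄| = |μ⁺| + |μ⁻|`. -/
def MultiPair.size (μ : MultiPair) : ℕ := (μ Sgn.plus).degree + (μ Sgn.minus).degree

/-- `t^μ̄ = t^{μ⁺} t^{μ⁻}`, where `t^μ = ∏ⱼ tⱼ^{μⱼ}`. -/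
def MultiPair.pow (t : ℕ → ℝ) (μ : MultiPair) : ℝ :=
  ((μ Sgn.plus).prod fun j k => t j ^ k) * ((μ Sgn.minus).prod fun j k => t j ^ k)

/-- The family in which each `g j` is repeated `μ j` times. -/
def repeated {s : ℕ} (g : ℕ → OneParticle s) (μ : ℕ →₀ ℕ) : List (OneParticle s) :=
  (μ.support.sort (· ≤ ·)).flatMap fun j => List.replicate (μ j) (g j)

/-- The arguments of the annihilation operators in `a(Le)^μ̄ = a(L⁺e)^{μ⁺} a(L⁻e)^{μ⁻}`. -/
def MultiPair.args {s : ℕ} (r : ℝ) (e : ℕ → OneParticle s) (μ : MultiPair) :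
    List (OneParticle s) :=
  repeated (fun j => localProj s r Sgn.plus (e j)) (μ Sgn.plus) ++
    repeated (fun j => localProj s r Sgn.minus (e j)) (μ Sgn.minus)

/-- The functional `S_{μ̄,ν̄}(φ) = φ(a*(Le)^μ̄ a(Le)^ν̄)` for functionals `φ = φ(P_E · P_E)`: the
operator `P_E a*(Le)^μ̄ a(Le)^ν̄ P_E` is `(a(Le)^μ̄ P_E)* (a(Le)^ν̄ P_E)`. -/
def functionalS {s : ℕ} (r E : ℝ) (e : ℕ → OneParticle s) (μ ν : MultiPair)
    (φ : Functional s) : ℂ :=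
  φ ((ContinuousLinearMap.adjoint (annihilator E (μ.args r e))).comp
    (annihilator E (ν.args r e)))

/-- `δ(x) = inf_{i ≠ j} (|x⃗ᵢ - x⃗ⱼ| - |xᵢ⁰ - xⱼ⁰|)`; for a single point, where the infimum is over
the empty set, the value is `0`. -/
def separation {s N : ℕ} (x : Fin N → Spacetime s) : ℝ :=
  ⨅ ij : {ij : Fin N × Fin N // ij.1 ≠ ij.2},
    (‖(x ij.1.1).2 - (x ij.1.2).2‖ - |(x ij.1.1).1 - (x ij.1.2).1|)

end MasslessField

end

noncomputable section

namespace MasslessField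

/-! ## Integration over momentum configurations -/

/-! Everything reduces to one-particle estimates `LowEnergyBound`: `∑ₖ |⟨fₖ, φ⟩|² ≤ M ⟨φ, ωφ⟩` for
`φ` of energy below `E`. By permutation symmetry, `(n+1) ∫ |p₁| |Ψ|²` is the expectation of the
total energy, so such an estimate lifts to `∑ₖ ‖a(fₖ)Ψ‖² ≤ M E ‖Ψ‖²` on the range of `P_E`
(`LowEnergyBound.sum_norm_sq_le`). Annihilation does not raise the energy; hence products
`a(f₁)⋯a(fₖ)P_E` split into factors `a(f)P_E`, each of norm at most `|t| √E`.

In `S` only the rightmost annihilation operator has to see the points `xₖ`. Since `U(x) a(f) U(x)* =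
a(U₁(x) f)`, Cauchy–Schwarz bounds linear combinations of the translated operators
(`norm_sum_smul_translates_le`), and `ℓ²` duality turns this into a bound on the sum over `k`. If
`ν̄` is empty one passes to adjoints; if both multiindices are empty the operator is `P_E`, on which
centered functionals vanish.

The required bound for the family `U₁(xₖ) L^± e` is a Schur test for the Gram matrix of the vectors
`ω^{-1/2} |h̃| U₁(xₖ) L^± e` (`lowEnergyBound_of_gram`). Its entries are the correlations of the
first claim; dividing by `h̃` again costs `sup |h̃|⁻²`.

The decay of the correlations comes from a contour shift (`norm_fiber_integral_le`). For `v =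
ω^{∓1/2} f̃` the correlation is, up to a constant, `∫ |p|⁻² |g̃|² e^{i(|p|x⁰ - p·x⃗)}`, or a finite
sum of such integrals, where `g` is the convolution of `f` with `h` or with a partial derivative of
`h`. Let `k` be the component of `p` along `x⃗` and `q` the transverse momentum. Moving `k` to `k -
i|q|/2` gains `e^{-(|x⃗| - |x⁰| - 4r)|q|/2}`, because `g` has support of radius `2r` and `|Im √(z² +
|q|²)| ≤ |Im z|`. Integrating this against `|q|⁻¹` over `ℝ^{s-1}` gives the power `s - 2`. The
prefactor `‖g‖₁²` is at most a constant times `‖g̃‖₂²`, which is controlled by `‖T_h e‖² ≤ t²`,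
since `γ ≥ 1/2` and `h̃^{1/2}` decays rapidly.

The multiplication operators are bounded because `f̃(p)` is a bounded functional of `v`
(`exists_norm_fourier_le`): a singularity `|p|^{-g}` is harmless when `2g + 1 < s`, which for `T_h`
is the condition `γ < (s-1)/2`. Boundedness also carries the estimates from generators to all of
`L^±`. -/

theorem injective_sigmaMk {s : ℕ} (n : ℕ) :
    Function.Injective (fun p : Fin n → Mom s => (⟨n, p⟩ : Config s)) := by
  intro p q h
  simpa using h

theorem measurableEmbedding_sigmaMk {s : ℕ} (n : ℕ) :
    MeasurableEmbedding (fun p : Fin n → Mom s => (⟨n, p⟩ : Config s)) where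
  injective := injective_sigmaMk n
  measurable := measurable_sigmaMk n
  measurableSet_image' := by
    intro t ht
    refine MeasurableSpace.measurableSet_iInf.2 fun m => ?_
    change MeasurableSet ((fun p : Fin m → Mom s => (⟨m, p⟩ : Config s)) ⁻¹' _)
    by_cases hm : m = n
    · subst hm
      rwa [Set.preimage_image_eq _ (injective_sigmaMk _)]
    · convert MeasurableSet.empty
      ext p
      simp only [Set.mem_preimage, Set.mem_image, Set.mem_empty_iff_false, iff_false]
      rintro ⟨q, _, hq⟩
      exact hm (congrArg Sigma.fst hq).symm

theorem ae_config_iff {s : ℕ} {P : Config s → Prop} :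
    (∀ᵐ X ∂configMeasure s, P X) ↔ ∀ n, ∀ᵐ p : Fin n → Mom s, P ⟨n, p⟩ := by
  unfold configMeasure
  rw [Measure.ae_sum_iff]
  exact forall_congr' fun n => (measurableEmbedding_sigmaMk n).ae_map_iff

theorem lintegral_config {s : ℕ} (F : Config s → ℝ≥0∞) :
    ∫⁻ X, F X ∂configMeasure s = ∑' n, ∫⁻ p : Fin n → Mom s, F ⟨n, p⟩ := by
  unfold configMeasure
  rw [lintegral_sum_measure]
  exact tsum_congr fun n => (measurableEmbedding_sigmaMk n).lintegral_map _

theorem measurePreserving_cons (s n : ℕ) :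
    MeasurePreserving (fun z : (Fin n → Mom s) × Mom s => (Fin.cons z.2 z.1 : Fin (n + 1) → Mom s))
      (volume.prod volume) volume := by
  have h := (volume_preserving_piFinSuccAbove (fun _ : Fin (n + 1) => Mom s) 0).symm
  have h2 := h.comp (Measure.measurePreserving_swap
    (μ := (volume : Measure (Fin n → Mom s))) (ν := (volume : Measure (Mom s))))
  have h3 : (fun z : (Fin n → Mom s) × Mom s => (Fin.cons z.2 z.1 : Fin (n + 1) → Mom s))
      = (MeasurableEquiv.piFinSuccAbove (fun _ : Fin (n + 1) => Mom s) 0).symm ∘ Prod.swap := by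
    funext z
    simp [MeasurableEquiv.piFinSuccAbove, Fin.insertNthEquiv]
  rw [h3]
  exact h2

theorem lintegral_cons {s n : ℕ} {F : (Fin (n + 1) → Mom s) → ℝ≥0∞} (hF : Measurable F) :
    ∫⁻ X, F X = ∫⁻ p : Fin n → Mom s, ∫⁻ q : Mom s, F (Fin.cons q p) := by
  rw [← (measurePreserving_cons s n).lintegral_comp hF]
  exact lintegral_prod _ (hF.comp (measurePreserving_cons s n).measurable).aemeasurable

theorem ae_cons {s n : ℕ} {P : (Fin (n + 1) → Mom s) → Prop} (h : ∀ᵐ X, P X) :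
    ∀ᵐ p : Fin n → Mom s, ∀ᵐ q : Mom s, P (Fin.cons q p) :=
  Measure.ae_ae_of_ae_prod ((measurePreserving_cons s n).quasiMeasurePreserving.ae h)

theorem stronglyMeasurable_wave {s : ℕ} (Ψ : Fock s) : StronglyMeasurable (wave Ψ) :=
  Lp.stronglyMeasurable _

theorem measurable_wave_sector {s : ℕ} (Ψ : Fock s) (n : ℕ) :
    Measurable fun p : Fin n → Mom s => wave Ψ ⟨n, p⟩ :=
  (stronglyMeasurable_wave Ψ).measurable.comp (measurable_sigmaMk n)

theorem enorm_sq_eq_lintegral_wave {s : ℕ} (Ψ : Fock s) :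
    ‖Ψ‖ₑ ^ 2 = ∑' n, ∫⁻ p : Fin n → Mom s, ‖wave Ψ ⟨n, p⟩‖ₑ ^ 2 := by
  have h1 : ‖Ψ‖ₑ = ‖(Fock.incl s Ψ).toL2‖ₑ := rfl
  rw [h1, Lp.enorm_def, eLpNorm_eq_lintegral_rpow_enorm_toReal two_ne_zero ENNReal.ofNat_ne_top,
    ← lintegral_config (fun X => ‖wave Ψ X‖ₑ ^ 2)]
  simp only [ENNReal.toReal_ofNat, ENNReal.rpow_ofNat]
  rw [← ENNReal.rpow_ofNat, ← ENNReal.rpow_mul]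
  norm_num
  rfl

theorem ae_wave_sector_comp_perm {s : ℕ} (Ψ : Fock s) {n : ℕ} (σ : Equiv.Perm (Fin n)) :
    ∀ᵐ p : Fin n → Mom s, wave Ψ ⟨n, p ∘ σ⟩ = wave Ψ ⟨n, p⟩ := by
  classical
  -- The permutation of the one sector is extended by the identity on all others.
  have h := ae_config_iff.1 (wave_permute Ψ
    (fun m => if h : m = n then h ▸ σ else Equiv.refl _)) n
  filter_upwards [h] with p hp
  simpa [permute] using hp

theorem measurePreserving_comp_perm {s n : ℕ} (σ : Equiv.Perm (Fin n)) :
    MeasurePreserving (fun p : Fin n → Mom s => p ∘ σ) volume volume :=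
  volume_preserving_arrowCongr' σ.symm (MeasurableEquiv.refl (Mom s)) (MeasurePreserving.id _)

/-- By Tonelli the squared norms of the slices have a finite integral over `p`, so almost all of
them are finite. -/
theorem memLp_slice {s : ℕ} (Ψ : Fock s) (n : ℕ) :
    ∀ᵐ p : Fin n → Mom s, MemLp (fun q : Mom s => wave Ψ ⟨n + 1, Fin.cons q p⟩) 2 := by
  have hm := measurable_wave_sector Ψ (n + 1)
  have h1 : ∫⁻ p : Fin n → Mom s, ∫⁻ q : Mom s, ‖wave Ψ ⟨n + 1, Fin.cons q p⟩‖ₑ ^ 2 ≠ ⊤ := by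
    rw [← lintegral_cons (F := fun X => ‖wave Ψ ⟨n + 1, X⟩‖ₑ ^ 2) (hm.enorm.pow_const 2)]
    have h2 := ENNReal.le_tsum
      (f := fun n => ∫⁻ p : Fin n → Mom s, ‖wave Ψ ⟨n, p⟩‖ₑ ^ 2) (n + 1)
    rw [← enorm_sq_eq_lintegral_wave] at h2
    exact ne_top_of_le_ne_top (by simp) h2
  have hm2 : Measurable fun z : (Fin n → Mom s) × Mom s =>
      wave Ψ ⟨n + 1, Fin.cons z.2 z.1⟩ := hm.comp (measurePreserving_cons s n).measurable
  have h2 := ae_lt_top (Measurable.lintegral_prod_right'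
    (f := fun z : (Fin n → Mom s) × Mom s => ‖wave Ψ ⟨n + 1, Fin.cons z.2 z.1⟩‖ₑ ^ 2)
    (hm2.enorm.pow_const 2)) h1
  filter_upwards [h2] with p hp
  refine ⟨(hm2.comp measurable_prodMk_left).aestronglyMeasurable, ?_⟩
  rw [eLpNorm_lt_top_iff_lintegral_rpow_enorm_lt_top two_ne_zero ENNReal.ofNat_ne_top]
  simpa using hp

/-- Guarantees that the integral defining `a(f)Ψ` is a genuine one and not the default value zero;
additivity in `Ψ` depends on this. -/
theorem integrable_conj_mul_slice {s : ℕ} (f : OneParticle s) (Ψ : Fock s) (n : ℕ) :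
    ∀ᵐ p : Fin n → Mom s,
      Integrable (fun q : Mom s => conj (f q) * wave Ψ ⟨n + 1, Fin.cons q p⟩) := by
  filter_upwards [memLp_slice Ψ n] with p hp
  exact (Lp.memLp f).star.integrable_mul hp

/-! ## Annihilation operators -/

theorem IsAnnihilated.unique {s : ℕ} {f : OneParticle s} {Ψ Φ Φ' : Fock s}
    (h : IsAnnihilated f Ψ Φ) (h' : IsAnnihilated f Ψ Φ') : Φ = Φ' := by
  refine wave_ext (ae_config_iff.2 fun n => ?_)
  filter_upwards [h n, h' n] with p h1 h2
  rw [h1, h2]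

theorem IsAnnihilated.add {s : ℕ} {f : OneParticle s} {Ψ Φ Ψ' Φ' : Fock s}
    (h : IsAnnihilated f Ψ Φ) (h' : IsAnnihilated f Ψ' Φ') :
    IsAnnihilated f (Ψ + Ψ') (Φ + Φ') := by
  intro n
  filter_upwards [h n, h' n, ae_config_iff.1 (wave_add Φ Φ') n,
    ae_cons (ae_config_iff.1 (wave_add Ψ Ψ') (n + 1)), integrable_conj_mul_slice f Ψ n,
    integrable_conj_mul_slice f Ψ' n] with p h1 h2 h3 h4 h5 h6
  rw [h3, h1, h2, ← mul_add, ← integral_add h5 h6]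
  congr 1
  refine integral_congr_ae ?_
  filter_upwards [h4] with q hq
  rw [hq, mul_add]

theorem IsAnnihilated.smul {s : ℕ} {f : OneParticle s} {Ψ Φ : Fock s} (c : ℂ)
    (h : IsAnnihilated f Ψ Φ) : IsAnnihilated f (c • Ψ) (c • Φ) := by
  intro n
  filter_upwards [h n, ae_config_iff.1 (wave_smul c Φ) n,
    ae_cons (ae_config_iff.1 (wave_smul c Ψ) (n + 1))] with p h1 h2 h3
  have h4 : ∫ q : Mom s, conj (f q) * wave (c • Ψ) ⟨n + 1, Fin.cons q p⟩
      = ∫ q : Mom s, c * (conj (f q) * wave Ψ ⟨n + 1, Fin.cons q p⟩) := by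
    refine integral_congr_ae ?_
    filter_upwards [h3] with q hq
    rw [hq, mul_left_comm]
  rw [h2, h1, h4, integral_const_mul, mul_left_comm]

/-- The wave function of `a(f) Ψ`. -/
def annihilatedWave {s : ℕ} (f : OneParticle s) (Ψ : Fock s) (X : Config s) : ℂ :=
  (Real.sqrt (X.1 + 1) : ℂ) * ∫ q : Mom s, conj (f q) * wave Ψ ⟨X.1 + 1, Fin.cons q X.2⟩

theorem measurable_annihilatedWave {s : ℕ} (f : OneParticle s) (Ψ : Fock s) :
    Measurable (annihilatedWave f Ψ) := by
  refine measurable_of_sectors fun n => ?_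
  simp only [annihilatedWave]
  refine Measurable.const_mul ?_ _
  have hm2 : Measurable fun z : (Fin n → Mom s) × Mom s =>
      conj (f z.2) * wave Ψ ⟨n + 1, Fin.cons z.2 z.1⟩ := by
    refine Measurable.mul ?_ ((measurable_wave_sector Ψ (n + 1)).comp
      (measurePreserving_cons s n).measurable)
    exact (RCLike.continuous_conj.measurable.comp (Lp.stronglyMeasurable f).measurable).comp
      measurable_snd
  exact hm2.stronglyMeasurable.integral_prod_right'.measurable

theorem annihilatedWave_permute {s : ℕ} (f : OneParticle s) (Ψ : Fock s)
    (σ : ∀ n : ℕ, Equiv.Perm (Fin n)) :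
    ∀ᵐ X ∂configMeasure s, annihilatedWave f Ψ (permute σ X) = annihilatedWave f Ψ X := by
  refine ae_config_iff.2 fun n => ?_
  -- This permutation of `n + 1` particles fixes the integrated particle `0` and moves the others by
  -- `σ n`.
  filter_upwards [ae_cons (ae_wave_sector_comp_perm Ψ
    (Equiv.Perm.decomposeFin.symm (0, σ n)))] with p hp
  simp only [annihilatedWave, permute]
  congr 1
  refine integral_congr_ae ?_
  filter_upwards [hp] with q hq
  rw [← hq]
  congr 3
  funext i
  refine Fin.cases ?_ (fun j => ?_) i <;> simp [Equiv.Perm.decomposeFin_symm_apply_succ]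

theorem IsAnnihilated.wave_eq {s : ℕ} {f : OneParticle s} {Ψ Φ : Fock s}
    (h : IsAnnihilated f Ψ Φ) : ∀ᵐ X ∂configMeasure s, wave Φ X = annihilatedWave f Ψ X :=
  ae_config_iff.2 h

/-! ## Energy bounds -/

theorem ae_wave_specProj {s : ℕ} (E : ℝ) (Ψ : Fock s) :
    ∀ᵐ X ∂configMeasure s, wave (specProj s E Ψ) X = if energy X < E then wave Ψ X else 0 := by
  filter_upwards [Multiplier.wave_apply _ Ψ] with X hX
  refine hX.trans ?_
  by_cases h : energy X < E <;> simp [h]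

theorem specProj_apply_eq_self {s : ℕ} {E : ℝ} {Ψ : Fock s} :
    specProj s E Ψ = Ψ ↔ ∀ᵐ X ∂configMeasure s, E ≤ energy X → wave Ψ X = 0 := by
  constructor
  · intro h
    have h1 := ae_wave_specProj E Ψ
    rw [h] at h1
    filter_upwards [h1] with X hX hE
    rw [hX, if_neg (not_lt.2 hE)]
  · intro h
    refine wave_ext ?_
    filter_upwards [ae_wave_specProj E Ψ, h] with X h1 h2
    rw [h1]
    split_ifs with h3
    · rfl
    · exact (h2 (not_lt.1 h3)).symm

theorem specProj_specProj {s : ℕ} (E : ℝ) (Ψ : Fock s) :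
    specProj s E (specProj s E Ψ) = specProj s E Ψ := by
  refine specProj_apply_eq_self.2 ?_
  filter_upwards [ae_wave_specProj E Ψ] with X hX hE
  rw [hX, if_neg (not_lt.2 hE)]

theorem energy_cons {s n : ℕ} (q : Mom s) (p : Fin n → Mom s) :
    energy (⟨n + 1, Fin.cons q p⟩ : Config s) = ‖q‖ + energy (⟨n, p⟩ : Config s) := by
  simp [energy, Fin.sum_univ_succ]

theorem energy_nonneg {s : ℕ} (X : Config s) : 0 ≤ energy X :=
  Finset.sum_nonneg fun _ _ => norm_nonneg _

/-- Removing a particle of momentum `q` lowers the energy by `|q| ≥ 0`, so `a(f)` preserves the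
range of `P_E`. -/
theorem IsAnnihilated.specProj_eq_self {s : ℕ} {E : ℝ} {f : OneParticle s} {Ψ Φ : Fock s}
    (h : IsAnnihilated f Ψ Φ) (hΨ : specProj s E Ψ = Ψ) : specProj s E Φ = Φ := by
  refine specProj_apply_eq_self.2 (ae_config_iff.2 fun n => ?_)
  filter_upwards [h n, ae_cons (ae_config_iff.1 (specProj_apply_eq_self.1 hΨ) (n + 1))]
    with p h1 h2 hE
  rw [h1, integral_eq_zero_of_ae, mul_zero]
  filter_upwards [h2] with q hq
  rw [hq, mul_zero, Pi.zero_apply]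
  rw [energy_cons]
  exact hE.trans (le_add_of_nonneg_left (norm_nonneg q))

/-- By symmetry every particle contributes equally to the energy. This is how the factor `n + 1`
from `√(n+1)` in `a(f)` is absorbed, uniformly in the particle number. -/
theorem lintegral_norm_zero_mul_wave {s n : ℕ} (Ψ : Fock s) :
    ∫⁻ X : Fin (n + 1) → Mom s, (n + 1) * (‖X 0‖ₑ * ‖wave Ψ ⟨n + 1, X⟩‖ₑ ^ 2)
      = ∫⁻ X : Fin (n + 1) → Mom s,
          ENNReal.ofReal (energy (⟨n + 1, X⟩ : Config s)) * ‖wave Ψ ⟨n + 1, X⟩‖ₑ ^ 2 := by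
  have hm : ∀ i : Fin (n + 1), Measurable fun X : Fin (n + 1) → Mom s =>
      ‖X i‖ₑ * ‖wave Ψ ⟨n + 1, X⟩‖ₑ ^ 2 := fun i =>
    (measurable_pi_apply i).enorm.mul ((measurable_wave_sector Ψ (n + 1)).enorm.pow_const 2)
  have h1 : ∀ i : Fin (n + 1), ∫⁻ X : Fin (n + 1) → Mom s, ‖X i‖ₑ * ‖wave Ψ ⟨n + 1, X⟩‖ₑ ^ 2
      = ∫⁻ X : Fin (n + 1) → Mom s, ‖X 0‖ₑ * ‖wave Ψ ⟨n + 1, X⟩‖ₑ ^ 2 := by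
    intro i
    rw [← (measurePreserving_comp_perm (s := s) (Equiv.swap 0 i)).lintegral_comp (hm i)]
    refine lintegral_congr_ae ?_
    filter_upwards [ae_wave_sector_comp_perm Ψ (Equiv.swap 0 i)] with X hX
    rw [hX]
    simp
  have h2 : ∀ X : Fin (n + 1) → Mom s,
      ENNReal.ofReal (energy (⟨n + 1, X⟩ : Config s)) * ‖wave Ψ ⟨n + 1, X⟩‖ₑ ^ 2
        = ∑ i, ‖X i‖ₑ * ‖wave Ψ ⟨n + 1, X⟩‖ₑ ^ 2 := by
    intro X
    rw [← Finset.sum_mul, energy, ENNReal.ofReal_sum_of_nonneg fun _ _ => norm_nonneg _]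
    simp only [ofReal_norm]
  simp_rw [h2]
  rw [lintegral_finsetSum _ fun i _ => hm i]
  simp_rw [h1]
  rw [lintegral_const_mul _ (hm 0)]
  simp

/-- `∑ₖ |⟨fₖ, φ⟩|² ≤ M ⟨φ, ω φ⟩` for the one-particle vectors `φ` of energy below `E`. -/
def LowEnergyBound {s : ℕ} {ι : Type*} [Fintype ι] (f : ι → OneParticle s) (E : ℝ) (M : ℝ≥0∞) :
    Prop :=
  ∀ φ : Mom s → ℂ, MemLp φ 2 → (∀ᵐ q, E ≤ ‖q‖ → φ q = 0) →
    ∑ k, ‖∫ q, conj (f k q) * φ q‖ₑ ^ 2 ≤ M * ∫⁻ q, ‖q‖ₑ * ‖φ q‖ₑ ^ 2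

/-- The one-particle bound is applied to the slice in the annihilated variable, the other momenta
being fixed. The resulting `∫ (n+1)|q| |Ψ|²` is the energy expectation in the sector `n + 1`, at
most `E` times the squared norm there. -/
theorem LowEnergyBound.lintegral_annihilatedWave_le {s : ℕ} {ι : Type*} [Fintype ι]
    {f : ι → OneParticle s} {E : ℝ} {M : ℝ≥0∞} (hf : LowEnergyBound f E M) {Ψ : Fock s}
    (hΨ : specProj s E Ψ = Ψ) :
    ∑ k, ∫⁻ X, ‖annihilatedWave (f k) Ψ X‖ₑ ^ 2 ∂configMeasure s
      ≤ M * ENNReal.ofReal E * ‖Ψ‖ₑ ^ 2 := by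
  have hE := specProj_apply_eq_self.1 hΨ
  have hm : ∀ k, Measurable fun X => ‖annihilatedWave (f k) Ψ X‖ₑ ^ 2 := fun k =>
    (measurable_annihilatedWave (f k) Ψ).enorm.pow_const 2
  rw [← lintegral_finsetSum _ fun k _ => hm k, lintegral_config]
  have key : ∀ n : ℕ, ∫⁻ p : Fin n → Mom s, ∑ k, ‖annihilatedWave (f k) Ψ ⟨n, p⟩‖ₑ ^ 2
      ≤ M * ENNReal.ofReal E * ∫⁻ X : Fin (n + 1) → Mom s, ‖wave Ψ ⟨n + 1, X⟩‖ₑ ^ 2 := by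
    intro n
    have hmw := measurable_wave_sector Ψ (n + 1)
    have hmF : Measurable fun X : Fin (n + 1) → Mom s =>
        (n + 1 : ℝ≥0∞) * (‖X 0‖ₑ * ‖wave Ψ ⟨n + 1, X⟩‖ₑ ^ 2) :=
      Measurable.const_mul ((measurable_pi_apply 0).enorm.mul (hmw.enorm.pow_const 2)) _
    have hmG : Measurable fun p : Fin n → Mom s => ∫⁻ q : Mom s, (n + 1 : ℝ≥0∞) *
        (‖q‖ₑ * ‖wave Ψ ⟨n + 1, Fin.cons q p⟩‖ₑ ^ 2) :=
      (hmF.comp (measurePreserving_cons s n).measurable).lintegral_prod_right'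
    calc ∫⁻ p : Fin n → Mom s, ∑ k, ‖annihilatedWave (f k) Ψ ⟨n, p⟩‖ₑ ^ 2
        ≤ ∫⁻ p : Fin n → Mom s, M * ∫⁻ q : Mom s, (n + 1 : ℝ≥0∞) *
            (‖q‖ₑ * ‖wave Ψ ⟨n + 1, Fin.cons q p⟩‖ₑ ^ 2) := by
          refine lintegral_mono_ae ?_
          filter_upwards [memLp_slice Ψ n, ae_cons (ae_config_iff.1 hE (n + 1))] with p h1 h2
          -- The slice vanishes for `|q| ≥ E` because the total energy is at least `|q|`.
          have h3 := hf _ h1 (by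
            filter_upwards [h2] with q hq hqE
            refine hq ?_
            rw [energy_cons]
            exact hqE.trans (le_add_of_nonneg_right (energy_nonneg _)))
          have hn : ‖((Real.sqrt (n + 1) : ℝ) : ℂ)‖ₑ ^ 2 = (n + 1 : ℝ≥0∞) := by
            rw [← enorm_pow, ← Complex.ofReal_pow, Real.sq_sqrt (by positivity)]
            have hc : (((n + 1 : ℝ)) : ℂ) = ((n + 1 : ℕ) : ℂ) := by push_cast; rfl
            rw [hc, ← ofReal_norm, Complex.norm_natCast, ENNReal.ofReal_natCast]
            push_cast
            rfl
          have hms : Measurable fun q : Mom s => ‖q‖ₑ * ‖wave Ψ ⟨n + 1, Fin.cons q p⟩‖ₑ ^ 2 :=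
            measurable_enorm.mul (((hmw.comp (measurePreserving_cons s n).measurable).comp
              measurable_prodMk_left).enorm.pow_const 2)
          simp only [annihilatedWave, enorm_mul, mul_pow, hn]
          rw [← Finset.mul_sum, lintegral_const_mul _ hms, mul_left_comm]
          gcongr
      _ = M * ∫⁻ X : Fin (n + 1) → Mom s, ENNReal.ofReal (energy (⟨n + 1, X⟩ : Config s)) *
            ‖wave Ψ ⟨n + 1, X⟩‖ₑ ^ 2 := by
          rw [lintegral_const_mul _ hmG, ← lintegral_norm_zero_mul_wave, lintegral_cons hmF]
          simp
      _ ≤ M * ∫⁻ X : Fin (n + 1) → Mom s, ENNReal.ofReal E * ‖wave Ψ ⟨n + 1, X⟩‖ₑ ^ 2 := by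
          gcongr M * ?_
          refine lintegral_mono_ae ?_
          filter_upwards [ae_config_iff.1 hE (n + 1)] with X hX
          rcases le_or_gt E (energy (⟨n + 1, X⟩ : Config s)) with h | h
          · simp [hX h]
          · gcongr
      _ = _ := by rw [lintegral_const_mul _ (hmw.enorm.pow_const 2), mul_assoc]
  refine (ENNReal.tsum_le_tsum key).trans ?_
  rw [ENNReal.tsum_mul_left, enorm_sq_eq_lintegral_wave]
  -- The shifted sum over `n + 1` omits only the vacuum component of `Ψ`.
  exact mul_le_mul' le_rfl <| ENNReal.tsum_comp_le_tsum_of_injective (add_left_injective 1)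
    (fun n => ∫⁻ X : Fin n → Mom s, ‖wave Ψ ⟨n, X⟩‖ₑ ^ 2)

theorem LowEnergyBound.sum_enorm_sq_le {s : ℕ} {ι : Type*} [Fintype ι]
    {f : ι → OneParticle s} {E : ℝ} {M : ℝ≥0∞} (hf : LowEnergyBound f E M) {Ψ : Fock s}
    (hΨ : specProj s E Ψ = Ψ) {Φ : ι → Fock s} (hΦ : ∀ k, IsAnnihilated (f k) Ψ (Φ k)) :
    ∑ k, ‖Φ k‖ₑ ^ 2 ≤ M * ENNReal.ofReal E * ‖Ψ‖ₑ ^ 2 := by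
  refine le_of_eq_of_le (Finset.sum_congr rfl fun k _ => ?_) (hf.lintegral_annihilatedWave_le hΨ)
  rw [enorm_sq_eq_lintegral_wave, ← lintegral_config (fun X => ‖wave (Φ k) X‖ₑ ^ 2)]
  refine lintegral_congr_ae ?_
  filter_upwards [(hΦ k).wave_eq] with X hX
  rw [hX]

/-- The same estimate shows that the formal wave function of `a(f)Ψ` is square integrable, so `Ψ`
lies in the domain. -/
theorem LowEnergyBound.exists_isAnnihilated {s : ℕ} {f : OneParticle s} {E : ℝ} {M : ℝ≥0∞}
    (hM : M ≠ ⊤) (hf : LowEnergyBound (fun _ : Unit => f) E M) {Ψ : Fock s}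
    (hΨ : specProj s E Ψ = Ψ) : ∃ Φ, IsAnnihilated f Ψ Φ := by
  have h1 := hf.lintegral_annihilatedWave_le hΨ
  have h2 : MemLp (annihilatedWave f Ψ) 2 (configMeasure s) := by
    refine ⟨(measurable_annihilatedWave f Ψ).aestronglyMeasurable, ?_⟩
    rw [eLpNorm_lt_top_iff_lintegral_rpow_enorm_lt_top two_ne_zero ENNReal.ofNat_ne_top]
    simp only [ENNReal.toReal_ofNat, ENNReal.rpow_ofNat]
    simp only [Finset.univ_unique, Finset.sum_singleton] at h1
    refine h1.trans_lt ?_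
    exact ENNReal.mul_lt_top (ENNReal.mul_lt_top hM.lt_top ENNReal.ofReal_lt_top) (by simp)
  exact ⟨Fock.ofWave _ h2 (annihilatedWave_permute f Ψ),
    ae_config_iff.1 (wave_ofWave _ h2 (annihilatedWave_permute f Ψ))⟩

/-! ## Products of annihilation operators on vectors of bounded energy -/

theorem LowEnergyBound.sum_norm_sq_le {s : ℕ} {ι : Type*} [Fintype ι]
    {f : ι → OneParticle s} {E m : ℝ} (hE : 0 ≤ E) (hm : 0 ≤ m)
    (hf : LowEnergyBound f E (ENNReal.ofReal m)) {Ψ : Fock s}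
    {Φ : ι → Fock s} (hΦ : ∀ k, IsAnnihilated (f k) (specProj s E Ψ) (Φ k)) :
    ∑ k, ‖Φ k‖ ^ 2 ≤ m * E * ‖Ψ‖ ^ 2 := by
  have h1 := hf.sum_enorm_sq_le (specProj_specProj E Ψ) hΦ
  have h2 : ‖specProj s E Ψ‖ ≤ ‖Ψ‖ := by
    refine norm_le_of_wave ?_
    filter_upwards [ae_wave_specProj E Ψ] with X hX
    rw [hX]
    split_ifs <;> simp
  have h3 : ∑ k, ‖Φ k‖ ^ 2 ≤ m * E * ‖specProj s E Ψ‖ ^ 2 := by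
    rw [← ENNReal.ofReal_le_ofReal_iff (by positivity),
      ENNReal.ofReal_sum_of_nonneg fun _ _ => by positivity, ENNReal.ofReal_mul (by positivity),
      ENNReal.ofReal_mul hm]
    simpa only [ENNReal.ofReal_pow (norm_nonneg _), ofReal_norm] using h1
  exact h3.trans (by gcongr)

/-- `A = a(f) P_E`. -/
def IsLowAnnihilator {s : ℕ} (E : ℝ) (f : OneParticle s) (A : BddOp s) : Prop :=
  ∀ Ψ : Fock s, IsAnnihilated f (specProj s E Ψ) (A Ψ)

theorem LowEnergyBound.exists_isLowAnnihilator {s : ℕ} {f : OneParticle s} {E m : ℝ}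
    (hE : 0 ≤ E) (hm : 0 ≤ m)
    (hf : LowEnergyBound (fun _ : Unit => f) E (ENNReal.ofReal (m ^ 2))) :
    ∃ A : BddOp s, IsLowAnnihilator E f A ∧ ‖A‖ ≤ m * Real.sqrt E := by
  have h1 : ∀ Ψ : Fock s, ∃ Φ, IsAnnihilated f (specProj s E Ψ) Φ := fun Ψ =>
    hf.exists_isAnnihilated ENNReal.ofReal_ne_top (specProj_specProj E Ψ)
  choose a ha using h1
  let A : Fock s →ₗ[ℂ] Fock s :=
    { toFun := a
      map_add' := fun Ψ Φ => by
        refine IsAnnihilated.unique (ha (Ψ + Φ)) ?_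
        rw [map_add]
        exact (ha Ψ).add (ha Φ)
      map_smul' := fun c Ψ => by
        refine IsAnnihilated.unique (ha (c • Ψ)) ?_
        rw [map_smul]
        exact (ha Ψ).smul c }
  have hA : ∀ Ψ, ‖A Ψ‖ ≤ m * Real.sqrt E * ‖Ψ‖ := by
    intro Ψ
    have h2 := hf.sum_norm_sq_le hE (sq_nonneg m) (fun _ => ha Ψ)
    refine (sq_le_sq₀ (norm_nonneg _) (by positivity)).1 ?_
    rw [mul_pow, mul_pow, Real.sq_sqrt hE]
    simpa [A] using h2
  exact ⟨A.mkContinuous _ hA, ha, A.mkContinuous_norm_le (by positivity) hA⟩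

theorem Multiplier.norm_op_le {s : ℕ} (m : Multiplier s) : ‖m.op‖ ≤ 1 := by
  refine m.op.opNorm_le_bound zero_le_one fun Ψ => ?_
  rw [one_mul]
  refine norm_le_of_wave ?_
  filter_upwards [m.wave_apply Ψ] with X hX
  change ‖wave (m.apply Ψ) X‖ ≤ _
  rw [hX, norm_mul]
  exact mul_le_of_le_one_left (norm_nonneg _) (m.bound X)

theorem norm_specProj_le (s : ℕ) (E : ℝ) : ‖specProj s E‖ ≤ 1 :=
  Multiplier.norm_op_le _

theorem IsAnnihilatedList.unique {s : ℕ} {l : List (OneParticle s)}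
    {Ψ Φ Φ' : Fock s} (h : IsAnnihilatedList l Ψ Φ) (h' : IsAnnihilatedList l Ψ Φ') :
    Φ = Φ' := by
  induction l generalizing Φ Φ' with
  | nil => rw [show Φ = Ψ from h, show Φ' = Ψ from h']
  | cons f l ih =>
    obtain ⟨Φ₁, h1, h2⟩ := h
    obtain ⟨Φ₂, h3, h4⟩ := h'
    rw [ih h1 h3] at h2
    exact h2.unique h4

/-- The last entry of a list acts first, so an appended operator acts before all of `l`. -/
theorem isAnnihilatedList_concat {s : ℕ} {l : List (OneParticle s)} {f : OneParticle s}
    {Ψ Φ Φ' : Fock s} (h : IsAnnihilated f Ψ Φ') (h' : IsAnnihilatedList l Φ' Φ) :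
    IsAnnihilatedList (l ++ [f]) Ψ Φ := by
  induction l generalizing Φ with
  | nil => exact ⟨Ψ, rfl, by rwa [show Φ = Φ' from h']⟩
  | cons g l ih =>
    obtain ⟨Φ₁, h1, h2⟩ := h'
    exact ⟨Φ₁, ih h1, h2⟩

/-- The result of annihilation is unique, so the choice in `annihilator` is no choice at all. -/
theorem IsAnnihilator.annihilator_eq {s : ℕ} {E : ℝ} {l : List (OneParticle s)} {B : BddOp s}
    (h : IsAnnihilator E l B) : annihilator E l = B := by
  have hex : ∃ B, IsAnnihilator E l B := ⟨B, h⟩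
  rw [annihilator, dif_pos hex]
  ext1 Ψ
  exact IsAnnihilatedList.unique (hex.choose_spec Ψ) (h Ψ)

theorem isAnnihilator_nil {s : ℕ} (E : ℝ) :
    IsAnnihilator E ([] : List (OneParticle s)) (specProj s E) := fun _ => rfl

theorem IsAnnihilator.concat {s : ℕ} {E : ℝ} {l : List (OneParticle s)} {f : OneParticle s}
    {A B : BddOp s} (hB : IsAnnihilator E l B) (hA : IsLowAnnihilator E f A) :
    IsAnnihilator E (l ++ [f]) (B.comp A) := by
  intro Ψ
  -- `A Ψ` again has energy below `E`, so the projection contained in `B` acts trivially on it.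
  have h1 := (hA Ψ).specProj_eq_self (specProj_specProj E Ψ)
  have h2 := hB (A Ψ)
  rw [h1] at h2
  exact isAnnihilatedList_concat (hA Ψ) h2

/-- Induction from the right end: `a(f₁)⋯a(fₖ)P_E` is the product of the operators `a(fᵢ)P_E`, each
of which costs a factor `w √E`. -/
theorem exists_isAnnihilator {s : ℕ} {α : Type*} {E : ℝ} (hE : 0 ≤ E) {f : α → OneParticle s}
    {w : α → ℝ} (hw : ∀ a, 0 ≤ w a)
    (hf : ∀ a, LowEnergyBound (fun _ : Unit => f a) E (ENNReal.ofReal (w a ^ 2))) (l : List α) :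
    ∃ B : BddOp s, IsAnnihilator E (l.map f) B ∧
      ‖B‖ ≤ Real.sqrt E ^ l.length * (l.map w).prod := by
  induction l using List.reverseRecOn with
  | nil => exact ⟨specProj s E, isAnnihilator_nil E, by simpa using norm_specProj_le s E⟩
  | append_singleton l a ih =>
    obtain ⟨B, hB, hB'⟩ := ih
    obtain ⟨A, hA, hA'⟩ := (hf a).exists_isLowAnnihilator hE (hw a)
    refine ⟨B.comp A, by simpa using hB.concat hA, ?_⟩
    refine (B.opNorm_comp_le A).trans ?_
    have hp : 0 ≤ (l.map w).prod := List.prod_nonneg (by simpa using fun a _ => hw a)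
    calc ‖B‖ * ‖A‖ ≤ (Real.sqrt E ^ l.length * (l.map w).prod) * (w a * Real.sqrt E) := by gcongr
      _ = _ := by
        simp only [List.length_append, List.length_singleton, List.map_append, List.prod_append,
          List.map_cons, List.map_nil, List.prod_cons, List.prod_nil]
        ring

/-! ## Translations -/

/-- The phase `e^{i(|p| x⁰ - p·x⃗)}`. -/
def planePhase {s : ℕ} (x : Spacetime s) (p : Mom s) : ℂ :=
  Complex.exp (Complex.I * ((‖p‖ * x.1 - ⟪p, x.2⟫_ℝ : ℝ) : ℂ))

theorem norm_planePhase {s : ℕ} (x : Spacetime s) (p : Mom s) : ‖planePhase x p‖ = 1 := by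
  rw [planePhase, mul_comm, Complex.norm_exp_ofReal_mul_I]

theorem continuous_planePhase {s : ℕ} (x : Spacetime s) : Continuous (planePhase x) := by
  unfold planePhase
  fun_prop

theorem conj_planePhase_mul {s : ℕ} (x y : Spacetime s) (p : Mom s) :
    conj (planePhase x p) * planePhase y p = planePhase (y - x) p := by
  simp only [planePhase, ← Complex.exp_conj, ← Complex.exp_add, Prod.fst_sub, Prod.snd_sub,
    inner_sub_right, map_mul, Complex.conj_I, Complex.conj_ofReal]
  congr 1
  push_cast
  ring

theorem memLp_planePhase_mul {s : ℕ} (x : Spacetime s) (f : OneParticle s) :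
    MemLp (fun p => planePhase x p * f p) 2 := by
  refine (Lp.memLp f).of_le
    ((continuous_planePhase x).aestronglyMeasurable.mul (Lp.memLp f).1)
    (Filter.Eventually.of_forall fun p => ?_)
  rw [norm_mul, norm_planePhase, one_mul]

/-- The vector `U₁(x) f`. -/
def translateOne {s : ℕ} (x : Spacetime s) (f : OneParticle s) : OneParticle s :=
  (memLp_planePhase_mul x f).toLp _

theorem ae_translateOne {s : ℕ} (x : Spacetime s) (f : OneParticle s) :
    ∀ᵐ p, translateOne x f p = planePhase x p * f p :=
  (memLp_planePhase_mul x f).coeFn_toLp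

theorem ae_wave_translation {s : ℕ} (x : Spacetime s) (Ψ : Fock s) :
    ∀ᵐ X ∂configMeasure s,
      wave (translation x Ψ) X = Complex.exp (Complex.I * (phase x X : ℂ)) * wave Ψ X :=
  Multiplier.wave_apply _ Ψ

theorem exp_phase_cons {s n : ℕ} (x : Spacetime s) (q : Mom s) (p : Fin n → Mom s) :
    Complex.exp (Complex.I * (phase x (⟨n + 1, Fin.cons q p⟩ : Config s) : ℂ))
      = planePhase x q * Complex.exp (Complex.I * (phase x (⟨n, p⟩ : Config s) : ℂ)) := by
  rw [planePhase, ← Complex.exp_add, ← mul_add]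
  simp only [phase, Fin.sum_univ_succ, Fin.cons_zero, Fin.cons_succ]
  push_cast
  rfl

/-- Covariance `U(x) a(f) = a(U₁(x) f) U(x)`: the phase of `n + 1` particles factorizes, and the
factor of the annihilated one cancels against that of `U₁(x) f`. -/
theorem IsAnnihilated.translate {s : ℕ} {f : OneParticle s} {Ψ Φ : Fock s} (x : Spacetime s)
    (h : IsAnnihilated f Ψ Φ) :
    IsAnnihilated (translateOne x f) (translation x Ψ) (translation x Φ) := by
  intro n
  filter_upwards [h n, ae_config_iff.1 (ae_wave_translation x Φ) n,
    ae_cons (ae_config_iff.1 (ae_wave_translation x Ψ) (n + 1))] with p h1 h2 h3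
  have h4 : ∫ q : Mom s, conj (translateOne x f q) * wave (translation x Ψ) ⟨n + 1, Fin.cons q p⟩
      = ∫ q : Mom s, Complex.exp (Complex.I * (phase x (⟨n, p⟩ : Config s) : ℂ)) *
        (conj (f q) * wave Ψ ⟨n + 1, Fin.cons q p⟩) := by
    refine integral_congr_ae ?_
    filter_upwards [h3, ae_translateOne x f] with q hq hq'
    rw [hq, hq', exp_phase_cons, map_mul]
    have h5 : conj (planePhase x q) * planePhase x q = 1 := by
      rw [mul_comm, Complex.mul_conj, Complex.normSq_eq_norm_sq, norm_planePhase]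
      simp
    linear_combination (conj (f q) * Complex.exp (Complex.I * (phase x (⟨n, p⟩ : Config s) : ℂ))
      * wave Ψ ⟨n + 1, Fin.cons q p⟩) * h5
  rw [h2, h1, h4, integral_const_mul, mul_left_comm]

theorem translation_neg_translation {s : ℕ} (x : Spacetime s) (Ψ : Fock s) :
    translation (-x) (translation x Ψ) = Ψ := by
  refine wave_ext ?_
  filter_upwards [ae_wave_translation (-x) (translation x Ψ), ae_wave_translation x Ψ]
    with X h1 h2
  have h3 : phase (-x) X = -phase x X := by
    simp only [phase, ← Finset.sum_neg_distrib]
    refine Finset.sum_congr rfl fun i _ => ?_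
    simp
    ring
  rw [h1, h2, ← mul_assoc, ← Complex.exp_add, h3]
  simp

theorem norm_translation_le {s : ℕ} (x : Spacetime s) : ‖translation x‖ ≤ 1 :=
  Multiplier.norm_op_le _

theorem norm_translation_apply {s : ℕ} (x : Spacetime s) (Ψ : Fock s) :
    ‖translation x Ψ‖ = ‖Ψ‖ := by
  have h : ∀ (y : Spacetime s) (Φ : Fock s), ‖translation y Φ‖ ≤ ‖Φ‖ := fun y Φ => by
    simpa using (translation y).le_of_opNorm_le (norm_translation_le y) Φ
  refine le_antisymm (h x Ψ) ?_
  conv_lhs => rw [← translation_neg_translation x Ψ]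
  exact h _ _

theorem adjoint_translation {s : ℕ} (x : Spacetime s) :
    ContinuousLinearMap.adjoint (translation x) = translation (-x) := by
  symm
  rw [ContinuousLinearMap.eq_adjoint_iff]
  intro Ψ Φ
  have h : ⟪translation x (translation (-x) Ψ), translation x Φ⟫_ℂ = ⟪translation (-x) Ψ, Φ⟫_ℂ :=
    (LinearMap.norm_map_iff_inner_map_map (translation x)).1 (norm_translation_apply x) _ _
  rw [← h]
  have h2 := translation_neg_translation (-x) Ψ
  rw [neg_neg] at h2
  rw [h2]

theorem translation_adjoint_translation {s : ℕ} (x : Spacetime s) (Ψ : Fock s) :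
    translation x (ContinuousLinearMap.adjoint (translation x) Ψ) = Ψ := by
  rw [adjoint_translation]
  simpa using translation_neg_translation (-x) Ψ

theorem specProj_translation {s : ℕ} (E : ℝ) (x : Spacetime s) (Ψ : Fock s) :
    specProj s E (translation x Ψ) = translation x (specProj s E Ψ) := by
  refine wave_ext ?_
  filter_upwards [ae_wave_specProj E (translation x Ψ), ae_wave_translation x Ψ,
    ae_wave_translation x (specProj s E Ψ), ae_wave_specProj E Ψ] with X h1 h2 h3 h4
  rw [h1, h2, h3, h4]
  split_ifs <;> simp

/-! ## Bounds on the functionals `S_{μ̄,ν̄}` -/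

theorem inner_eq_integral_wave {s : ℕ} (Ψ Φ : Fock s) :
    ⟪Ψ, Φ⟫_ℂ = ∫ X, ⟪wave Ψ X, wave Φ X⟫_ℂ ∂configMeasure s :=
  L2.inner_def (𝕜 := ℂ) (Fock.incl s Ψ).toL2 (Fock.incl s Φ).toL2

theorem adjoint_specProj (s : ℕ) (E : ℝ) :
    ContinuousLinearMap.adjoint (specProj s E) = specProj s E := by
  symm
  rw [ContinuousLinearMap.eq_adjoint_iff]
  intro Ψ Φ
  rw [inner_eq_integral_wave, inner_eq_integral_wave]
  refine integral_congr_ae ?_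
  filter_upwards [ae_wave_specProj E Ψ, ae_wave_specProj E Φ] with X h1 h2
  rw [h1, h2]
  split_ifs <;> simp

theorem norm_vacuum (s : ℕ) : ‖vacuum s‖ = 1 := by
  have h1 := ae_config_iff.1 (wave_ofWave _
    (memLp_indicator_const 2 (vacuum_measurableSet s) (1 : ℂ) (Or.inr (vacuum_measure_ne_top s)))
    fun _ => Filter.Eventually.of_forall fun _ => rfl)
  have h2 : ‖vacuum s‖ₑ ^ 2 = 1 := by
    rw [enorm_sq_eq_lintegral_wave, tsum_eq_single 0]
    · have h3 : ∀ᵐ p : Fin 0 → Mom s, ‖wave (vacuum s) ⟨0, p⟩‖ₑ ^ 2 = 1 := by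
        filter_upwards [h1 0] with p hp
        have h4 : wave (vacuum s) ⟨0, p⟩ = 1 := hp.trans (by simp)
        rw [h4]
        simp
      rw [lintegral_congr_ae h3]
      simp [volume_pi]
    · intro n hn
      have h3 : ∀ᵐ p : Fin n → Mom s, ‖wave (vacuum s) ⟨n, p⟩‖ₑ ^ 2 = 0 := by
        filter_upwards [h1 n] with p hp
        have h4 : wave (vacuum s) ⟨n, p⟩ = 0 := hp.trans (by simp [hn])
        rw [h4]
        simp
      rw [lintegral_congr_ae h3]
      simp
  rw [← ofReal_norm, ← ENNReal.ofReal_pow (norm_nonneg _), ENNReal.ofReal_eq_one] at h2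
  exact (pow_eq_one_iff_of_nonneg (norm_nonneg _) two_ne_zero).1 h2

theorem specProj_vacuum {s : ℕ} {E : ℝ} (hE : 0 < E) : specProj s E (vacuum s) = vacuum s := by
  refine specProj_apply_eq_self.2 ?_
  filter_upwards [wave_ofWave _
    (memLp_indicator_const 2 (vacuum_measurableSet s) (1 : ℂ) (Or.inr (vacuum_measure_ne_top s)))
    fun _ => Filter.Eventually.of_forall fun _ => rfl] with X hX hEX
  refine hX.trans (Set.indicator_of_notMem ?_ _)
  rintro (h : X.1 = 0)
  obtain ⟨n, p⟩ := X
  subst h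
  simp [energy] at hEX
  linarith

theorem specProj_eq_zero {s : ℕ} {E : ℝ} (hE : E ≤ 0) : specProj s E = 0 := by
  ext1 Ψ
  refine wave_ext ?_
  have h0 : ∀ᵐ X ∂configMeasure s, wave (0 : Fock s) X = 0 := Lp.coeFn_zero _ _ _
  filter_upwards [ae_wave_specProj E Ψ, h0] with X h1 h2
  rw [h1, if_neg (not_lt.2 (hE.trans (energy_nonneg X)))]
  exact h2.symm

theorem dualTranslation_apply {s : ℕ} (x : Spacetime s) (φ : Functional s) (A : BddOp s) :
    dualTranslation x φ A
      = φ (translation x * A * ContinuousLinearMap.adjoint (translation x)) := rfl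

/-- A functional in `𝒯_E` takes the same value on `1` and on `P_E`, and for `E > 0` so does the
vacuum state, as `P_E Ω = Ω`. For `E ≤ 0` the strict inequality in the definition makes `P_E` zero.
-/
theorem apply_specProj_eq_zero {s : ℕ} {E : ℝ} {φ : Functional s}
    (hφ : φ ∈ centeredFunctionals s E) : φ (specProj s E) = 0 := by
  obtain ⟨_, ⟨ψ, -, rfl⟩, rfl⟩ := hφ
  have hP : specProj s E * specProj s E = specProj s E :=
    ContinuousLinearMap.ext (specProj_specProj E)
  rcases le_or_gt E 0 with hE | hE
  · simp [specProj_eq_zero hE]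
  · have h1 : vacuumState s (specProj s E) = 1 := by
      change ⟪vacuum s, specProj s E (vacuum s)⟫_ℂ = 1
      rw [specProj_vacuum hE, inner_self_eq_norm_sq_to_K, norm_vacuum]
      simp
    simp [h1, hP]

theorem dualTranslation_specProj {s : ℕ} (E : ℝ) (x : Spacetime s) (φ : Functional s) :
    dualTranslation x φ (specProj s E) = φ (specProj s E) := by
  rw [dualTranslation_apply]
  congr 1
  ext1 Ψ
  change translation x (specProj s E (ContinuousLinearMap.adjoint (translation x) Ψ)) = _
  rw [← specProj_translation, translation_adjoint_translation]

/-- Duality in `ℓ²`: testing with `zₖ = conj φ(Aₖ)` gives `Q ≤ K √Q` for the sum `Q` to be bounded.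
-/
theorem sum_norm_sq_apply_le {H : Type*} [NormedAddCommGroup H] [NormedSpace ℂ H]
    {ι : Type*} [Fintype ι] {A : ι → H} {K : ℝ}
    (hA : ∀ z : ι → ℂ, ‖∑ k, z k • A k‖ ≤ K * Real.sqrt (∑ k, ‖z k‖ ^ 2))
    {φ : H →L[ℂ] ℂ} (hφ : ‖φ‖ ≤ 1) : ∑ k, ‖φ (A k)‖ ^ 2 ≤ K ^ 2 := by
  set Q : ℝ := ∑ k, ‖φ (A k)‖ ^ 2 with hQ
  have hQ0 : 0 ≤ Q := Finset.sum_nonneg fun _ _ => sq_nonneg _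
  have h1 : φ (∑ k, conj (φ (A k)) • A k) = (Q : ℂ) := by
    simp only [map_sum, map_smul, smul_eq_mul, hQ, Complex.ofReal_sum]
    refine Finset.sum_congr rfl fun k _ => ?_
    rw [mul_comm, Complex.mul_conj, Complex.normSq_eq_norm_sq]
  have h2 : Q ≤ K * Real.sqrt Q := by
    calc Q = ‖φ (∑ k, conj (φ (A k)) • A k)‖ := by
          rw [h1, Complex.norm_real, Real.norm_of_nonneg hQ0]
      _ ≤ 1 * ‖∑ k, conj (φ (A k)) • A k‖ := φ.le_of_opNorm_le hφ _
      _ ≤ K * Real.sqrt Q := by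
          rw [one_mul]
          simpa [RCLike.norm_conj, hQ] using hA fun k => conj (φ (A k))
  have h3 : Real.sqrt Q * Real.sqrt Q = Q := Real.mul_self_sqrt hQ0
  have h4 : 0 ≤ Real.sqrt Q := Real.sqrt_nonneg Q
  -- `2Q ≤ 2K√Q ≤ K² + Q`, which needs neither a sign of `K` nor `Q ≠ 0`.
  nlinarith [sq_nonneg (K - Real.sqrt Q)]

/-- The translates of `A = a(f)P_E` are `a(U₁(xₖ)f)P_E`, whose squared norms on a fixed vector are
summable with bound `M E`. The unitaries and `C` to the left are estimated termwise in norm, and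
Cauchy–Schwarz combines the coefficients with the vectors. -/
theorem norm_sum_smul_translates_le {s : ℕ} {ι : Type*} [Fintype ι] {E M : ℝ} (hE : 0 ≤ E)
    (hM : 0 ≤ M) {x : ι → Spacetime s} {f : OneParticle s} {A C : BddOp s}
    (hA : IsLowAnnihilator E f A)
    (hf : LowEnergyBound (fun k => translateOne (x k) f) E (ENNReal.ofReal M)) (z : ι → ℂ) :
    ‖∑ k, z k • (translation (x k) * (C * A) * ContinuousLinearMap.adjoint (translation (x k)))‖
      ≤ ‖C‖ * Real.sqrt (M * E) * Real.sqrt (∑ k, ‖z k‖ ^ 2) := by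
  refine ContinuousLinearMap.opNorm_le_bound _ (by positivity) fun Ψ => ?_
  set D : ι → Fock s := fun k =>
    A (ContinuousLinearMap.adjoint (translation (x k)) Ψ) with hD
  have h1 : ∀ k, IsAnnihilated (translateOne (x k) f) (specProj s E Ψ)
      (translation (x k) (D k)) := by
    intro k
    have h2 := (hA (ContinuousLinearMap.adjoint (translation (x k)) Ψ)).translate (x k)
    rwa [← specProj_translation, translation_adjoint_translation] at h2
  have h3 := hf.sum_norm_sq_le hE hM h1
  simp only [norm_translation_apply] at h3
  rw [sum_apply]
  calc ‖∑ k, (z k • (translation (x k) * (C * A) *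
          ContinuousLinearMap.adjoint (translation (x k)))) Ψ‖
      ≤ ∑ k, ‖z k‖ * (‖C‖ * ‖D k‖) := by
        refine (norm_sum_le _ _).trans (Finset.sum_le_sum fun k _ => ?_)
        rw [smul_apply, norm_smul]
        gcongr
        change ‖translation (x k) (C (D k))‖ ≤ _
        rw [norm_translation_apply]
        exact C.le_opNorm _
    _ = ‖C‖ * ∑ k, ‖z k‖ * ‖D k‖ := by
        rw [Finset.mul_sum]
        exact Finset.sum_congr rfl fun k _ => by ring
    _ ≤ ‖C‖ * (Real.sqrt (∑ k, ‖z k‖ ^ 2) * Real.sqrt (∑ k, ‖D k‖ ^ 2)) := by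
        gcongr
        exact Real.sum_mul_le_sqrt_mul_sqrt _ _ _
    _ ≤ ‖C‖ * (Real.sqrt (∑ k, ‖z k‖ ^ 2) * (Real.sqrt (M * E) * ‖Ψ‖)) := by
        gcongr
        rw [← Real.sqrt_sq (norm_nonneg Ψ), ← Real.sqrt_mul (by positivity)]
        exact Real.sqrt_le_sqrt h3
    _ = _ := by ring

/-- Schur test: row sums of the Gram matrix bound its operator norm, hence also the norm of the
analysis map `φ ↦ (⟨gₖ, φ⟩)ₖ`. The reduction is Cauchy–Schwarz for `∑ cₖ gₖ` and `φ`, with `cₖ =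
⟨gₖ, φ⟩`. -/
theorem sum_norm_inner_sq_le {H : Type*} [NormedAddCommGroup H] [InnerProductSpace ℂ H]
    {ι : Type*} [Fintype ι] {g : ι → H} {R : ℝ} (hR : 0 ≤ R)
    (hg : ∀ i, ∑ j, ‖⟪g i, g j⟫_ℂ‖ ≤ R) (φ : H) :
    ∑ k, ‖⟪g k, φ⟫_ℂ‖ ^ 2 ≤ R * ‖φ‖ ^ 2 := by
  set c : ι → ℂ := fun k => ⟪g k, φ⟫_ℂ with hc
  set Q : ℝ := ∑ k, ‖c k‖ ^ 2 with hQ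
  have hQ0 : 0 ≤ Q := Finset.sum_nonneg fun _ _ => sq_nonneg _
  have h1 : ⟪∑ k, c k • g k, φ⟫_ℂ = (Q : ℂ) := by
    simp only [sum_inner, inner_smul_left, hQ, Complex.ofReal_sum]
    refine Finset.sum_congr rfl fun k _ => ?_
    change conj (c k) * c k = _
    rw [mul_comm, Complex.mul_conj, Complex.normSq_eq_norm_sq]
  have h2 : Q ≤ ‖∑ k, c k • g k‖ * ‖φ‖ := by
    have h := norm_inner_le_norm (𝕜 := ℂ) (∑ k, c k • g k) φ
    rwa [h1, Complex.norm_real, Real.norm_of_nonneg hQ0] at h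
  have h3 : ‖∑ k, c k • g k‖ ^ 2 ≤ R * Q := by
    have h4 : ‖∑ k, c k • g k‖ ^ 2 ≤ ∑ i, ∑ j, ‖c i‖ * ‖c j‖ * ‖⟪g i, g j⟫_ℂ‖ := by
      have h5 : ‖∑ k, c k • g k‖ ^ 2 = ‖⟪∑ k, c k • g k, ∑ k, c k • g k⟫_ℂ‖ := by
        rw [inner_self_eq_norm_sq_to_K]
        simp
      rw [h5, sum_inner]
      refine (norm_sum_le _ _).trans (Finset.sum_le_sum fun i _ => ?_)
      rw [inner_sum]
      refine (norm_sum_le _ _).trans (Finset.sum_le_sum fun j _ => ?_)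
      rw [inner_smul_left, inner_smul_right, norm_mul, norm_mul, RCLike.norm_conj, mul_assoc]
    have h6 : ∀ i j, ‖⟪g i, g j⟫_ℂ‖ = ‖⟪g j, g i⟫_ℂ‖ := fun i j => norm_inner_symm _ _
    calc _ ≤ ∑ i, ∑ j, ‖c i‖ * ‖c j‖ * ‖⟪g i, g j⟫_ℂ‖ := h4
      _ ≤ ∑ i, ∑ j, (‖c i‖ ^ 2 * ‖⟪g i, g j⟫_ℂ‖ / 2 + ‖c j‖ ^ 2 * ‖⟪g i, g j⟫_ℂ‖ / 2) := by
          gcongr with i _ j _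
          -- `|cᵢ||cⱼ| ≤ (|cᵢ|² + |cⱼ|²)/2`; by symmetry of the matrix both halves give row sums.
          nlinarith [mul_nonneg (sq_nonneg (‖c i‖ - ‖c j‖)) (norm_nonneg ⟪g i, g j⟫_ℂ)]
      _ = ∑ i, ‖c i‖ ^ 2 * ∑ j, ‖⟪g i, g j⟫_ℂ‖ := by
          simp only [Finset.sum_add_distrib]
          rw [Finset.sum_comm (f := fun i j => ‖c j‖ ^ 2 * ‖⟪g i, g j⟫_ℂ‖ / 2)]
          simp only [h6, ← Finset.sum_add_distrib, Finset.mul_sum]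
          refine Finset.sum_congr rfl fun i _ => Finset.sum_congr rfl fun j _ => ?_
          ring
      _ ≤ ∑ i, ‖c i‖ ^ 2 * R := by
          gcongr with i _
          exact hg i
      _ = R * Q := by rw [← Finset.sum_mul, mul_comm]
  rcases hQ0.eq_or_lt with hQ1 | hQ1
  · rw [← hQ1]
    positivity
  · have h9 : Q * Q ≤ R * ‖φ‖ ^ 2 * Q := by
      calc Q * Q ≤ (‖∑ k, c k • g k‖ * ‖φ‖) * (‖∑ k, c k • g k‖ * ‖φ‖) := by gcongr
        _ = ‖∑ k, c k • g k‖ ^ 2 * ‖φ‖ ^ 2 := by ring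
        _ ≤ R * Q * ‖φ‖ ^ 2 := by gcongr
        _ = _ := by ring
    exact le_of_mul_le_mul_right h9 hQ1

/-- Moving the multiplier across, `⟨fₖ, φ⟩ = ⟨gₖ, φ/m⟩`. The Schur test gives the factor `R`, and
`m⁻² ≤ S|q|` bounds `‖φ/m‖²` by `S ⟨φ, ωφ⟩`. It is used with `m = |p|^{-1/2}` for single vectors and
with `m = |p|^{-1/2}|h̃|` for families of translates. -/
theorem lowEnergyBound_of_gram {s : ℕ} {ι : Type*} [Fintype ι] {f g : ι → OneParticle s}
    {m : Mom s → ℝ} (hm : Measurable m) (hg : ∀ k, ∀ᵐ p, g k p = (m p : ℂ) * f k p)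
    {E S R : ℝ} (hE : 0 ≤ E) (hS0 : 0 ≤ S) (hR0 : 0 ≤ R)
    (hS : ∀ᵐ q, ‖q‖ < E → m q ≠ 0 ∧ (m q ^ 2)⁻¹ ≤ S * ‖q‖)
    (hR : ∀ i, ∑ j, ‖⟪g i, g j⟫_ℂ‖ ≤ R) : LowEnergyBound f E (ENNReal.ofReal (R * S)) := by
  intro φ hφ hφE
  set φ' : Mom s → ℂ := fun q => ((m q)⁻¹ : ℝ) * φ q with hφ'
  have hb : ∀ᵐ q, ‖φ' q‖ ^ 2 ≤ S * (‖q‖ * ‖φ q‖ ^ 2) := by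
    filter_upwards [hS, hφE] with q h1 h2
    rcases lt_or_ge ‖q‖ E with h | h
    · simp only [hφ', norm_mul, mul_pow, Complex.norm_real, Real.norm_eq_abs, sq_abs]
      rw [← mul_assoc, inv_pow]
      gcongr
      exact (h1 h).2
    · simp [hφ', h2 h]
  -- The energy cutoff enters here only to make `φ/m` square integrable; `E` does not appear in the
  -- final bound.
  have hb2 : ∀ᵐ q, ‖φ' q‖ ≤ Real.sqrt (S * E) * ‖φ q‖ := by
    filter_upwards [hb, hφE] with q h1 h2
    rcases lt_or_ge ‖q‖ E with h | h
    · refine (sq_le_sq₀ (norm_nonneg _) (by positivity)).1 (h1.trans ?_)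
      rw [mul_pow, Real.sq_sqrt (by positivity), ← mul_assoc]
      gcongr
    · simp [hφ', h2 h]
  have hL : MemLp φ' 2 := by
    refine (hφ.const_mul ((Real.sqrt (S * E) : ℝ) : ℂ)).of_le ?_ ?_
    · exact (Complex.measurable_ofReal.comp hm.inv).aestronglyMeasurable.mul hφ.1
    · filter_upwards [hb2] with q hq
      refine hq.trans_eq ?_
      rw [norm_mul, Complex.norm_real, Real.norm_of_nonneg (Real.sqrt_nonneg _)]
  have h1 : ∀ k, ∫ q, conj (f k q) * φ q = ⟪g k, hL.toLp φ'⟫_ℂ := by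
    intro k
    rw [L2.inner_def]
    refine integral_congr_ae ?_
    filter_upwards [hg k, hL.coeFn_toLp, hS, hφE] with q h2 h3 h4 h5
    rw [h2, h3, RCLike.inner_apply, map_mul, Complex.conj_ofReal]
    rcases lt_or_ge ‖q‖ E with h | h
    · have h6 : ((m q : ℝ) : ℂ) ≠ 0 := Complex.ofReal_ne_zero.2 (h4 h).1
      simp only [hφ', Complex.ofReal_inv]
      field_simp
    · simp [hφ', h5 h]
  have h2 := sum_norm_inner_sq_le hR0 hR (hL.toLp φ')
  have h3 : ENNReal.ofReal (‖hL.toLp φ'‖ ^ 2) ≤ ENNReal.ofReal S * ∫⁻ q, ‖q‖ₑ * ‖φ q‖ₑ ^ 2 := by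
    rw [ENNReal.ofReal_pow (norm_nonneg _), ofReal_norm, Lp.enorm_def,
      eLpNorm_eq_lintegral_rpow_enorm_toReal two_ne_zero ENNReal.ofNat_ne_top,
      ← lintegral_const_mul' _ _ ENNReal.ofReal_ne_top]
    simp only [ENNReal.toReal_ofNat, ENNReal.rpow_ofNat]
    rw [← ENNReal.rpow_ofNat, ← ENNReal.rpow_mul]
    norm_num
    refine lintegral_mono_ae ?_
    filter_upwards [hb, hL.coeFn_toLp] with q h4 h5
    rw [h5, ← ofReal_norm (φ' q), ← ofReal_norm q, ← ofReal_norm (φ q),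
      ← ENNReal.ofReal_pow (norm_nonneg _), ← ENNReal.ofReal_pow (norm_nonneg _),
      ← ENNReal.ofReal_mul (norm_nonneg _), ← ENNReal.ofReal_mul hS0]
    exact ENNReal.ofReal_le_ofReal h4
  calc ∑ k, ‖∫ q, conj (f k q) * φ q‖ₑ ^ 2
      = ENNReal.ofReal (∑ k, ‖⟪g k, hL.toLp φ'⟫_ℂ‖ ^ 2) := by
        rw [ENNReal.ofReal_sum_of_nonneg fun _ _ => by positivity]
        refine Finset.sum_congr rfl fun k _ => ?_
        rw [h1, ENNReal.ofReal_pow (norm_nonneg _), ofReal_norm]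
    _ ≤ ENNReal.ofReal (R * ‖hL.toLp φ'‖ ^ 2) := ENNReal.ofReal_le_ofReal h2
    _ ≤ _ := by
        rw [ENNReal.ofReal_mul hR0, ENNReal.ofReal_mul hR0, mul_assoc]
        gcongr

/-! ## Multiindices -/

/-- The list in which each `j` is repeated `μ j` times. -/
def repeatedIndex (μ : ℕ →₀ ℕ) : List ℕ :=
  (μ.support.sort (· ≤ ·)).flatMap fun j => List.replicate (μ j) j

theorem repeated_eq_map {s : ℕ} (g : ℕ → OneParticle s) (μ : ℕ →₀ ℕ) :
    repeated g μ = (repeatedIndex μ).map g := by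
  simp [repeated, repeatedIndex, List.map_flatMap]

theorem length_repeatedIndex (μ : ℕ →₀ ℕ) : (repeatedIndex μ).length = μ.degree := by
  rw [repeatedIndex, List.length_flatMap, Finsupp.degree_apply]
  simp only [List.length_replicate]
  rw [← Multiset.sum_coe, ← Multiset.map_coe, Finset.sort_eq]
  rfl

theorem prod_map_repeatedIndex (w : ℕ → ℝ) (μ : ℕ →₀ ℕ) :
    ((repeatedIndex μ).map w).prod = μ.prod fun j k => w j ^ k := by
  rw [repeatedIndex, List.map_flatMap, List.flatMap_def, List.prod_flatten, List.map_map]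
  simp only [Function.comp_def, List.map_replicate, List.prod_replicate]
  rw [← Multiset.prod_coe, ← Multiset.map_coe, Finset.sort_eq]
  rfl

/-- The list of the labels of the annihilation operators in `a(Le)^μ̄`. -/
def MultiPair.labels (μ : MultiPair) : List (Sgn × ℕ) :=
  (repeatedIndex (μ Sgn.plus)).map (Prod.mk Sgn.plus) ++
    (repeatedIndex (μ Sgn.minus)).map (Prod.mk Sgn.minus)

theorem MultiPair.args_eq_map {s : ℕ} (r : ℝ) (e : ℕ → OneParticle s) (μ : MultiPair) :
    μ.args r e = μ.labels.map fun a => localProj s r a.1 (e a.2) := by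
  simp [MultiPair.args, MultiPair.labels, repeated_eq_map, Function.comp_def]

theorem MultiPair.length_labels (μ : MultiPair) : μ.labels.length = μ.size := by
  simp [MultiPair.labels, MultiPair.size, length_repeatedIndex]

theorem MultiPair.prod_map_labels (μ : MultiPair) (t : ℕ → ℝ) :
    (μ.labels.map fun a => |t a.2|).prod = |μ.pow t| := by
  simp only [MultiPair.labels, List.map_append, List.map_map, List.prod_append, Function.comp_def,
    MultiPair.pow, abs_mul]
  rw [prod_map_repeatedIndex (fun j => |t j|), prod_map_repeatedIndex (fun j => |t j|)]
  simp [Finsupp.prod, Finset.abs_prod]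

/-! ## The norm of `S_{μ̄,ν̄}` -/

/-- The last annihilation operator of `l'` carries the dependence on the points and yields `t² K E`.
All other factors are estimated in norm and together form the bounded operator `C` of
`norm_sum_smul_translates_le`. -/
theorem sum_norm_sq_translates_le {s : ℕ} {α : Type*} {E K : ℝ} (hE : 0 ≤ E) (hK : 0 ≤ K)
    {f : α → OneParticle s} {t : α → ℝ}
    (hf : ∀ a, LowEnergyBound (fun _ : Unit => f a) E (ENNReal.ofReal (|t a| ^ 2)))
    {N : ℕ} {x : Fin N → Spacetime s}
    (hx : ∀ a, LowEnergyBound (fun k => translateOne (x k) (f a)) E (ENNReal.ofReal (t a ^ 2 * K)))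
    (l : List α) {l' : List α} (hl' : l' ≠ []) {φ : Functional s} (hφ : ‖φ‖ ≤ 1) :
    ∑ k, ‖dualTranslation (x k) φ
        (ContinuousLinearMap.adjoint (annihilator E (l.map f)) * annihilator E (l'.map f))‖ ^ 2 ≤
      K * E ^ (l.length + l'.length) *
        ((l.map fun a => |t a|).prod * (l'.map fun a => |t a|).prod) ^ 2 := by
  obtain ⟨l'', a, rfl⟩ : ∃ l'' a, l' = l'' ++ [a] :=
    ⟨l'.dropLast, l'.getLast hl', (List.dropLast_append_getLast hl').symm⟩
  have h0 : ∀ b, 0 ≤ |t b| := fun b => abs_nonneg _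
  have hp : ∀ l : List α, 0 ≤ (l.map fun a => |t a|).prod := fun l =>
    List.prod_nonneg (by simp)
  obtain ⟨B, hB, hBn⟩ := exists_isAnnihilator hE h0 hf l
  obtain ⟨B', hB', hBn'⟩ := exists_isAnnihilator hE h0 hf l''
  obtain ⟨A, hA, -⟩ := (hf a).exists_isLowAnnihilator hE (h0 a)
  rw [hB.annihilator_eq, show ((l'' ++ [a]).map f) = l''.map f ++ [f a] by simp,
    (hB'.concat hA).annihilator_eq]
  have h1 := fun z => norm_sum_smul_translates_le
    (C := ContinuousLinearMap.adjoint B * B') hE (by positivity) hA (hx a) z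
  have h2 := sum_norm_sq_apply_le h1 hφ
  refine h2.trans ?_
  have h3 : ‖ContinuousLinearMap.adjoint B * B'‖ ≤ ‖B‖ * ‖B'‖ := by
    refine (norm_mul_le _ _).trans_eq ?_
    rw [LinearIsometryEquiv.norm_map]
  have hpl := hp l
  have hpl' := hp l''
  calc (‖ContinuousLinearMap.adjoint B * B'‖ * Real.sqrt (t a ^ 2 * K * E)) ^ 2
      ≤ ((Real.sqrt E ^ l.length * (l.map fun a => |t a|).prod) *
          (Real.sqrt E ^ l''.length * (l''.map fun a => |t a|).prod) *
            Real.sqrt (t a ^ 2 * K * E)) ^ 2 := by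
        gcongr
        exact h3.trans (by gcongr)
    _ = K * (Real.sqrt E ^ 2) ^ l.length * (Real.sqrt E ^ 2) ^ l''.length * E *
          ((l.map fun a => |t a|).prod * ((l''.map fun a => |t a|).prod * |t a|)) ^ 2 := by
        rw [mul_pow, Real.sq_sqrt (by positivity), ← sq_abs (t a)]
        ring
    _ = _ := by
        rw [Real.sq_sqrt hE]
        simp only [List.length_append, List.length_singleton, List.map_append, List.prod_append,
          List.map_cons, List.map_nil, List.prod_cons, List.prod_nil]
        ring

/-- The adjoint functional `φ*` interchanges the roles of `μ̄` and `ν̄`. -/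
theorem norm_adjoint_functional {s : ℕ} (φ : Functional s) :
    ∃ φ' : Functional s, ‖φ'‖ ≤ ‖φ‖ ∧
      ∀ A : BddOp s, φ' A = conj (φ (ContinuousLinearMap.adjoint A)) := by
  let L : BddOp s →ₗ[ℂ] ℂ :=
    { toFun := fun A => conj (φ (ContinuousLinearMap.adjoint A))
      map_add' := fun A B => by simp
      map_smul' := fun c A => by simp [map_smulₛₗ] }
  have hL : ∀ A, ‖L A‖ ≤ ‖φ‖ * ‖A‖ := fun A => by
    change ‖conj (φ (ContinuousLinearMap.adjoint A))‖ ≤ _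
    rw [RCLike.norm_conj]
    refine (φ.le_opNorm _).trans_eq ?_
    rw [LinearIsometryEquiv.norm_map]
  exact ⟨L.mkContinuous _ hL, L.mkContinuous_norm_le (norm_nonneg _) hL, fun A => rfl⟩

theorem MultiPair.labels_ne_nil_of_size {μ : MultiPair} (h : μ.size ≠ 0) : μ.labels ≠ [] := by
  rw [← List.length_pos_iff, μ.length_labels]
  exact Nat.pos_of_ne_zero h

/-- An annihilation operator must stand at the right. If `ν̄` is empty but `μ̄` is not, the adjoint
functional puts one there. If both are empty, the operator is `P_E`, which is translation invariant,
and this is the only case that needs `φ` to be centered. -/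
theorem sum_norm_sq_functionalS_le {s : ℕ} {r E K : ℝ} (hE : 0 ≤ E) (hK : 0 ≤ K)
    {e : ℕ → OneParticle s} {t : ℕ → ℝ}
    (hf : ∀ σ j, LowEnergyBound (fun _ : Unit => localProj s r σ (e j)) E
      (ENNReal.ofReal (|t j| ^ 2)))
    {N : ℕ} {x : Fin N → Spacetime s}
    (hx : ∀ σ j, LowEnergyBound (fun k => translateOne (x k) (localProj s r σ (e j))) E
      (ENNReal.ofReal (t j ^ 2 * K)))
    (μ ν : MultiPair) {φ : Functional s} (hφ : φ ∈ centeredFunctionals s E) (hφ1 : ‖φ‖ ≤ 1) :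
    ∑ k, ‖functionalS r E e μ ν (dualTranslation (x k) φ)‖ ^ 2 ≤
      K * E ^ (μ.size + ν.size) * (μ.pow t * ν.pow t) ^ 2 := by
  have key := fun (μ ν : MultiPair) (hν : ν.size ≠ 0) (φ : Functional s) (hφ1 : ‖φ‖ ≤ 1) =>
    sum_norm_sq_translates_le hE hK (f := fun a : Sgn × ℕ => localProj s r a.1 (e a.2))
      (t := fun a => t a.2) (fun a => hf a.1 a.2) (fun a => hx a.1 a.2) μ.labels
      (MultiPair.labels_ne_nil_of_size hν) hφ1
  simp only [← MultiPair.args_eq_map, MultiPair.prod_map_labels, MultiPair.length_labels,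
    ← abs_mul, sq_abs] at key
  by_cases hν : ν.size = 0
  · by_cases hμ : μ.size = 0
    · have hnil : ∀ κ : MultiPair, κ.size = 0 →
          annihilator E (κ.args r e) = specProj s E := by
        intro κ hκ
        have h1 : κ.labels = [] := List.eq_nil_of_length_eq_zero (by rw [κ.length_labels, hκ])
        rw [κ.args_eq_map, h1]
        exact (isAnnihilator_nil E).annihilator_eq
      have hP : (ContinuousLinearMap.adjoint (specProj s E)).comp (specProj s E)
          = specProj s E := by
        rw [adjoint_specProj]
        exact ContinuousLinearMap.ext (specProj_specProj E)
      have h2 : ∀ k, functionalS r E e μ ν (dualTranslation (x k) φ) = 0 := fun k => by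
        rw [functionalS, hnil μ hμ, hnil ν hν, hP, dualTranslation_specProj,
          apply_specProj_eq_zero hφ]
      simp only [h2]
      simp only [norm_zero, ne_eq, OfNat.ofNat_ne_zero, not_false_eq_true, zero_pow,
        Finset.sum_const_zero]
      positivity
    · obtain ⟨φ', h1, h2⟩ := norm_adjoint_functional φ
      have h3 := key ν μ hμ φ' (h1.trans hφ1)
      rw [add_comm, mul_comm (ν.pow t)] at h3
      refine le_of_eq_of_le (Finset.sum_congr rfl fun k _ => ?_) h3
      rw [functionalS, dualTranslation_apply, dualTranslation_apply, h2, RCLike.norm_conj]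
      congr 3
      simp only [← ContinuousLinearMap.star_eq_adjoint, ← ContinuousLinearMap.mul_def, star_mul,
        star_star, mul_assoc]
  · exact key μ ν hν φ hφ1

theorem multiNorm_functionalS_sq_le {s : ℕ} {r E K : ℝ} (hE : 0 ≤ E) (hK : 0 ≤ K)
    {e : ℕ → OneParticle s} {t : ℕ → ℝ}
    (hf : ∀ σ j, LowEnergyBound (fun _ : Unit => localProj s r σ (e j)) E
      (ENNReal.ofReal (|t j| ^ 2)))
    {N : ℕ} {x : Fin N → Spacetime s}
    (hx : ∀ σ j, LowEnergyBound (fun k => translateOne (x k) (localProj s r σ (e j))) E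
      (ENNReal.ofReal (t j ^ 2 * K)))
    (μ ν : MultiPair) :
    multiNorm (centeredFunctionals s E) x (functionalS r E e μ ν) ^ 2 ≤
      ENNReal.ofReal (K * E ^ (μ.size + ν.size) * (μ.pow t * ν.pow t) ^ 2) := by
  have h1 : multiNorm (centeredFunctionals s E) x (functionalS r E e μ ν) ≤
      ENNReal.ofReal (K * E ^ (μ.size + ν.size) * (μ.pow t * ν.pow t) ^ 2) ^ (1 / 2 : ℝ) := by
    refine iSup₂_le fun φ hφ => ?_
    refine ENNReal.rpow_le_rpow ?_ (by norm_num)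
    refine le_of_eq_of_le ?_ (ENNReal.ofReal_le_ofReal
      (sum_norm_sq_functionalS_le hE hK hf hx μ ν hφ.1 hφ.2))
    rw [ENNReal.ofReal_sum_of_nonneg fun _ _ => by positivity]
    refine Finset.sum_congr rfl fun k _ => ?_
    rw [ENNReal.ofReal_pow (norm_nonneg _), ofReal_norm]
  refine (pow_le_pow_left' h1 2).trans_eq ?_
  rw [← ENNReal.rpow_natCast, ← ENNReal.rpow_mul]
  norm_num

theorem exists_isAnnihilator_args {s : ℕ} {r E : ℝ} (hE : 0 ≤ E)
    {e : ℕ → OneParticle s} {t : ℕ → ℝ}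
    (hf : ∀ σ j, LowEnergyBound (fun _ : Unit => localProj s r σ (e j)) E
      (ENNReal.ofReal (|t j| ^ 2))) (μ : MultiPair) :
    ∃ B, IsAnnihilator E (μ.args r e) B := by
  have key := exists_isAnnihilator hE (f := fun a : Sgn × ℕ => localProj s r a.1 (e a.2))
    (w := fun a => |t a.2|) (fun a => abs_nonneg (t a.2)) (fun a => hf a.1 a.2) μ.labels
  rw [← μ.args_eq_map] at key
  exact key.imp fun B hB => hB.1

open scoped FourierTransform

/-! ## Fourier transforms of test functions -/

/-- The bridge to the normalization `e^{-2πi⟨x,w⟩}` of `𝓕`, through `w = p/2π`. -/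
theorem fourier_eq_const_mul {s : ℕ} (f : Mom s → ℂ) (p : Mom s) :
    fourier f p = (((2 * Real.pi) ^ (-(s : ℝ) / 2) : ℝ) : ℂ) * 𝓕 f ((2 * Real.pi)⁻¹ • p) := by
  rw [fourier, Real.fourier_eq']
  congr 1
  refine integral_congr_ae (Filter.Eventually.of_forall fun x => ?_)
  simp only [smul_eq_mul]
  congr 2
  have hpi : (2 * Real.pi) ≠ 0 := by positivity
  rw [inner_smul_right, real_inner_comm, mul_comm Complex.I, ← neg_mul]
  congr 1
  rw [← mul_assoc, neg_mul, neg_mul, mul_inv_cancel₀ hpi]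
  simp

/-- A test function as a Schwartz function. -/
def IsTestFunction.schwartz {s : ℕ} {r : ℝ} {f : Mom s → ℂ} (hf : IsTestFunction r f) :
    SchwartzMap (Mom s) ℂ :=
  hf.compact.toSchwartzMap hf.smooth

theorem IsTestFunction.fourier_eq {s : ℕ} {r : ℝ} {f : Mom s → ℂ} (hf : IsTestFunction r f)
    (p : Mom s) :
    fourier f p
      = (((2 * Real.pi) ^ (-(s : ℝ) / 2) : ℝ) : ℂ) * 𝓕 hf.schwartz ((2 * Real.pi)⁻¹ • p) := by
  rw [fourier_eq_const_mul, SchwartzMap.fourier_coe]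
  rfl

theorem IsTestFunction.continuous_fourier {s : ℕ} {r : ℝ} {f : Mom s → ℂ}
    (hf : IsTestFunction r f) : Continuous (fourier f) := by
  have h : fourier f = fun p =>
      (((2 * Real.pi) ^ (-(s : ℝ) / 2) : ℝ) : ℂ) * 𝓕 hf.schwartz ((2 * Real.pi)⁻¹ • p) :=
    funext hf.fourier_eq
  rw [h]
  have := (𝓕 hf.schwartz).continuous
  fun_prop

theorem IsTestFunction.exists_fourier_decay {s : ℕ} {r : ℝ} {f : Mom s → ℂ}
    (hf : IsTestFunction r f) (k : ℕ) :
    ∃ C, 0 < C ∧ ∀ p, (1 + ‖p‖) ^ k * ‖fourier f p‖ ≤ C := by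
  have hpi : 0 < 2 * Real.pi := by positivity
  have hpi1 : (1 : ℝ) ≤ 2 * Real.pi := by linarith [Real.pi_gt_three]
  obtain ⟨C, hC⟩ : ∃ C, ∀ w, (1 + ‖w‖) ^ k * ‖𝓕 hf.schwartz w‖ ≤ C := by
    have h := SchwartzMap.one_add_le_sup_seminorm_apply (𝕜 := ℂ) (m := (k, 0)) le_rfl le_rfl
      (𝓕 hf.schwartz)
    simp only [norm_iteratedFDeriv_zero] at h
    exact ⟨_, h⟩
  have hC0 : 0 ≤ C := le_trans (by positivity) (hC 0)
  set c : ℝ := (2 * Real.pi) ^ (-(s : ℝ) / 2) with hc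
  have hc0 : 0 < c := Real.rpow_pos_of_pos hpi _
  refine ⟨c * (2 * Real.pi) ^ k * C + 1, by positivity, fun p => ?_⟩
  have h1 := hC ((2 * Real.pi)⁻¹ • p)
  rw [norm_smul, Real.norm_of_nonneg (by positivity)] at h1
  have h2 : 1 + ‖p‖ ≤ (2 * Real.pi) * (1 + (2 * Real.pi)⁻¹ * ‖p‖) := by
    rw [mul_add, mul_one, ← mul_assoc, mul_inv_cancel₀ hpi.ne', one_mul]
    gcongr
  rw [hf.fourier_eq, norm_mul, Complex.norm_real, Real.norm_of_nonneg hc0.le]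
  calc (1 + ‖p‖) ^ k * (c * ‖𝓕 hf.schwartz ((2 * Real.pi)⁻¹ • p)‖)
      ≤ ((2 * Real.pi) * (1 + (2 * Real.pi)⁻¹ * ‖p‖)) ^ k *
          (c * ‖𝓕 hf.schwartz ((2 * Real.pi)⁻¹ • p)‖) := by gcongr
    _ = c * (2 * Real.pi) ^ k *
          ((1 + (2 * Real.pi)⁻¹ * ‖p‖) ^ k * ‖𝓕 hf.schwartz ((2 * Real.pi)⁻¹ • p)‖) := by
        rw [mul_pow]; ring
    _ ≤ c * (2 * Real.pi) ^ k * C := by gcongr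
    _ ≤ _ := by linarith

/-- Plancherel: the prefactor `(2π)^{-s}` cancels the Jacobian of `w = p/2π`. -/
theorem IsTestFunction.integral_conj_fourier_mul {s : ℕ} {r r' : ℝ} {f g : Mom s → ℂ}
    (hf : IsTestFunction r f) (hg : IsTestFunction r' g) :
    ∫ q, conj (fourier g q) * fourier f q = ∫ x, conj (g x) * f x := by
  have hpi : 0 < 2 * Real.pi := by positivity
  have h1 : ∫ w, conj (𝓕 hg.schwartz w) * 𝓕 hf.schwartz w = ∫ x, conj (g x) * f x := by
    have h := SchwartzMap.integral_inner_fourier_fourier hg.schwartz hf.schwartz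
    simp only [RCLike.inner_apply] at h
    simp only [mul_comm (conj _)]
    exact h
  rw [← h1]
  have h2 := Measure.integral_comp_smul (volume : Measure (Mom s))
    (fun w => conj (𝓕 hg.schwartz w) * 𝓕 hf.schwartz w) (2 * Real.pi)⁻¹
  have h3 : ∀ q, conj (fourier g q) * fourier f q = (((2 * Real.pi) ^ (-(s : ℝ)) : ℝ) : ℂ) *
      (conj (𝓕 hg.schwartz ((2 * Real.pi)⁻¹ • q)) * 𝓕 hf.schwartz ((2 * Real.pi)⁻¹ • q)) := by
    intro q
    have h4 : (2 * Real.pi) ^ (-(s : ℝ))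
        = (2 * Real.pi) ^ (-(s : ℝ) / 2) * (2 * Real.pi) ^ (-(s : ℝ) / 2) := by
      rw [← Real.rpow_add hpi]
      congr 1
      ring
    rw [hf.fourier_eq, hg.fourier_eq, map_mul, Complex.conj_ofReal, h4, Complex.ofReal_mul]
    ring
  simp_rw [h3]
  rw [integral_const_mul, h2, finrank_euclideanSpace_fin, inv_pow, inv_inv,
    abs_of_pos (by positivity), Complex.real_smul, ← mul_assoc, ← Complex.ofReal_mul,
    ← Real.rpow_natCast, ← Real.rpow_add hpi]
  simp

/-! ### Linear structure of the generating vectors of the local subspaces. -/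

theorem IsTestFunction.add {s : ℕ} {r : ℝ} {f g : Mom s → ℂ} (hf : IsTestFunction r f)
    (hg : IsTestFunction r g) : IsTestFunction r (fun x => f x + g x) where
  smooth := hf.smooth.add hg.smooth
  compact := hf.compact.add hg.compact
  supp := (tsupport_add f g).trans (Set.union_subset hf.supp hg.supp)

theorem IsTestFunction.const_mul {s : ℕ} {r : ℝ} {f : Mom s → ℂ} (hf : IsTestFunction r f)
    (c : ℂ) : IsTestFunction r (fun x => c * f x) where
  smooth := contDiff_const.mul hf.smooth
  compact := hf.compact.mul_left
  supp := (tsupport_mul_subset_right (f := fun _ => c)).trans hf.supp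

theorem isTestFunction_zero {s : ℕ} (r : ℝ) : IsTestFunction r (fun _ : Mom s => (0 : ℂ)) where
  smooth := contDiff_const
  compact := HasCompactSupport.zero
  supp := by
    rw [show (fun _ : Mom s => (0 : ℂ)) = 0 from rfl, tsupport_eq_empty_iff.2 rfl]
    exact Set.empty_subset _

theorem IsTestFunction.integrable {s : ℕ} {r : ℝ} {f : Mom s → ℂ} (hf : IsTestFunction r f) :
    Integrable f :=
  hf.smooth.continuous.integrable_of_hasCompactSupport hf.compact

theorem integrable_exp_mul {s : ℕ} {f : Mom s → ℂ} (hf : Integrable f) (p : Mom s) :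
    Integrable fun x : Mom s => Complex.exp (-(Complex.I * ((⟪p, x⟫_ℝ : ℝ) : ℂ))) * f x := by
  refine hf.bdd_mul (c := 1) (by fun_prop) (Filter.Eventually.of_forall fun x => ?_)
  rw [← mul_neg, ← Complex.ofReal_neg, mul_comm, Complex.norm_exp_ofReal_mul_I]

theorem fourier_add {s : ℕ} {f g : Mom s → ℂ} (hf : Integrable f) (hg : Integrable g)
    (p : Mom s) : fourier (fun x => f x + g x) p = fourier f p + fourier g p := by
  simp only [fourier, mul_add (Complex.exp _)]
  rw [integral_add (integrable_exp_mul hf p) (integrable_exp_mul hg p), mul_add]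

theorem fourier_const_mul {s : ℕ} (c : ℂ) (f : Mom s → ℂ) (p : Mom s) :
    fourier (fun x => c * f x) p = c * fourier f p := by
  simp only [fourier, mul_left_comm _ c]
  rw [integral_const_mul, mul_left_comm]

/-- The vectors `ω^{∓1/2} f̃` that generate the local subspaces. -/
def IsLocalVector {s : ℕ} (r : ℝ) (σ : Sgn) (v : OneParticle s) : Prop :=
  ∃ f : Mom s → ℂ, IsTestFunction r f ∧
    ∀ᵐ p, v p = ((‖p‖ ^ σ.exponent : ℝ) : ℂ) * fourier f p

/-- The generators already form a linear space, so every vector of `L^±` is a limit of vectors that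
come from a single test function. -/
theorem isLocalVector_of_mem_span {s : ℕ} {r : ℝ} {σ : Sgn} {v : OneParticle s}
    (hv : v ∈ Submodule.span ℂ {g : OneParticle s | IsLocalVector r σ g}) :
    IsLocalVector r σ v := by
  induction hv using Submodule.span_induction with
  | mem v hv => exact hv
  | zero =>
    refine ⟨_, isTestFunction_zero r, ?_⟩
    filter_upwards [Lp.coeFn_zero ℂ 2 (volume : Measure (Mom s))] with p hp
    rw [hp]
    simp [fourier]
  | add v w _ _ hv hw =>
    obtain ⟨f, hf, hvf⟩ := hv
    obtain ⟨g, hg, hwg⟩ := hw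
    refine ⟨_, hf.add hg, ?_⟩
    filter_upwards [hvf, hwg, Lp.coeFn_add v w] with p h1 h2 h3
    rw [h3, Pi.add_apply, h1, h2, fourier_add hf.integrable hg.integrable, mul_add]
  | smul c v _ hv =>
    obtain ⟨f, hf, hvf⟩ := hv
    refine ⟨_, hf.const_mul c, ?_⟩
    filter_upwards [hvf, Lp.coeFn_smul c v] with p h1 h2
    rw [h2, Pi.smul_apply, h1, smul_eq_mul, fourier_const_mul, mul_left_comm]

theorem exists_seq_isLocalVector {s : ℕ} {r : ℝ} {σ : Sgn} {v : OneParticle s}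
    (hv : v ∈ localSubspace s r σ) :
    ∃ u : ℕ → OneParticle s, (∀ n, IsLocalVector r σ (u n)) ∧
      Filter.Tendsto u Filter.atTop (nhds v) := by
  have h1 : v ∈ closure (Submodule.span ℂ {g : OneParticle s | IsLocalVector r σ g} :
      Set (OneParticle s)) := hv
  obtain ⟨u, hu, hu'⟩ := mem_closure_iff_seq_limit.1 h1
  exact ⟨u, fun n => isLocalVector_of_mem_span (hu n), hu'⟩

theorem IsLocalVector.mem {s : ℕ} {r : ℝ} {σ : Sgn} {v : OneParticle s}
    (hv : IsLocalVector r σ v) : v ∈ localSubspace s r σ :=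
  Submodule.le_topologicalClosure _ (Submodule.subset_span hv)

/-! ## Pointwise bounds on Fourier transforms of local vectors -/

theorem integrableOn_ball_norm_rpow {s : ℕ} [NeZero s] {a R : ℝ} (ha : -(s : ℝ) < a) :
    IntegrableOn (fun p : Mom s => ‖p‖ ^ a) (Metric.ball 0 R) := by
  rw [integrableOn_fun_norm_addHaar (E := Mom s) volume (f := fun y => y ^ a),
    finrank_euclideanSpace_fin]
  rcases le_or_gt R 0 with hR | hR
  · simp [Set.Ioo_eq_empty (not_lt.2 hR)]
  have hs : 1 ≤ s := NeZero.one_le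
  have h1 : IntegrableOn (fun y : ℝ => y ^ ((s : ℝ) - 1 + a)) (Set.Ioo 0 R) := by
    have h2 := intervalIntegral.intervalIntegrable_rpow' (a := 0) (b := R)
      (r := (s : ℝ) - 1 + a) (by linarith)
    rw [intervalIntegrable_iff_integrableOn_Ioo_of_le hR.le] at h2
    exact h2
  refine h1.congr_fun (fun y hy => ?_) measurableSet_Ioo
  simp only [smul_eq_mul]
  rw [Real.rpow_add hy.1, ← Nat.cast_one, ← Nat.cast_sub hs, Real.rpow_natCast]

/-- On the unit ball the decaying factor is dropped. Outside, `|p|^a ≤ 1 + |p|` costs one power of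
the decay, and `k - 1 > s` remains. -/
theorem integrable_norm_rpow_mul {s : ℕ} [NeZero s] {a : ℝ} (ha : -(s : ℝ) < a) (ha1 : a ≤ 1)
    {k : ℕ} (hk : s + 1 < k) :
    Integrable fun p : Mom s => ‖p‖ ^ a * ((1 + ‖p‖) ^ k)⁻¹ := by
  have h1 : Integrable ((Metric.ball (0 : Mom s) 1).indicator fun p => ‖p‖ ^ a) :=
    (integrable_indicator_iff measurableSet_ball).2 (integrableOn_ball_norm_rpow ha)
  have h2 : Integrable fun p : Mom s => (1 + ‖p‖) ^ (-((k : ℝ) - 1)) := by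
    refine integrable_one_add_norm ?_
    rw [finrank_euclideanSpace_fin]
    have : (s : ℝ) + 1 < k := by exact_mod_cast hk
    linarith
  refine (h1.add h2).mono' ?_ (Filter.Eventually.of_forall fun p => ?_)
  · have hm : Measurable fun p : Mom s => ‖p‖ ^ a * ((1 + ‖p‖) ^ k)⁻¹ := by fun_prop
    exact hm.aestronglyMeasurable
  · rw [Real.norm_of_nonneg (by positivity), Pi.add_apply]
    have h3 : (0 : ℝ) < 1 + ‖p‖ := by positivity
    by_cases hp : p ∈ Metric.ball (0 : Mom s) 1
    · rw [Set.indicator_of_mem hp]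
      have h4 : ((1 + ‖p‖) ^ k)⁻¹ ≤ 1 := inv_le_one_of_one_le₀ (one_le_pow₀ (by simp))
      have h5 : 0 ≤ (1 + ‖p‖) ^ (-((k : ℝ) - 1)) := by positivity
      have h6 : 0 ≤ ‖p‖ ^ a := by positivity
      nlinarith
    · rw [Set.indicator_of_notMem hp, zero_add]
      have h4 : 1 ≤ ‖p‖ := by simpa using hp
      calc ‖p‖ ^ a * ((1 + ‖p‖) ^ k)⁻¹ ≤ (1 + ‖p‖) ^ (1 : ℝ) * ((1 + ‖p‖) ^ k)⁻¹ := by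
            gcongr
            calc ‖p‖ ^ a ≤ ‖p‖ ^ (1 : ℝ) := Real.rpow_le_rpow_of_exponent_le h4 ha1
              _ ≤ _ := by gcongr; linarith
        _ = _ := by
            rw [← Real.rpow_natCast, ← Real.rpow_neg h3.le, ← Real.rpow_add h3]
            congr 1
            ring

theorem norm_sq_eq_integral {s : ℕ} (v : OneParticle s) : ‖v‖ ^ 2 = ∫ p, ‖v p‖ ^ 2 := by
  have h1 : ((‖v‖ ^ 2 : ℝ) : ℂ) = ((∫ p, ‖v p‖ ^ 2 : ℝ) : ℂ) := by
    have h2 := inner_self_eq_norm_sq_to_K (𝕜 := ℂ) v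
    rw [L2.inner_def] at h2
    rw [← integral_complex_ofReal, Complex.ofReal_pow]
    refine h2.symm.trans ?_
    simp [inner_self_eq_norm_sq_to_K]
  exact_mod_cast h1

theorem enorm_sq_eq_lintegral {s : ℕ} (v : OneParticle s) : ‖v‖ₑ ^ 2 = ∫⁻ p, ‖v p‖ₑ ^ 2 := by
  rw [Lp.enorm_def, eLpNorm_eq_lintegral_rpow_enorm_toReal two_ne_zero ENNReal.ofNat_ne_top]
  simp only [ENNReal.toReal_ofNat, ENNReal.rpow_ofNat]
  rw [← ENNReal.rpow_ofNat, ← ENNReal.rpow_mul]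
  norm_num

theorem exists_cutoff (s : ℕ) {r : ℝ} (hr : 0 < r) :
    ∃ χ : Mom s → ℂ, IsTestFunction (r + 2) χ ∧ ∀ x ∈ Metric.ball (0 : Mom s) r, χ x = 1 := by
  let b : ContDiffBump (0 : Mom s) := ⟨r, r + 1, hr, by linarith⟩
  refine ⟨fun x => (b x : ℂ), ⟨Complex.ofRealCLM.contDiff.comp b.contDiff,
    b.hasCompactSupport.comp_left Complex.ofReal_zero, ?_⟩, fun x hx => ?_⟩
  · refine (closure_mono (Function.support_comp_subset Complex.ofReal_zero b)).trans ?_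
    refine b.tsupport_eq.trans_subset ?_
    exact Metric.closedBall_subset_ball (by change r + 1 < r + 2; linarith)
  · change ((b x : ℝ) : ℂ) = 1
    rw [b.one_of_mem_closedBall (Metric.ball_subset_closedBall hx), Complex.ofReal_one]

theorem IsTestFunction.exp_mul {s : ℕ} {r : ℝ} {χ : Mom s → ℂ} (hχ : IsTestFunction r χ)
    (p : Mom s) :
    IsTestFunction r fun x => Complex.exp (Complex.I * ((⟪p, x⟫_ℝ : ℝ) : ℂ)) * χ x where
  smooth := by
    refine ContDiff.mul (ContDiff.cexp (contDiff_const.mul ?_)) hχ.smooth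
    exact Complex.ofRealCLM.contDiff.comp (contDiff_const.inner ℝ contDiff_id)
  compact := hχ.compact.mul_left
  supp := tsupport_mul_subset_right.trans hχ.supp

theorem fourier_exp_mul {s : ℕ} (χ : Mom s → ℂ) (p q : Mom s) :
    fourier (fun x => Complex.exp (Complex.I * ((⟪p, x⟫_ℝ : ℝ) : ℂ)) * χ x) q
      = fourier χ (q - p) := by
  simp only [fourier, ← mul_assoc, ← Complex.exp_add, inner_sub_left]
  congr 2
  funext x
  congr 2
  push_cast
  ring

/-- Localization makes evaluation at `p` a bounded functional of `v`. With a cutoff `χ` equal to one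
on the ball, `f̃(p)` is the inner product of `f` with `e^{ip·x} χ`; by Plancherel it equals a
constant times `⟨w, v⟩` with `w = ω^{±1/2} χ̃(· - p)`, which is square integrable. -/
theorem exists_norm_fourier_le {s : ℕ} (hs : 2 ≤ s) {r : ℝ} (hr : 0 < r) (σ : Sgn) :
    ∃ C, 0 < C ∧ ∀ (f : Mom s → ℂ) (v : OneParticle s), IsTestFunction r f →
      (∀ᵐ p, v p = ((‖p‖ ^ σ.exponent : ℝ) : ℂ) * fourier f p) →
      ∀ p, ‖fourier f p‖ ≤ C * (1 + ‖p‖) ^ (s + 2) * ‖v‖ := by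
  have : NeZero s := ⟨by omega⟩
  obtain ⟨χ, hχ, hχ1⟩ := exists_cutoff s hr
  obtain ⟨D, hD0, hD⟩ := hχ.exists_fourier_decay (s + 2)
  have hs' : (2 : ℝ) ≤ s := by exact_mod_cast hs
  have hint : Integrable fun q : Mom s =>
      ‖q‖ ^ (-2 * σ.exponent) * ((1 + ‖q‖) ^ (2 * (s + 2)))⁻¹ := by
    refine integrable_norm_rpow_mul ?_ ?_ (by omega) <;>
      cases σ <;> simp only [Sgn.exponent] <;> linarith
  set I : ℝ := ∫ q : Mom s, ‖q‖ ^ (-2 * σ.exponent) * ((1 + ‖q‖) ^ (2 * (s + 2)))⁻¹ with hI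
  have hI0 : 0 ≤ I := integral_nonneg fun q => by positivity
  set c : ℝ := (2 * Real.pi) ^ (-(s : ℝ) / 2) with hc
  have hc0 : 0 < c := Real.rpow_pos_of_pos (by positivity) _
  refine ⟨c * D * Real.sqrt I + 1, by positivity, fun f v hf hv p => ?_⟩
  set w : Mom s → ℂ := fun q => ((‖q‖ ^ (-σ.exponent) : ℝ) : ℂ) * fourier χ (q - p) with hw
  have hwb : ∀ q, ‖w q‖ ^ 2 ≤ (D * (1 + ‖p‖) ^ (s + 2)) ^ 2 *
      (‖q‖ ^ (-2 * σ.exponent) * ((1 + ‖q‖) ^ (2 * (s + 2)))⁻¹) := by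
    intro q
    have h1 : ‖fourier χ (q - p)‖ ≤ D * (1 + ‖p‖) ^ (s + 2) * ((1 + ‖q‖) ^ (s + 2))⁻¹ := by
      have h2 : 1 + ‖q‖ ≤ (1 + ‖p‖) * (1 + ‖q - p‖) := by
        -- Peetre's inequality trades the decay of `χ̃` in `q - p` for decay in `q` and polynomial
        -- growth in `p`.
        have h3 := norm_sub_norm_le q p
        nlinarith [norm_nonneg p, norm_nonneg (q - p)]
      rw [← div_eq_mul_inv, le_div_iff₀ (by positivity)]
      calc ‖fourier χ (q - p)‖ * (1 + ‖q‖) ^ (s + 2)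
          ≤ ‖fourier χ (q - p)‖ * ((1 + ‖p‖) * (1 + ‖q - p‖)) ^ (s + 2) := by gcongr
        _ = ((1 + ‖q - p‖) ^ (s + 2) * ‖fourier χ (q - p)‖) * (1 + ‖p‖) ^ (s + 2) := by
            rw [mul_pow]; ring
        _ ≤ _ := by gcongr; exact hD _
    have h4 : (‖q‖ ^ (-σ.exponent)) ^ 2 = ‖q‖ ^ (-2 * σ.exponent) := by
      rw [← Real.rpow_natCast, ← Real.rpow_mul (norm_nonneg _)]
      congr 1
      push_cast
      ring
    rw [hw]
    simp only [norm_mul, mul_pow, Complex.norm_real]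
    rw [Real.norm_of_nonneg (by positivity), h4]
    calc ‖q‖ ^ (-2 * σ.exponent) * ‖fourier χ (q - p)‖ ^ 2
        ≤ ‖q‖ ^ (-2 * σ.exponent) *
          (D * (1 + ‖p‖) ^ (s + 2) * ((1 + ‖q‖) ^ (s + 2))⁻¹) ^ 2 := by gcongr
      _ = _ := by rw [mul_pow, inv_pow, ← pow_mul, mul_pow, mul_comm (s + 2) 2]; ring
  have hwm : AEStronglyMeasurable w volume := by
    have h1 := hχ.continuous_fourier
    have : Measurable w := by
      refine Measurable.mul ?_ ?_
      · fun_prop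
      · exact (h1.comp (continuous_id.sub continuous_const)).measurable
    exact this.aestronglyMeasurable
  have hwi : Integrable fun q => ‖w q‖ ^ 2 := by
    refine (hint.const_mul ((D * (1 + ‖p‖) ^ (s + 2)) ^ 2)).mono' (hwm.norm.pow 2)
      (Filter.Eventually.of_forall fun q => ?_)
    rw [Real.norm_of_nonneg (by positivity)]
    exact hwb q
  have hwL : MemLp w 2 := (memLp_two_iff_integrable_sq_norm hwm).2 hwi
  have hwn : ‖hwL.toLp w‖ ≤ D * (1 + ‖p‖) ^ (s + 2) * Real.sqrt I := by
    refine (sq_le_sq₀ (norm_nonneg _) (by positivity)).1 ?_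
    rw [norm_sq_eq_integral, mul_pow _ (Real.sqrt I), Real.sq_sqrt hI0, hI, ← integral_const_mul]
    have h5 : ∫ q, ‖hwL.toLp w q‖ ^ 2 = ∫ q, ‖w q‖ ^ 2 := by
      refine integral_congr_ae ?_
      filter_upwards [hwL.coeFn_toLp] with q hq
      rw [hq]
    rw [h5]
    exact integral_mono hwi (hint.const_mul _) hwb
  have h6 : fourier f p = (c : ℂ) * ⟪hwL.toLp w, v⟫_ℂ := by
    have h7 : ∫ x : Mom s, Complex.exp (-(Complex.I * ((⟪p, x⟫_ℝ : ℝ) : ℂ))) * f x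
        = ∫ x, conj (Complex.exp (Complex.I * ((⟪p, x⟫_ℝ : ℝ) : ℂ)) * χ x) * f x := by
      congr 1
      funext x
      by_cases hx : x ∈ tsupport f
      · rw [hχ1 x (hf.supp hx), mul_one, ← Complex.exp_conj]
        simp
      · rw [image_eq_zero_of_notMem_tsupport hx, mul_zero, mul_zero]
    rw [fourier, h7, ← hf.integral_conj_fourier_mul (hχ.exp_mul p), L2.inner_def]
    congr 1
    refine integral_congr_ae ?_
    filter_upwards [hwL.coeFn_toLp, hv, Measure.ae_ne volume (0 : Mom s)] with q h8 h9 h10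
    have h11 : 0 < ‖q‖ := norm_pos_iff.2 h10
    have h12 : (((‖q‖ ^ (-σ.exponent) : ℝ) : ℂ)) * ((‖q‖ ^ σ.exponent : ℝ) : ℂ) = 1 := by
      rw [← Complex.ofReal_mul, ← Real.rpow_add h11]
      simp
    rw [h8, h9, RCLike.inner_apply, fourier_exp_mul, hw]
    simp only [map_mul, Complex.conj_ofReal]
    linear_combination (-conj (fourier χ (q - p)) * fourier f q) * h12
  rw [h6, norm_mul, Complex.norm_real, Real.norm_of_nonneg hc0.le]
  calc c * ‖⟪hwL.toLp w, v⟫_ℂ‖ ≤ c * (‖hwL.toLp w‖ * ‖v‖) := by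
        gcongr
        exact norm_inner_le_norm _ _
    _ ≤ c * ((D * (1 + ‖p‖) ^ (s + 2) * Real.sqrt I) * ‖v‖) := by gcongr
    _ = c * D * Real.sqrt I * (1 + ‖p‖) ^ (s + 2) * ‖v‖ := by ring
    _ ≤ _ := by gcongr; linarith

/-! ## Multiplication operators on the local subspaces -/

/-- The growth of symbols `m` for which `m(p) L^±` is bounded. -/
structure IsTameSymbol {s : ℕ} (m : Mom s → ℝ) : Prop where
  measurable : Measurable m
  bound : ∃ R C g : ℝ, 0 ≤ R ∧ 0 ≤ C ∧ 2 * g + 1 < s ∧ (∀ p, ‖p‖ < R → |m p| ≤ C * ‖p‖ ^ (-g)) ∧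
    ∀ p, R ≤ ‖p‖ → |m p| ≤ C

/-- For `|p| < R` the pointwise bound on `f̃` gives `|m v|² ≤ A |p|^{2(∓1/2 - g)} ‖v‖²`. The worse
sign is integrable at the origin exactly because `2g + 1 < s`. For `|p| ≥ R` the symbol is bounded.
-/
theorem IsTameSymbol.exists_lintegral_le {s : ℕ} (hs : 2 ≤ s) {r : ℝ} (hr : 0 < r) (σ : Sgn)
    {m : Mom s → ℝ} (hm : IsTameSymbol m) :
    ∃ K : ℝ, 0 ≤ K ∧ ∀ v : OneParticle s, IsLocalVector r σ v →
      ∫⁻ p, ‖(m p : ℂ) * v p‖ₑ ^ 2 ≤ ENNReal.ofReal K * ‖v‖ₑ ^ 2 := by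
  have : NeZero s := ⟨by omega⟩
  obtain ⟨R, C, g, hR, hC, hg, h1, h2⟩ := hm.bound
  obtain ⟨D, hD, hD'⟩ := exists_norm_fourier_le hs hr σ
  set a : ℝ := 2 * (σ.exponent - g) with ha
  have hint : IntegrableOn (fun p : Mom s => ‖p‖ ^ a) (Metric.ball 0 R) := by
    refine integrableOn_ball_norm_rpow ?_
    cases σ <;> simp only [ha, Sgn.exponent] <;> linarith
  set A : ℝ := (C * (D * (1 + R) ^ (s + 2))) ^ 2 with hA
  set I : ℝ := ∫ p in Metric.ball (0 : Mom s) R, ‖p‖ ^ a with hI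
  have hI0 : 0 ≤ I := integral_nonneg fun q => by positivity
  refine ⟨A * I + C ^ 2, by positivity, ?_⟩
  rintro v ⟨f, hf, hv⟩
  have h3 : ∀ᵐ p, ‖(m p : ℂ) * v p‖ₑ ^ 2 ≤
      (Metric.ball (0 : Mom s) R).indicator
        (fun p => ENNReal.ofReal (A * ‖v‖ ^ 2) * ENNReal.ofReal (‖p‖ ^ a)) p +
      ENNReal.ofReal (C ^ 2) * ‖v p‖ₑ ^ 2 := by
    filter_upwards [hv, Measure.ae_ne volume (0 : Mom s)] with p hp hp0
    have hp1 : 0 < ‖p‖ := norm_pos_iff.2 hp0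
    rw [← ofReal_norm (_ * _), ← ENNReal.ofReal_pow (norm_nonneg _), norm_mul, Complex.norm_real,
      Real.norm_eq_abs]
    rcases lt_or_ge ‖p‖ R with h | h
    · rw [Set.indicator_of_mem (by simpa using h), ← ENNReal.ofReal_mul (by positivity)]
      refine le_add_right (ENNReal.ofReal_le_ofReal ?_)
      have h4 : ‖v p‖ ≤ ‖p‖ ^ σ.exponent * (D * (1 + R) ^ (s + 2) * ‖v‖) := by
        rw [hp, norm_mul, Complex.norm_real, Real.norm_of_nonneg (by positivity)]
        gcongr
        refine (hD' f v hf hv p).trans ?_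
        gcongr
      have h5 : ‖p‖ ^ a = (‖p‖ ^ (-g) * ‖p‖ ^ σ.exponent) ^ 2 := by
        rw [← Real.rpow_add hp1, ← Real.rpow_natCast, ← Real.rpow_mul (norm_nonneg _)]
        congr 1
        push_cast
        ring
      calc (|m p| * ‖v p‖) ^ 2
          ≤ ((C * ‖p‖ ^ (-g)) * (‖p‖ ^ σ.exponent * (D * (1 + R) ^ (s + 2) * ‖v‖))) ^ 2 := by
            gcongr
            exact h1 p h
        _ = _ := by rw [h5, hA]; ring
    · refine le_add_left ?_
      rw [← ofReal_norm (v p), ← ENNReal.ofReal_pow (norm_nonneg _),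
        ← ENNReal.ofReal_mul (by positivity), ← mul_pow]
      refine ENNReal.ofReal_le_ofReal ?_
      gcongr
      exact h2 p h
  refine (lintegral_mono_ae h3).trans ?_
  rw [lintegral_add_right' _ (((Lp.stronglyMeasurable v).measurable.enorm.pow_const 2).const_mul
    _).aemeasurable, lintegral_const_mul' _ _ ENNReal.ofReal_ne_top, ← enorm_sq_eq_lintegral,
    lintegral_indicator measurableSet_ball, lintegral_const_mul' _ _ ENNReal.ofReal_ne_top,
    ← ofReal_integral_eq_lintegral_ofReal hint (Filter.Eventually.of_forall fun p => by positivity),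
    ← hI, ENNReal.ofReal_add (by positivity) (by positivity), add_mul,
    ENNReal.ofReal_mul (p := A) (q := I) (by positivity),
    ENNReal.ofReal_mul (p := A) (q := ‖v‖ ^ 2) (by positivity), ENNReal.ofReal_pow (norm_nonneg _),
    ofReal_norm]
  refine le_of_eq ?_
  ring

/-- Fatou's lemma along an almost everywhere convergent subsequence; it extends the bound from
generators to their closure although `m` is unbounded. -/
theorem lintegral_mul_le_of_tendsto {s : ℕ} {m : Mom s → ℝ} (hm : Measurable m) {K : ℝ}
    {u : ℕ → OneParticle s} {v : OneParticle s} (huv : Filter.Tendsto u Filter.atTop (nhds v))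
    (hu : ∀ n, ∫⁻ p, ‖(m p : ℂ) * u n p‖ₑ ^ 2 ≤ ENNReal.ofReal K * ‖u n‖ₑ ^ 2) :
    ∫⁻ p, ‖(m p : ℂ) * v p‖ₑ ^ 2 ≤ ENNReal.ofReal K * ‖v‖ₑ ^ 2 := by
  obtain ⟨ns, hns, hae⟩ := (tendstoInMeasure_of_tendsto_Lp huv).exists_seq_tendsto_ae
  have h1 : ∀ᵐ p, ‖(m p : ℂ) * v p‖ₑ ^ 2
      = Filter.liminf (fun n => ‖(m p : ℂ) * u (ns n) p‖ₑ ^ 2) Filter.atTop := by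
    filter_upwards [hae] with p hp
    refine (Filter.Tendsto.liminf_eq ?_).symm
    exact ((ENNReal.continuous_pow 2).tendsto _).comp
      ((continuous_enorm.tendsto _).comp (hp.const_mul _))
  rw [lintegral_congr_ae h1]
  refine (lintegral_liminf_le fun n => ?_).trans ?_
  · exact ((Complex.measurable_ofReal.comp hm).mul
      (Lp.stronglyMeasurable (u (ns n))).measurable).enorm.pow_const 2
  · have h2 : Filter.Tendsto (fun n => ENNReal.ofReal K * ‖u (ns n)‖ₑ ^ 2) Filter.atTop
        (nhds (ENNReal.ofReal K * ‖v‖ₑ ^ 2)) := by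
      refine ENNReal.Tendsto.const_mul ?_ (Or.inr ENNReal.ofReal_ne_top)
      exact ((ENNReal.continuous_pow 2).tendsto _).comp
        ((continuous_enorm.tendsto _).comp (huv.comp hns.tendsto_atTop))
    rw [← h2.liminf_eq]
    exact Filter.liminf_le_liminf (Filter.Eventually.of_forall fun n => hu (ns n))

theorem IsTameSymbol.exists_isMulComp {s : ℕ} (hs : 2 ≤ s) {r : ℝ} (hr : 0 < r) (σ : Sgn)
    {m : Mom s → ℝ} (hm : IsTameSymbol m) : ∃ B, IsMulComp m (localProj s r σ) B := by
  obtain ⟨K, hK, hK'⟩ := hm.exists_lintegral_le hs hr σ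
  have h1 : ∀ f : OneParticle s, ∫⁻ p, ‖(m p : ℂ) * localProj s r σ f p‖ₑ ^ 2 ≤
      ENNReal.ofReal K * ‖localProj s r σ f‖ₑ ^ 2 := by
    intro f
    have h2 : localProj s r σ f ∈ localSubspace s r σ := Submodule.starProjection_apply_mem _ _
    obtain ⟨u, hu, huv⟩ := exists_seq_isLocalVector h2
    exact lintegral_mul_le_of_tendsto hm.measurable huv fun n => hK' _ (hu n)
  have hmeas : ∀ f : OneParticle s, Measurable fun p => (m p : ℂ) * localProj s r σ f p := fun f =>
    (Complex.measurable_ofReal.comp hm.measurable).mul (Lp.stronglyMeasurable _).measurable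
  have h3 : ∀ f : OneParticle s, MemLp (fun p => (m p : ℂ) * localProj s r σ f p) 2 := by
    intro f
    refine ⟨(hmeas f).aestronglyMeasurable, ?_⟩
    rw [eLpNorm_lt_top_iff_lintegral_rpow_enorm_lt_top two_ne_zero ENNReal.ofNat_ne_top]
    simp only [ENNReal.toReal_ofNat, ENNReal.rpow_ofNat]
    exact (h1 f).trans_lt (ENNReal.mul_lt_top ENNReal.ofReal_lt_top (by simp))
  let B : OneParticle s →ₗ[ℂ] OneParticle s :=
    { toFun := fun f => (h3 f).toLp _
      map_add' := fun f g => by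
        refine Lp.ext ?_
        filter_upwards [(h3 (f + g)).coeFn_toLp, (h3 f).coeFn_toLp, (h3 g).coeFn_toLp,
          Lp.coeFn_add ((h3 f).toLp _) ((h3 g).toLp _),
          Lp.coeFn_add (localProj s r σ f) (localProj s r σ g)] with p h4 h5 h6 h7 h8
        rw [h4, h7, Pi.add_apply, h5, h6, map_add, h8, Pi.add_apply, mul_add]
      map_smul' := fun c f => by
        refine Lp.ext ?_
        filter_upwards [(h3 (c • f)).coeFn_toLp, (h3 f).coeFn_toLp,
          Lp.coeFn_smul c ((h3 f).toLp _),
          Lp.coeFn_smul c (localProj s r σ f)] with p h4 h5 h7 h8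
        rw [RingHom.id_apply, h4, h7, Pi.smul_apply, h5, map_smul, h8, Pi.smul_apply, smul_eq_mul,
          smul_eq_mul, mul_left_comm] }
  have hB : ∀ f, ‖B f‖ ≤ Real.sqrt K * ‖f‖ := by
    intro f
    have h4 : ‖B f‖ₑ ^ 2 ≤ ENNReal.ofReal K * ‖localProj s r σ f‖ₑ ^ 2 := by
      rw [enorm_sq_eq_lintegral]
      refine le_of_eq_of_le (lintegral_congr_ae ?_) (h1 f)
      filter_upwards [(h3 f).coeFn_toLp] with p hp
      exact congrArg (fun z => ‖z‖ₑ ^ 2) hp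
    have h5 : ‖localProj s r σ f‖ ≤ ‖f‖ := Submodule.norm_starProjection_apply_le _ _
    rw [← ofReal_norm, ← ofReal_norm, ← ENNReal.ofReal_pow (norm_nonneg _),
      ← ENNReal.ofReal_pow (norm_nonneg _), ← ENNReal.ofReal_mul hK,
      ENNReal.ofReal_le_ofReal_iff (by positivity)] at h4
    refine (sq_le_sq₀ (norm_nonneg _) (by positivity)).1 (h4.trans ?_)
    rw [mul_pow, Real.sq_sqrt hK]
    gcongr
  exact ⟨B.mkContinuous _ hB, fun f => (h3 f).coeFn_toLp⟩

/-! ## Shift of the integration contour -/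

theorem integrable_inv_sq_add_sq {a : ℝ} (ha : 0 < a) :
    Integrable fun ξ : ℝ => (ξ ^ 2 + a ^ 2)⁻¹ := by
  refine ((integrable_inv_one_add_sq.comp_div ha.ne').const_mul (a ^ 2)⁻¹).congr
    (Filter.Eventually.of_forall fun ξ => ?_)
  simp only
  rw [← mul_inv]
  congr 1
  field_simp
  ring

theorem integral_inv_sq_add_sq {a : ℝ} (ha : 0 < a) :
    ∫ ξ : ℝ, (ξ ^ 2 + a ^ 2)⁻¹ = Real.pi / a := by
  have h1 : ∀ ξ : ℝ, (ξ ^ 2 + a ^ 2)⁻¹ = (a ^ 2)⁻¹ * (1 + (ξ / a) ^ 2)⁻¹ := fun ξ => by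
    rw [← mul_inv]
    congr 1
    field_simp
    ring
  simp_rw [h1]
  rw [integral_const_mul, Measure.integral_comp_div (fun x : ℝ => (1 + x ^ 2)⁻¹) a,
    integral_univ_inv_one_add_sq, smul_eq_mul, abs_of_pos ha]
  field_simp

/-- Cauchy's theorem on the rectangle with vertical sides at `±T`, whose contributions are of order
`T⁻²` and vanish in the limit. -/
theorem integral_eq_integral_shift {F : ℂ → ℂ} {η K b : ℝ} (hη : 0 ≤ η) (hb : 0 < b)
    (hF : DifferentiableOn ℂ F {z | -η ≤ z.im ∧ z.im ≤ 0})
    (hbound : ∀ ξ y : ℝ, -η ≤ y → y ≤ 0 → ‖F (ξ + y * Complex.I)‖ ≤ K * (ξ ^ 2 + b ^ 2)⁻¹) :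
    ∫ ξ : ℝ, F ξ = ∫ ξ : ℝ, F (ξ + (-η : ℝ) * Complex.I) := by
  have hint : ∀ y : ℝ, -η ≤ y → y ≤ 0 → Integrable fun ξ : ℝ => F (ξ + y * Complex.I) := by
    intro y h1 h2
    refine ((integrable_inv_sq_add_sq hb).const_mul K).mono' ?_
      (Filter.Eventually.of_forall fun ξ => hbound ξ y h1 h2)
    have hc : Continuous fun ξ : ℝ => F (ξ + y * Complex.I) :=
      hF.continuousOn.comp_continuous (by fun_prop) fun ξ => by simp [h1, h2]
    exact hc.aestronglyMeasurable
  have h0 : ∀ ξ : ℝ, F ξ = F (ξ + (0 : ℝ) * Complex.I) := fun ξ => by simp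
  have hi1 := intervalIntegral_tendsto_integral (hint 0 (by linarith) le_rfl)
    Filter.tendsto_neg_atTop_atBot Filter.tendsto_id
  have hi2 := intervalIntegral_tendsto_integral (hint (-η) le_rfl (by linarith))
    Filter.tendsto_neg_atTop_atBot Filter.tendsto_id
  have hrect : ∀ T : ℝ, 0 ≤ T →
      ‖(∫ ξ in (-T)..T, F (ξ + (0 : ℝ) * Complex.I)) -
        ∫ ξ in (-T)..T, F (ξ + (-η : ℝ) * Complex.I)‖ ≤ 2 * (K * (T ^ 2 + b ^ 2)⁻¹ * η) := by
    intro T hT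
    have h1 := Complex.integral_boundary_rect_eq_zero_of_differentiableOn F
      (⟨-T, -η⟩ : ℂ) (⟨T, 0⟩ : ℂ) (hF.mono (by
        rintro z ⟨-, hz⟩
        simpa [Set.uIcc_of_le (show -η ≤ 0 by linarith)] using hz))
    simp only at h1
    have hside : ∀ X : ℝ, X ^ 2 = T ^ 2 →
        ‖∫ y in (-η)..0, F (X + y * Complex.I)‖ ≤ K * (T ^ 2 + b ^ 2)⁻¹ * η := by
      intro X hX
      have h2 := intervalIntegral.norm_integral_le_of_norm_le_const (a := -η) (b := 0)
        (f := fun y : ℝ => F (X + y * Complex.I)) (C := K * (T ^ 2 + b ^ 2)⁻¹) (by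
          intro y hy
          rw [Set.uIoc_of_le (by linarith)] at hy
          rw [← hX]
          exact hbound X y hy.1.le hy.2)
      simpa [abs_of_nonneg hη] using h2
    have h3 : (∫ ξ in (-T)..T, F (ξ + (0 : ℝ) * Complex.I)) -
        ∫ ξ in (-T)..T, F (ξ + (-η : ℝ) * Complex.I)
        = Complex.I • (∫ y in (-η)..0, F (T + y * Complex.I)) -
          Complex.I • ∫ y in (-η)..0, F ((-T : ℝ) + y * Complex.I) := by
      linear_combination (-1 : ℂ) * h1
    rw [h3]
    refine (norm_sub_le _ _).trans ?_
    rw [norm_smul, norm_smul, Complex.norm_I, one_mul, one_mul, two_mul]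
    exact add_le_add (hside T rfl) (hside (-T) (by ring))
  have hlim : Filter.Tendsto (fun T : ℝ => 2 * (K * (T ^ 2 + b ^ 2)⁻¹ * η)) Filter.atTop
      (nhds (2 * (K * 0 * η))) := by
    refine Filter.Tendsto.const_mul _ (Filter.Tendsto.mul_const _ (Filter.Tendsto.const_mul _ ?_))
    refine Filter.Tendsto.inv_tendsto_atTop ?_
    exact Filter.tendsto_atTop_add_const_right _ _ (Filter.tendsto_pow_atTop two_ne_zero)
  simp_rw [h0]
  refine sub_eq_zero.1 (norm_le_zero_iff.1 ?_)
  have h4 := le_of_tendsto_of_tendsto (hi1.sub hi2).norm hlim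
    (Filter.eventually_atTop.2 ⟨0, fun T hT => hrect T hT⟩)
  simpa using h4

/-! ## The dispersion relation in complex momentum space -/

/-- Real and imaginary parts give `Re S · Im S = Re z · Im z` and `(Re S)² - (Im S)² ≥ (Re z)² - (Im
z)²`. If `|Im S|` exceeded `|Im z|`, then `|Re S|` would exceed `|Re z|`, contradicting the equality
of the products. The time evolution thus grows in the complex domain at most like `e^{|t||Im z|}`.
-/
theorem abs_im_sqrt_le {z S : ℂ} {a : ℝ} (hS : S ^ 2 = z ^ 2 + (a : ℂ) ^ 2) :
    |S.im| ≤ |z.im| := by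
  have h1 : S.re ^ 2 - S.im ^ 2 = z.re ^ 2 - z.im ^ 2 + a ^ 2 := by
    have := congrArg Complex.re hS
    simp [pow_two] at this
    nlinarith
  have h2 : S.re * S.im = z.re * z.im := by
    have := congrArg Complex.im hS
    simp [pow_two] at this
    nlinarith
  by_contra! h
  have h3 : z.im ^ 2 < S.im ^ 2 := sq_lt_sq.2 h
  have h4 : S.re ^ 2 * S.im ^ 2 = z.re ^ 2 * z.im ^ 2 := by
    rw [← mul_pow, h2, mul_pow]
  have h5 : z.re ^ 2 < S.re ^ 2 := by nlinarith [sq_nonneg a]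
  nlinarith [sq_nonneg z.re, sq_nonneg z.im]

theorem re_sq_add_sq (z : ℂ) (a : ℝ) :
    (z ^ 2 + (a : ℂ) ^ 2).re = z.re ^ 2 - z.im ^ 2 + a ^ 2 := by
  simp [pow_two]

/-- The elementary half of Paley–Wiener: since `ℓ` is bounded on the support of `b`, differentiation
under the integral is dominated locally uniformly in `z`. -/
theorem differentiable_integral_exp_mul {s : ℕ} {b : Mom s → ℂ} (hb : Integrable b)
    {ℓ : Mom s → ℝ} (hℓ : Continuous ℓ) {R : ℝ} (hR : ∀ x, b x ≠ 0 → |ℓ x| ≤ R) :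
    Differentiable ℂ fun z : ℂ => ∫ x, Complex.exp (z * ℓ x) * b x := by
  intro z₀
  have hexp : ∀ z x, b x ≠ 0 → ‖Complex.exp (z * ℓ x)‖ ≤ Real.exp (‖z‖ * R) := by
    intro z x hx
    rw [Complex.norm_exp]
    refine Real.exp_le_exp.2 ((Complex.re_le_norm _).trans ?_)
    rw [norm_mul, Complex.norm_real, Real.norm_eq_abs]
    gcongr
    exact hR x hx
  have hle : ∀ z x, ‖Complex.exp (z * ℓ x) * b x‖ ≤ Real.exp (‖z‖ * R) * ‖b x‖ := by
    intro z x
    by_cases hx : b x = 0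
    · simp [hx]
    · rw [norm_mul]
      gcongr
      exact hexp z x hx
  have hm : ∀ z : ℂ, AEStronglyMeasurable (fun x => Complex.exp (z * ℓ x) * b x) volume := by
    intro z
    have : Continuous fun x => Complex.exp (z * ℓ x) := by fun_prop
    exact this.aestronglyMeasurable.mul hb.1
  have h := hasDerivAt_integral_of_dominated_loc_of_deriv_le (μ := volume) (𝕜 := ℂ)
    (F := fun z x => Complex.exp (z * ℓ x) * b x)
    (F' := fun z x => Complex.exp (z * ℓ x) * ℓ x * b x) (x₀ := z₀)
    (s := Metric.ball z₀ 1) (bound := fun x => R * Real.exp ((‖z₀‖ + 1) * R) * ‖b x‖)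
    (Metric.ball_mem_nhds _ one_pos) (Filter.Eventually.of_forall hm)
    ((hb.norm.const_mul _).mono' (hm z₀) (Filter.Eventually.of_forall (hle z₀)))
    ?_ ?_ (hb.norm.const_mul _) ?_
  · exact h.2.differentiableAt
  · have : Continuous fun x => Complex.exp (z₀ * ℓ x) * ℓ x := by fun_prop
    exact this.aestronglyMeasurable.mul hb.1
  · refine Filter.Eventually.of_forall fun x z hz => ?_
    by_cases hx : b x = 0
    · simp [hx]
    · have hR0 : 0 ≤ R := (abs_nonneg _).trans (hR x hx)
      have hz1 : ‖z‖ ≤ ‖z₀‖ + 1 := by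
        have h1 : ‖z - z₀‖ < 1 := by simpa [dist_eq_norm] using hz
        have h2 := norm_sub_norm_le z z₀
        linarith
      rw [norm_mul, norm_mul, Complex.norm_real, Real.norm_eq_abs]
      calc ‖Complex.exp (z * ℓ x)‖ * |ℓ x| * ‖b x‖
          ≤ Real.exp ((‖z₀‖ + 1) * R) * R * ‖b x‖ := by
            gcongr
            · exact (hexp z x hx).trans (Real.exp_le_exp.2 (by gcongr))
            · exact hR x hx
        _ = _ := by ring
  · refine Filter.Eventually.of_forall fun x z _ => ?_
    have h1 : HasDerivAt (fun z : ℂ => z * ℓ x) (ℓ x : ℂ) z := by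
      simpa using (hasDerivAt_id z).mul_const (ℓ x : ℂ)
    exact h1.cexp.mul_const (b x)

theorem norm_integral_exp_mul_le {s : ℕ} {b : Mom s → ℂ} (hb : Integrable b)
    {ℓ : Mom s → ℝ} {R : ℝ} (hR : ∀ x, b x ≠ 0 → |ℓ x| ≤ R) (z : ℂ) :
    ‖∫ x, Complex.exp (z * ℓ x) * b x‖ ≤ Real.exp (|z.re| * R) * ∫ x, ‖b x‖ := by
  rw [← integral_const_mul]
  refine norm_integral_le_of_norm_le (hb.norm.const_mul _) (Filter.Eventually.of_forall fun x => ?_)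
  by_cases hx : b x = 0
  · simp [hx]
  · rw [norm_mul, Complex.norm_exp]
    gcongr
    rw [Complex.re_mul_ofReal]
    refine (le_abs_self _).trans ?_
    rw [abs_mul]
    gcongr
    exact hR x hx

/-- The integral over the component `ξ` of the momentum along `x⃗`, with transverse momentum of
length `a`. The integrand is holomorphic in the strip `-a/2 ≤ Im z ≤ 0`. On the line `Im z = y` it
is bounded by `e^{y(Y - |t| - 2R)}`, where `2R` is the exponential type of `|g̃|²`; `y = -a/2` gives
the decay. -/
theorem norm_fiber_integral_le {s : ℕ} {g : Mom s → ℂ} (hg : Integrable g) {R : ℝ}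
    (hR : ∀ x, g x ≠ 0 → ‖x‖ ≤ R) {u : Mom s} (hu : ‖u‖ = 1) (q : Mom s) {a : ℝ} (ha : 0 < a)
    {t Y : ℝ} (hd : 2 * R ≤ Y - |t|) :
    ‖∫ ξ : ℝ, (((ξ ^ 2 + a ^ 2)⁻¹ * ‖fourier g (ξ • u + q)‖ ^ 2 : ℝ) : ℂ) *
        Complex.exp (Complex.I * ((Real.sqrt (ξ ^ 2 + a ^ 2) * t - ξ * Y : ℝ) : ℂ))‖
      ≤ 4 / 3 * Real.pi * (∫ x, ‖g x‖) ^ 2 *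
        (a⁻¹ * Real.exp (-((Y - |t| - 2 * R) * (a / 2)))) := by
  set n : ℝ := ∫ x, ‖g x‖ with hn
  have hn0 : 0 ≤ n := integral_nonneg fun x => norm_nonneg _
  set c : ℝ := (2 * Real.pi) ^ (-(s : ℝ) / 2) with hc
  have hc0 : 0 < c := Real.rpow_pos_of_pos (by positivity) _
  have hc1 : c ≤ 1 := by
    refine Real.rpow_le_one_of_one_le_of_nonpos (by linarith [Real.pi_gt_three]) ?_
    have : (0 : ℝ) ≤ s := by positivity
    linarith
  set b : Mom s → ℂ := fun x => Complex.exp (-(Complex.I * ((⟪q, x⟫_ℝ : ℝ) : ℂ))) * g x with hb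
  have hbn : ∀ x, ‖b x‖ = ‖g x‖ := fun x => by
    simp only [hb]
    rw [norm_mul, ← mul_neg, ← Complex.ofReal_neg, mul_comm Complex.I,
      Complex.norm_exp_ofReal_mul_I, one_mul]
  have hbi : Integrable b := integrable_exp_mul hg q
  have hbi' : Integrable fun x => conj (b x) := by
    refine hbi.norm.mono' (RCLike.continuous_conj.comp_aestronglyMeasurable hbi.1)
      (Filter.Eventually.of_forall fun x => ?_)
    rw [RCLike.norm_conj]
  have hbR : ∀ x, b x ≠ 0 → |⟪u, x⟫_ℝ| ≤ R := by
    intro x hx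
    have h1 := abs_real_inner_le_norm u x
    rw [hu, one_mul] at h1
    refine h1.trans (hR x fun h => hx ?_)
    simp [hb, h]
  have hbR' : ∀ x, conj (b x) ≠ 0 → |⟪u, x⟫_ℝ| ≤ R := fun x hx =>
    hbR x fun h => hx (by rw [h, map_zero])
  have hR0 : 0 ≤ n * R := by
    by_cases h : ∃ x, g x ≠ 0
    · obtain ⟨x, hx⟩ := h
      exact mul_nonneg hn0 ((norm_nonneg x).trans (hR x hx))
    · push Not at h
      simp [hn, h]
  -- `G₁` continues `g̃(ξu + q)` (without its constant), and `G₂` continues the complex conjugate;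
  -- `c² G₁ G₂` is then an entire continuation of `|g̃|²`.
  set G₁ : ℂ → ℂ := fun z => ∫ x, Complex.exp ((-Complex.I * z) * (⟪u, x⟫_ℝ : ℝ)) * b x with hG₁
  set G₂ : ℂ → ℂ := fun z => ∫ x, Complex.exp ((Complex.I * z) * (⟪u, x⟫_ℝ : ℝ)) * conj (b x)
    with hG₂
  have hcu : Continuous fun x : Mom s => ⟪u, x⟫_ℝ := by fun_prop
  have hd1 : Differentiable ℂ G₁ :=
    (differentiable_integral_exp_mul hbi hcu hbR).comp (differentiable_id.const_mul _)
  have hd2 : Differentiable ℂ G₂ :=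
    (differentiable_integral_exp_mul hbi' hcu hbR').comp (differentiable_id.const_mul _)
  have hn1 : ∀ z, ‖G₁ z‖ ≤ Real.exp (|z.im| * R) * n := fun z => by
    have h := norm_integral_exp_mul_le hbi hbR (-Complex.I * z)
    simpa [hbn, hG₁, hn] using h
  have hn2 : ∀ z, ‖G₂ z‖ ≤ Real.exp (|z.im| * R) * n := fun z => by
    have h := norm_integral_exp_mul_le hbi' hbR' (Complex.I * z)
    simpa [hbn, hG₂, hn] using h
  have hG : ∀ ξ : ℝ, ((‖fourier g (ξ • u + q)‖ ^ 2 : ℝ) : ℂ) = (c : ℂ) ^ 2 * (G₁ ξ * G₂ ξ) := by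
    intro ξ
    have h1 : fourier g (ξ • u + q) = c * G₁ ξ := by
      rw [fourier, hG₁]
      congr 2
      funext x
      simp only [hb]
      rw [← mul_assoc, ← Complex.exp_add, inner_add_left, inner_smul_left]
      congr 2
      push_cast
      simp only [conj_trivial]
      ring
    have h2 : conj (G₁ ξ) = G₂ ξ := by
      rw [hG₁, hG₂]
      simp only
      rw [← integral_conj]
      congr 1
      funext x
      rw [map_mul, ← Complex.exp_conj]
      simp
    rw [h1, norm_mul, mul_pow, Complex.norm_real, Real.norm_of_nonneg hc0.le, ← h2,
      Complex.mul_conj, Complex.normSq_eq_norm_sq]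
    push_cast
    rfl
  set w : ℂ → ℂ := fun z => z ^ 2 + (a : ℂ) ^ 2 with hw
  -- Principal square root; it is holomorphic in the strip because `Re w > 0` there.
  set S : ℂ → ℂ := fun z => w z ^ (((2 : ℕ) : ℂ)⁻¹) with hS
  have hS2 : ∀ z, S z ^ 2 = z ^ 2 + (a : ℂ) ^ 2 := fun z =>
    Complex.cpow_nat_inv_pow _ two_ne_zero
  have hwR : ∀ ξ : ℝ, w ξ = ((ξ ^ 2 + a ^ 2 : ℝ) : ℂ) := fun ξ => by
    simp [hw]
  have hSR : ∀ ξ : ℝ, S ξ = (Real.sqrt (ξ ^ 2 + a ^ 2) : ℝ) := fun ξ => by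
    rw [hS]
    simp only
    rw [hwR, Real.sqrt_eq_rpow, Complex.ofReal_cpow (by positivity)]
    norm_num
  set F : ℂ → ℂ := fun z => (w z)⁻¹ * ((c : ℂ) ^ 2 * (G₁ z * G₂ z)) *
    Complex.exp (Complex.I * (S z * t - z * Y)) with hF
  -- Going down only to `a/2` keeps away from the singularity at `-ia`, at the price of the factor
  -- `4/3`.
  have hre : ∀ z : ℂ, -(a / 2) ≤ z.im → z.im ≤ 0 → 3 / 4 * (z.re ^ 2 + a ^ 2) ≤ (w z).re := by
    intro z h1 h2
    rw [hw]
    simp only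
    rw [re_sq_add_sq]
    nlinarith [sq_nonneg z.re]
  have hre0 : ∀ z : ℂ, -(a / 2) ≤ z.im → z.im ≤ 0 → 0 < (w z).re := fun z h1 h2 =>
    lt_of_lt_of_le (by positivity) (hre z h1 h2)
  have hdiff : DifferentiableOn ℂ F {z | -(a / 2) ≤ z.im ∧ z.im ≤ 0} := by
    intro z hz
    have h1 := hre0 z hz.1 hz.2
    have h2 : w z ≠ 0 := fun h => by
      rw [h] at h1
      simp at h1
    have hwd : DifferentiableAt ℂ w z := by
      simp only [hw]
      fun_prop
    have hSd : DifferentiableAt ℂ S z :=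
      hwd.cpow_const (Or.inl h1)
    have h3 := hd1 z
    have h4 := hd2 z
    refine DifferentiableAt.differentiableWithinAt ?_
    simp only [hF]
    exact ((hwd.inv h2).mul ((h3.mul h4).const_mul _)).mul
      (((hSd.mul_const _).sub (differentiableAt_id.mul_const _)).const_mul _).cexp
  have hbd : ∀ ξ y : ℝ, -(a / 2) ≤ y → y ≤ 0 →
      ‖F (ξ + y * Complex.I)‖ ≤ 4 / 3 * n ^ 2 * Real.exp (y * (Y - |t| - 2 * R)) *
        (ξ ^ 2 + a ^ 2)⁻¹ := by
    intro ξ y h1 h2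
    set z : ℂ := ξ + y * Complex.I with hz
    have hzr : z.re = ξ := by simp [hz]
    have hzi : z.im = y := by simp [hz]
    have h3 := hre z (by rwa [hzi]) (by rwa [hzi])
    rw [hzr] at h3
    have h4 : ‖(w z)⁻¹‖ ≤ 4 / 3 * (ξ ^ 2 + a ^ 2)⁻¹ := by
      rw [norm_inv]
      calc ‖w z‖⁻¹ ≤ (3 / 4 * (ξ ^ 2 + a ^ 2))⁻¹ :=
            inv_anti₀ (by positivity) (h3.trans (Complex.re_le_norm _))
        _ = _ := by rw [mul_inv]; norm_num
    have h5 : ‖Complex.exp (Complex.I * (S z * t - z * Y))‖ ≤ Real.exp (y * (Y - |t|)) := by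
      rw [Complex.norm_exp]
      refine Real.exp_le_exp.2 ?_
      have h6 := abs_im_sqrt_le (hS2 z)
      rw [hzi, abs_of_nonpos h2] at h6
      have h7 : (Complex.I * (S z * t - z * Y)).re = -((S z).im * t) + y * Y := by
        simp [hzi]
        ring
      rw [h7]
      have h8 : -((S z).im * t) ≤ -y * |t| := by
        refine (neg_le_abs _).trans ?_
        rw [abs_mul]
        gcongr
      linarith
    have h6 := hn1 z
    have h7 := hn2 z
    rw [hzi, abs_of_nonpos h2] at h6 h7
    rw [hF]
    simp only [norm_mul, norm_pow, Complex.norm_real]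
    rw [Real.norm_of_nonneg hc0.le]
    have hc2 : c ^ 2 ≤ 1 := pow_le_one₀ hc0.le hc1
    calc ‖(w z)⁻¹‖ * (c ^ 2 * (‖G₁ z‖ * ‖G₂ z‖)) * ‖Complex.exp (Complex.I * (S z * t - z * Y))‖
        ≤ (4 / 3 * (ξ ^ 2 + a ^ 2)⁻¹) * (1 * ((Real.exp (-y * R) * n) * (Real.exp (-y * R) * n))) *
          Real.exp (y * (Y - |t|)) := by gcongr
      _ = 4 / 3 * n ^ 2 * (Real.exp (-y * R) * Real.exp (-y * R) * Real.exp (y * (Y - |t|))) *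
          (ξ ^ 2 + a ^ 2)⁻¹ := by ring
      _ = _ := by
          rw [← Real.exp_add, ← Real.exp_add]
          congr 3
          ring
  have hshift := integral_eq_integral_shift (F := F) (η := a / 2) (K := 4 / 3 * n ^ 2) (b := a)
    (by positivity) ha hdiff (fun ξ y h1 h2 => by
      refine (hbd ξ y h1 h2).trans ?_
      have h3 : Real.exp (y * (Y - |t| - 2 * R)) ≤ 1 := by
        rw [Real.exp_le_one_iff]
        nlinarith
      calc _ ≤ 4 / 3 * n ^ 2 * 1 * (ξ ^ 2 + a ^ 2)⁻¹ := by gcongr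
        _ = _ := by rw [mul_one])
  have hFR : ∀ ξ : ℝ, (((ξ ^ 2 + a ^ 2)⁻¹ * ‖fourier g (ξ • u + q)‖ ^ 2 : ℝ) : ℂ) *
        Complex.exp (Complex.I * ((Real.sqrt (ξ ^ 2 + a ^ 2) * t - ξ * Y : ℝ) : ℂ)) = F ξ := by
    intro ξ
    rw [Complex.ofReal_mul, hG, hF]
    simp only
    rw [hwR, hSR]
    push_cast
    rfl
  simp_rw [hFR]
  rw [hshift]
  refine (norm_integral_le_of_norm_le ((integrable_inv_sq_add_sq ha).const_mul _)
    (Filter.Eventually.of_forall fun ξ => hbd ξ (-(a / 2)) le_rfl (by linarith))).trans ?_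
  rw [integral_const_mul, integral_inv_sq_add_sq ha]
  refine le_of_eq ?_
  rw [show -(a / 2) * (Y - |t| - 2 * R) = -((Y - |t| - 2 * R) * (a / 2)) by ring]
  field_simp

/-! ## Integration over hyperplanes -/

/-- Orthogonal decomposition into the line `ℝu` and its complement, identified isometrically with
`ℝⁿ`. -/
theorem exists_measurePreserving_split {n : ℕ} {u : Mom (n + 1)} (hu : ‖u‖ = 1) :
    ∃ ι : Mom n →ₗᵢ[ℝ] Mom (n + 1), (∀ q, ⟪u, ι q⟫_ℝ = 0) ∧
      MeasurePreserving (fun z : Mom n × ℝ => z.2 • u + ι z.1) (volume.prod volume) volume := by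
  set K : Submodule ℝ (Mom (n + 1)) := ℝ ∙ u with hK
  have hu0 : u ≠ 0 := fun h => by simp [h] at hu
  have hfin : Module.finrank ℝ Kᗮ = n := by
    have : Fact (Module.finrank ℝ (Mom (n + 1)) = n + 1) := ⟨finrank_euclideanSpace_fin⟩
    exact Submodule.finrank_orthogonal_span_singleton hu0
  let b : Kᗮ ≃ₗᵢ[ℝ] Mom n := ((stdOrthonormalBasis ℝ Kᗮ).reindex (finCongr hfin)).repr
  let j : ℝ ≃ₗᵢ[ℝ] K := LinearIsometryEquiv.toSpanUnitSingleton u hu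
  refine ⟨Kᗮ.subtypeₗᵢ.comp b.symm.toLinearIsometry, fun q => ?_, ?_⟩
  · exact Submodule.mem_orthogonal_singleton_iff_inner_right.1 (b.symm q).2
  · have h1 : MeasurePreserving (fun z : Mom n × ℝ => (j z.2, b.symm z.1))
        (volume.prod volume) (volume.prod volume) :=
      (j.measurePreserving.prod b.symm.measurePreserving).comp Measure.measurePreserving_swap
    have h2 := (K.orthogonalDecomposition.symm.measurePreserving.comp
      (WithLp.volume_preserving_toLp (U := K) (V := Kᗮ))).comp h1
    have h3 : (fun z : Mom n × ℝ => z.2 • u +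
        (Kᗮ.subtypeₗᵢ.comp b.symm.toLinearIsometry) z.1)
        = (K.orthogonalDecomposition.symm ∘ WithLp.toLp 2) ∘
          fun z : Mom n × ℝ => (j z.2, b.symm z.1) := by
      funext z
      rfl
    rw [h3]
    exact h2

theorem integrable_inv_norm_mul_exp {n : ℕ} (hn : 2 ≤ n) :
    Integrable fun q : Mom n => ‖q‖⁻¹ * Real.exp (-(‖q‖ / 2)) := by
  have : NeZero n := ⟨by omega⟩
  rw [integrable_fun_norm_addHaar (E := Mom n) volume
    (f := fun y => y⁻¹ * Real.exp (-(y / 2))), finrank_euclideanSpace_fin]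
  have hn' : (2 : ℝ) ≤ n := by exact_mod_cast hn
  have h1 := integrableOn_rpow_mul_exp_neg_mul_rpow (p := 1) (s := (n : ℝ) - 2) (b := 1 / 2)
    (by linarith) one_pos (by norm_num)
  refine h1.congr_fun (fun y hy => ?_) measurableSet_Ioi
  have hy0 : (0 : ℝ) < y := hy
  simp only [smul_eq_mul, Real.rpow_one]
  rw [← mul_assoc, show (n : ℝ) - 2 = ((n - 1 : ℕ) : ℝ) + (-1) by
    rw [Nat.cast_sub (by omega)]; push_cast; ring, Real.rpow_add hy0, Real.rpow_natCast,
    Real.rpow_neg_one]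
  congr 2
  ring

/-- Scaling `q ↦ Dq`: the Jacobian `D⁻ⁿ` loses one power to `|q|⁻¹`. With `n = s - 1` this is the
origin of the exponent `s - 2`. -/
theorem integral_inv_norm_mul_exp {n : ℕ} (hn : 2 ≤ n) {D : ℝ} (hD : 0 < D) :
    Integrable (fun q : Mom n => ‖q‖⁻¹ * Real.exp (-(D * (‖q‖ / 2)))) ∧
    ∫ q : Mom n, ‖q‖⁻¹ * Real.exp (-(D * (‖q‖ / 2)))
      = (D ^ (n - 1))⁻¹ * ∫ q : Mom n, ‖q‖⁻¹ * Real.exp (-(‖q‖ / 2)) := by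
  have h1 : ∀ q : Mom n, ‖q‖⁻¹ * Real.exp (-(D * (‖q‖ / 2)))
      = D * (‖D • q‖⁻¹ * Real.exp (-(‖D • q‖ / 2))) := by
    intro q
    rw [norm_smul, Real.norm_of_nonneg hD.le, mul_inv, ← mul_assoc, ← mul_assoc,
      mul_inv_cancel₀ hD.ne', one_mul, mul_div_assoc]
  simp_rw [h1]
  refine ⟨((integrable_inv_norm_mul_exp hn).comp_smul hD.ne').const_mul D, ?_⟩
  rw [integral_const_mul, Measure.integral_comp_smul volume
    (fun q : Mom n => ‖q‖⁻¹ * Real.exp (-(‖q‖ / 2))) D, finrank_euclideanSpace_fin,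
    abs_of_pos (by positivity), smul_eq_mul, ← mul_assoc]
  congr 1
  obtain ⟨m, rfl⟩ : ∃ m, n = m + 1 := ⟨n - 1, by omega⟩
  simp only [Nat.add_sub_cancel]
  field_simp
  ring

/-- The decay of `∫ |p|^{-2} |g̃(p)|² e^{i(|p|x⁰ - p·x⃗)} dp` in spacelike directions. -/
theorem exists_norm_integral_planePhase_le {s : ℕ} (hs : 3 ≤ s) :
    ∃ C, 0 < C ∧ ∀ (g : Mom s → ℂ) (R : ℝ), Integrable g → (∀ x, g x ≠ 0 → ‖x‖ ≤ R) → 0 ≤ R →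
      Integrable (fun p => (‖p‖ ^ 2)⁻¹ * ‖fourier g p‖ ^ 2) →
      ∀ x : Spacetime s, 2 * R < ‖x.2‖ - |x.1| →
        ‖∫ p, (((‖p‖ ^ 2)⁻¹ * ‖fourier g p‖ ^ 2 : ℝ) : ℂ) * planePhase x p‖ ≤
          C * (∫ y, ‖g y‖) ^ 2 * ((‖x.2‖ - |x.1| - 2 * R) ^ (s - 2))⁻¹ := by
  obtain ⟨n, rfl⟩ : ∃ n, s = n + 1 := ⟨s - 1, by omega⟩
  have hn : 2 ≤ n := by omega
  have : NeZero n := ⟨by omega⟩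
  set I : ℝ := ∫ q : Mom n, ‖q‖⁻¹ * Real.exp (-(‖q‖ / 2)) with hI
  have hI0 : 0 ≤ I := integral_nonneg fun q => by positivity
  refine ⟨4 / 3 * Real.pi * I + 1, by positivity, ?_⟩
  rintro g R hg hR hR0 hint ⟨t, y⟩ hd
  simp only at hd ⊢
  have hy : 0 < ‖y‖ := by linarith [abs_nonneg t]
  -- With `u` along `x⃗` the phase depends on the transverse momentum only through its length, as in
  -- the fiber estimate.
  set u : Mom (n + 1) := ‖y‖⁻¹ • y with hu
  have hu1 : ‖u‖ = 1 := norm_smul_inv_norm (𝕜 := ℝ) (norm_pos_iff.1 hy)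
  have hyu : y = ‖y‖ • u := by
    rw [hu, smul_smul, mul_inv_cancel₀ hy.ne', one_smul]
  obtain ⟨ι, hι, hmp⟩ := exists_measurePreserving_split hu1
  have hnorm : ∀ (k : ℝ) (q : Mom n), ‖k • u + ι q‖ ^ 2 = k ^ 2 + ‖q‖ ^ 2 := by
    intro k q
    have h1 : ⟪k • u, ι q⟫_ℝ = 0 := by rw [inner_smul_left, hι, mul_zero]
    rw [pow_two, norm_add_sq_eq_norm_sq_add_norm_sq_of_inner_eq_zero _ _ h1, norm_smul, hu1,
      ι.norm_map, mul_one, Real.norm_eq_abs, abs_mul_abs_self]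
    ring
  set Φ : Mom (n + 1) → ℂ := fun p =>
    (((‖p‖ ^ 2)⁻¹ * ‖fourier g p‖ ^ 2 : ℝ) : ℂ) * planePhase (t, y) p with hΦ
  have hΦi : Integrable Φ :=
    hint.ofReal.mul_bdd (c := 1) (continuous_planePhase _).aestronglyMeasurable
      (Filter.Eventually.of_forall fun p => (norm_planePhase _ p).le)
  have hΦ2 : Integrable (fun z : Mom n × ℝ => Φ (z.2 • u + ι z.1)) (volume.prod volume) :=
    hmp.integrable_comp_of_integrable hΦi
  have h1 : ∫ p, Φ p = ∫ q : Mom n, ∫ k : ℝ, Φ (k • u + ι q) := by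
    rw [← hmp.map_eq, integral_map hmp.measurable.aemeasurable (by
      rw [hmp.map_eq]; exact hΦi.1)]
    exact integral_prod _ hΦ2
  have hfib : ∀ᵐ q : Mom n, ‖∫ k : ℝ, Φ (k • u + ι q)‖ ≤ 4 / 3 * Real.pi * (∫ y, ‖g y‖) ^ 2 *
      (‖q‖⁻¹ * Real.exp (-((‖y‖ - |t| - 2 * R) * (‖q‖ / 2)))) := by
    filter_upwards [Measure.ae_ne volume (0 : Mom n)] with q hq
    have h2 := norm_fiber_integral_le hg hR hu1 (ι q) (norm_pos_iff.2 hq) (t := t) (Y := ‖y‖)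
      hd.le
    refine le_of_eq_of_le ?_ h2
    congr 2
    funext k
    have h3 : ‖k • u + ι q‖ = Real.sqrt (k ^ 2 + ‖q‖ ^ 2) := by
      rw [← hnorm, Real.sqrt_sq (norm_nonneg _)]
    have h4 : ⟪k • u + ι q, y⟫_ℝ = k * ‖y‖ := by
      conv_lhs => rw [hyu]
      rw [inner_smul_right, inner_add_left, inner_smul_left, real_inner_self_eq_norm_sq, hu1,
        real_inner_comm, hι]
      simp
      ring
    simp only [hΦ, planePhase]
    rw [h4, hnorm, h3]
  obtain ⟨h5, h6⟩ := integral_inv_norm_mul_exp hn (D := ‖y‖ - |t| - 2 * R) (by linarith)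
  rw [h1]
  refine (norm_integral_le_of_norm_le (h5.const_mul _) hfib).trans ?_
  rw [integral_const_mul, h6, ← hI, show n + 1 - 2 = n - 1 by omega]
  have h7 : 0 ≤ ((‖y‖ - |t| - 2 * R) ^ (n - 1))⁻¹ := by
    have : 0 ≤ ‖y‖ - |t| - 2 * R := by linarith
    positivity
  calc 4 / 3 * Real.pi * (∫ y, ‖g y‖) ^ 2 * (((‖y‖ - |t| - 2 * R) ^ (n - 1))⁻¹ * I)
      = (4 / 3 * Real.pi * I) * (∫ y, ‖g y‖) ^ 2 * ((‖y‖ - |t| - 2 * R) ^ (n - 1))⁻¹ := by ring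
    _ ≤ _ := by gcongr; linarith

open scoped FourierTransform Convolution Pointwise

/-! ## Smoothed local vectors -/

theorem IsTestFunction.convolution {s : ℕ} {r : ℝ} {h f : Mom s → ℂ} (hh : IsTestFunction r h)
    (hf : IsTestFunction r f) :
    IsTestFunction (2 * r) (h ⋆[ContinuousLinearMap.mul ℂ ℂ, volume] f) where
  smooth := by
    have h1 : (h ⋆[ContinuousLinearMap.mul ℂ ℂ, volume] f)
        = h ⋆[ContinuousLinearMap.mul ℝ ℂ, volume] f := rfl
    rw [h1]
    exact hf.compact.contDiff_convolution_right _ hh.integrable.locallyIntegrable hf.smooth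
  compact := hh.compact.convolution _ hf.compact
  supp := by
    have h1 : tsupport (h ⋆[ContinuousLinearMap.mul ℂ ℂ, volume] f) ⊆ tsupport h + tsupport f :=
      closure_minimal ((support_convolution_subset _).trans
        (Set.add_subset_add subset_closure subset_closure))
        (hh.compact.isCompact.add hf.compact.isCompact).isClosed
    refine h1.trans ?_
    rintro _ ⟨x, hx, y, hy, rfl⟩
    have hx' : ‖x‖ < r := by simpa using hh.supp hx
    have hy' : ‖y‖ < r := by simpa using hf.supp hy
    have hxy := norm_add_le x y
    simp only [Metric.mem_ball, dist_zero_right]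
    linarith

theorem IsTestFunction.norm_fourier_convolution_sq {s : ℕ} {r : ℝ} {h f : Mom s → ℂ}
    (hh : IsTestFunction r h) (hf : IsTestFunction r f) (p : Mom s) :
    ‖fourier (h ⋆[ContinuousLinearMap.mul ℂ ℂ, volume] f) p‖ ^ 2
      = (2 * Real.pi) ^ (s : ℝ) * (‖fourier h p‖ ^ 2 * ‖fourier f p‖ ^ 2) := by
  have hpi : 0 < 2 * Real.pi := by positivity
  have hc : 0 < (2 * Real.pi) ^ (-(s : ℝ) / 2) := Real.rpow_pos_of_pos hpi _
  have h1 : (2 * Real.pi) ^ (s : ℝ) * ((2 * Real.pi) ^ (-(s : ℝ) / 2)) ^ 2 = 1 := by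
    rw [← Real.rpow_natCast, ← Real.rpow_mul hpi.le, ← Real.rpow_add hpi]
    simp
  rw [fourier_eq_const_mul, fourier_eq_const_mul h, fourier_eq_const_mul f,
    Real.fourier_mul_convolution_eq hh.integrable hf.integrable]
  simp only [norm_mul, Complex.norm_real, mul_pow]
  rw [Real.norm_of_nonneg hc.le]
  linear_combination -(((2 * Real.pi) ^ (-(s : ℝ) / 2)) ^ 2 * ‖𝓕 h ((2 * Real.pi)⁻¹ • p)‖ ^ 2 *
    ‖𝓕 f ((2 * Real.pi)⁻¹ • p)‖ ^ 2) * h1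

theorem IsTestFunction.lineDeriv {s : ℕ} {r : ℝ} {h : Mom s → ℂ} (hh : IsTestFunction r h)
    (m : Mom s) : IsTestFunction r fun x => fderiv ℝ h x m where
  smooth := (hh.smooth.fderiv_right (by simp)).clm_apply contDiff_const
  compact := hh.compact.fderiv_apply (𝕜 := ℝ) m
  supp := by
    refine (closure_mono ?_).trans ((tsupport_fderiv_subset ℝ).trans hh.supp)
    intro x hx hx'
    exact hx (by simp only [hx', zero_apply])

theorem IsTestFunction.norm_fourier_lineDeriv_sq {s : ℕ} {r : ℝ} {h : Mom s → ℂ}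
    (hh : IsTestFunction r h) (m p : Mom s) :
    ‖fourier (fun x => fderiv ℝ h x m) p‖ ^ 2 = ⟪p, m⟫_ℝ ^ 2 * ‖fourier h p‖ ^ 2 := by
  have hpi : 0 < 2 * Real.pi := by positivity
  have h1 : (hh.lineDeriv m).schwartz = LineDeriv.lineDerivOp m hh.schwartz := by
    ext x
    rw [SchwartzMap.lineDerivOp_apply_eq_fderiv]
    rfl
  have hg : (inner ℝ · m).HasTemperateGrowth := ((innerSL ℝ (E := Mom s)).flip m).hasTemperateGrowth
  have h2 : ∀ w : Mom s, ‖𝓕 (hh.lineDeriv m).schwartz w‖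
      = 2 * Real.pi * (|⟪w, m⟫_ℝ| * ‖𝓕 hh.schwartz w‖) := by
    intro w
    rw [h1, SchwartzMap.fourier_lineDerivOp_eq, smul_apply,
      SchwartzMap.smulLeftCLM_apply_apply hg, norm_smul, norm_smul]
    simp [abs_of_pos Real.pi_pos]
  rw [(hh.lineDeriv m).fourier_eq, hh.fourier_eq, norm_mul, norm_mul, h2, inner_smul_left,
    conj_trivial, abs_mul, abs_of_pos (by positivity : 0 < (2 * Real.pi)⁻¹)]
  rw [← sq_abs ⟪p, m⟫_ℝ]
  field_simp

/-- Cauchy–Schwarz on the ball, in the form that the variance of `|g|` about its mean `N/V` is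
nonnegative. -/
theorem sq_integral_norm_le {s : ℕ} {R : ℝ} (hR : 0 < R) {g : Mom s → ℂ}
    (hg : IsTestFunction R g) :
    (∫ x, ‖g x‖) ^ 2 ≤ volume.real (Metric.ball (0 : Mom s) R) * ∫ x, ‖g x‖ ^ 2 := by
  set B : Set (Mom s) := Metric.ball 0 R with hB
  set V : ℝ := volume.real B with hV
  have hVf : volume B ≠ ⊤ := measure_ball_lt_top.ne
  have hV0 : 0 < V := ENNReal.toReal_pos (Metric.measure_ball_pos _ _ hR).ne' hVf
  have h0 : ∀ x, x ∉ B → g x = 0 := fun x hx =>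
    image_eq_zero_of_notMem_tsupport fun h => hx (hg.supp h)
  have hi2 : Integrable fun x => ‖g x‖ ^ 2 := by
    have h1 : HasCompactSupport fun x => ‖g x‖ ^ 2 :=
      hg.compact.comp_left (g := fun z : ℂ => ‖z‖ ^ 2) (by simp)
    exact (hg.smooth.continuous.norm.pow 2).integrable_of_hasCompactSupport h1
  set N : ℝ := ∫ x, ‖g x‖ with hN
  have h1 : ∫ x in B, ‖g x‖ = N :=
    setIntegral_eq_integral_of_forall_compl_eq_zero fun x hx => by simp [h0 x hx]
  have h2 : ∫ x in B, ‖g x‖ ^ 2 = ∫ x, ‖g x‖ ^ 2 :=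
    setIntegral_eq_integral_of_forall_compl_eq_zero fun x hx => by simp [h0 x hx]
  have h3 : 0 ≤ ∫ x in B, (‖g x‖ - N / V) ^ 2 := integral_nonneg fun x => sq_nonneg _
  have h4 : ∫ x in B, (‖g x‖ - N / V) ^ 2
      = (∫ x, ‖g x‖ ^ 2) - 2 * (N / V) * N + V * (N / V) ^ 2 := by
    have h5 : ∀ x, (‖g x‖ - N / V) ^ 2 = ‖g x‖ ^ 2 - 2 * (N / V) * ‖g x‖ + (N / V) ^ 2 :=
      fun x => by ring
    have hc : IntegrableOn (fun _ : Mom s => (N / V) ^ 2) B := integrableOn_const hVf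
    have ha : IntegrableOn (fun x => 2 * (N / V) * ‖g x‖) B :=
      (hg.integrable.norm.const_mul _).integrableOn
    simp_rw [h5]
    have hab : IntegrableOn (fun x => ‖g x‖ ^ 2 - 2 * (N / V) * ‖g x‖) B :=
      hi2.integrableOn.sub ha
    rw [integral_add hab hc, integral_sub hi2.integrableOn ha,
      integral_const_mul, h1, h2, setIntegral_const, smul_eq_mul]
  rw [h4] at h3
  have h6 : V * (N / V) ^ 2 = N / V * N := by
    field_simp
  have h7 : N / V * N ≤ ∫ x, ‖g x‖ ^ 2 := by linarith
  calc N ^ 2 = V * (N / V * N) := by field_simp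
    _ ≤ _ := by gcongr

theorem IsTestFunction.integral_norm_fourier_sq {s : ℕ} {r : ℝ} {g : Mom s → ℂ}
    (hg : IsTestFunction r g) : ∫ p, ‖fourier g p‖ ^ 2 = ∫ x, ‖g x‖ ^ 2 := by
  have h1 := hg.integral_conj_fourier_mul hg
  have h2 : ∀ z : ℂ, conj z * z = ((‖z‖ ^ 2 : ℝ) : ℂ) := fun z => by
    rw [mul_comm, Complex.mul_conj, Complex.normSq_eq_norm_sq]
  simp only [h2] at h1
  rw [integral_complex_ofReal, integral_complex_ofReal] at h1
  exact_mod_cast h1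

theorem IsTestFunction.integrable_norm_rpow_mul_fourier_sq {s : ℕ} [NeZero s] {r : ℝ}
    {g : Mom s → ℂ} (hg : IsTestFunction r g) {a : ℝ} (ha : -(s : ℝ) < a) (ha1 : a ≤ 1) :
    Integrable fun p => ‖p‖ ^ a * ‖fourier g p‖ ^ 2 := by
  obtain ⟨C, hC, hC'⟩ := hg.exists_fourier_decay (s + 2)
  have h1 := (integrable_norm_rpow_mul (s := s) ha ha1 (k := 2 * (s + 2)) (by omega)).const_mul
    (C ^ 2)
  refine h1.mono' ?_ (Filter.Eventually.of_forall fun p => ?_)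
  · have h2 := hg.continuous_fourier.measurable
    have : Measurable fun p => ‖p‖ ^ a * ‖fourier g p‖ ^ 2 := by fun_prop
    exact this.aestronglyMeasurable
  · rw [Real.norm_of_nonneg (by positivity)]
    have h2 : ‖fourier g p‖ ≤ C * ((1 + ‖p‖) ^ (s + 2))⁻¹ := by
      rw [← div_eq_mul_inv, le_div_iff₀ (by positivity), mul_comm]
      exact hC' p
    calc ‖p‖ ^ a * ‖fourier g p‖ ^ 2 ≤ ‖p‖ ^ a * (C * ((1 + ‖p‖) ^ (s + 2))⁻¹) ^ 2 := by gcongr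
      _ = _ := by rw [mul_pow, inv_pow, ← pow_mul, mul_comm (s + 2) 2]; ring

/-- The product `k̃ f̃` is, up to a constant, the Fourier transform of `g = k ⋆ f`, supported in
radius `2r`; hence the margin `4r`. Compact support bounds `‖g‖₁²` by `‖g‖₂²`, and Plancherel
returns to momentum space. -/
theorem exists_norm_integral_fourier_mul_le {s : ℕ} (hs : 3 ≤ s) {r : ℝ} (hr : 0 < r) :
    ∃ C, 0 < C ∧ ∀ k f : Mom s → ℂ, IsTestFunction r k → IsTestFunction r f →
      Integrable (fun p => (‖p‖ ^ 2)⁻¹ * (‖fourier k p‖ ^ 2 * ‖fourier f p‖ ^ 2)) ∧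
      Integrable (fun p => ‖fourier k p‖ ^ 2 * ‖fourier f p‖ ^ 2) ∧
      ∀ x : Spacetime s, 4 * r < ‖x.2‖ - |x.1| →
        ‖∫ p, (((‖p‖ ^ 2)⁻¹ * (‖fourier k p‖ ^ 2 * ‖fourier f p‖ ^ 2) : ℝ) : ℂ) *
            planePhase x p‖ ≤
          C * (∫ p, ‖fourier k p‖ ^ 2 * ‖fourier f p‖ ^ 2) *
            ((‖x.2‖ - |x.1| - 4 * r) ^ (s - 2))⁻¹ := by
  have : NeZero s := ⟨by omega⟩
  have hs' : (3 : ℝ) ≤ s := by exact_mod_cast hs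
  obtain ⟨C, hC, hC'⟩ := exists_norm_integral_planePhase_le hs
  set V : ℝ := volume.real (Metric.ball (0 : Mom s) (2 * r)) with hV
  refine ⟨C * V + 1, by positivity, fun k f hk hf => ?_⟩
  set g : Mom s → ℂ := k ⋆[ContinuousLinearMap.mul ℂ ℂ, volume] f with hgdef
  have hg : IsTestFunction (2 * r) g := hk.convolution hf
  set c : ℝ := (2 * Real.pi) ^ (s : ℝ) with hc
  have hc0 : 0 < c := Real.rpow_pos_of_pos (by positivity) _
  have hgf : ∀ p, ‖fourier k p‖ ^ 2 * ‖fourier f p‖ ^ 2 = c⁻¹ * ‖fourier g p‖ ^ 2 := fun p => by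
    rw [hgdef, hk.norm_fourier_convolution_sq hf, ← mul_assoc, inv_mul_cancel₀ hc0.ne', one_mul]
  have hi1 : Integrable fun p => (‖p‖ ^ 2)⁻¹ * ‖fourier g p‖ ^ 2 := by
    refine (hg.integrable_norm_rpow_mul_fourier_sq (a := -2) (by linarith) (by norm_num)).congr
      (Filter.Eventually.of_forall fun p => ?_)
    simp only
    rw [Real.rpow_neg (norm_nonneg _)]
    norm_num
  have hi2 : Integrable fun p => ‖fourier g p‖ ^ 2 := by
    refine (hg.integrable_norm_rpow_mul_fourier_sq (a := 0) (by linarith) (by norm_num)).congr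
      (Filter.Eventually.of_forall fun p => ?_)
    simp
  have hswap : ∀ p : Mom s, (‖p‖ ^ 2)⁻¹ * (c⁻¹ * ‖fourier g p‖ ^ 2)
      = c⁻¹ * ((‖p‖ ^ 2)⁻¹ * ‖fourier g p‖ ^ 2) := fun p => by ring
  simp only [hgf, hswap]
  refine ⟨hi1.const_mul _, hi2.const_mul _, fun x hx => ?_⟩
  have h1 := hC' g (2 * r) hg.integrable (fun x hx => by
    have h2 : x ∈ Metric.ball (0 : Mom s) (2 * r) := hg.supp (subset_tsupport g hx)
    exact (by simpa using h2 : ‖x‖ < 2 * r).le) (by positivity) hi1 x (by linarith)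
  have h2 := sq_integral_norm_le (by positivity) hg
  rw [← hV, ← hg.integral_norm_fourier_sq] at h2
  have h3 : ∫ p, ((c⁻¹ * ((‖p‖ ^ 2)⁻¹ * ‖fourier g p‖ ^ 2) : ℝ) : ℂ) * planePhase x p
      = (c⁻¹ : ℝ) * ∫ p, (((‖p‖ ^ 2)⁻¹ * ‖fourier g p‖ ^ 2 : ℝ) : ℂ) * planePhase x p := by
    rw [← integral_const_mul]
    congr 1
    funext p
    push_cast
    ring
  rw [h3, norm_mul, Complex.norm_real, Real.norm_of_nonneg (by positivity), integral_const_mul]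
  have hd : 0 ≤ ((‖x.2‖ - |x.1| - 4 * r) ^ (s - 2))⁻¹ := by
    have : 0 ≤ ‖x.2‖ - |x.1| - 4 * r := by linarith
    positivity
  have hI : 0 ≤ ∫ p, ‖fourier g p‖ ^ 2 := integral_nonneg fun p => by positivity
  rw [show 2 * (2 * r) = 4 * r by ring] at h1
  calc _ ≤ c⁻¹ * (C * (V * ∫ p, ‖fourier g p‖ ^ 2) * ((‖x.2‖ - |x.1| - 4 * r) ^ (s - 2))⁻¹) := by
        gcongr
        exact h1.trans (by gcongr)
    _ = (C * V) * (c⁻¹ * ∫ p, ‖fourier g p‖ ^ 2) * ((‖x.2‖ - |x.1| - 4 * r) ^ (s - 2))⁻¹ := by ring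
    _ ≤ _ := by gcongr; linarith

/-! ## Decay of the correlations -/

/-- The symbol of `ω^a |h̃|`. -/
def powSymbol {s : ℕ} (a : ℝ) (h : Mom s → ℂ) (p : Mom s) : ℝ := ‖p‖ ^ a * ‖fourier h p‖

theorem sum_sq_inner_basis {s : ℕ} (p : Mom s) :
    ∑ j, ⟪p, EuclideanSpace.basisFun (Fin s) ℝ j⟫_ℝ ^ 2 = ‖p‖ ^ 2 := by
  have h := (EuclideanSpace.basisFun (Fin s) ℝ).sum_sq_norm_inner_left p
  simpa only [Real.norm_eq_abs, sq_abs] using h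

/-- Both signs are brought to the weight `|p|⁻²`. For `+` the powers of `ω` produce it directly. For
`-` they cancel, and `1 = |p|⁻² ∑ⱼ pⱼ²` is inserted, where `pⱼ h̃` is up to a phase the transform of
`∂ⱼh`, again a test function on the same ball. -/
theorem integral_planePhase_local_le {s : ℕ} (hs : 3 ≤ s) {r : ℝ} (hr : 0 < r) :
    ∃ C, 0 < C ∧ ∀ (h : Mom s → ℂ), IsTestFunction r h → ∀ (σ : Sgn) (v : OneParticle s),
      IsLocalVector r σ v → ∀ x : Spacetime s, 4 * r < ‖x.2‖ - |x.1| →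
        ‖∫ p, (((powSymbol (-(1 / 2)) h p * ‖v p‖) ^ 2 : ℝ) : ℂ) * planePhase x p‖ ≤
          C * (∫ p, (powSymbol (1 / 2) h p * ‖v p‖) ^ 2) *
            ((‖x.2‖ - |x.1| - 4 * r) ^ (s - 2))⁻¹ := by
  have : NeZero s := ⟨by omega⟩
  obtain ⟨C, hC, hC'⟩ := exists_norm_integral_fourier_mul_le hs hr
  have hpow : ∀ (p : Mom s), 0 < ‖p‖ → ∀ a : ℝ, (‖p‖ ^ a) ^ 2 = ‖p‖ ^ (2 * a) := by
    intro p hp a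
    rw [← Real.rpow_natCast, ← Real.rpow_mul hp.le, mul_comm]
    norm_num
  refine ⟨C, hC, ?_⟩
  rintro h hh σ v ⟨f, hf, hv⟩ x hx
  cases σ with
  | plus =>
    obtain ⟨-, -, h3⟩ := hC' h f hh hf
    have h1 : ∀ᵐ p, (powSymbol (-(1 / 2)) h p * ‖v p‖) ^ 2
        = (‖p‖ ^ 2)⁻¹ * (‖fourier h p‖ ^ 2 * ‖fourier f p‖ ^ 2) := by
      filter_upwards [hv, Measure.ae_ne volume (0 : Mom s)] with p hp hp0
      have hp1 : 0 < ‖p‖ := norm_pos_iff.2 hp0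
      rw [hp, norm_mul, Complex.norm_real, Real.norm_of_nonneg (by positivity), powSymbol,
        Sgn.exponent, mul_pow, mul_pow, mul_pow, hpow p hp1]
      norm_num
      rw [Real.rpow_neg_one]
      field_simp
    have h2 : ∀ᵐ p, (powSymbol (1 / 2) h p * ‖v p‖) ^ 2
        = ‖fourier h p‖ ^ 2 * ‖fourier f p‖ ^ 2 := by
      filter_upwards [hv, Measure.ae_ne volume (0 : Mom s)] with p hp hp0
      have hp1 : 0 < ‖p‖ := norm_pos_iff.2 hp0
      rw [hp, norm_mul, Complex.norm_real, Real.norm_of_nonneg (by positivity), powSymbol,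
        Sgn.exponent, mul_pow, mul_pow, mul_pow, hpow p hp1, hpow p hp1]
      norm_num
      rw [Real.rpow_neg_one]
      field_simp
    rw [integral_congr_ae h2]
    refine le_of_eq_of_le ?_ (h3 x hx)
    congr 1
    refine integral_congr_ae ?_
    filter_upwards [h1] with p hp
    rw [hp]
  | minus =>
    set b := EuclideanSpace.basisFun (Fin s) ℝ with hb
    set k : Fin s → Mom s → ℂ := fun j x => fderiv ℝ h x (b j) with hk
    have hkt : ∀ j, IsTestFunction r (k j) := fun j => hh.lineDeriv (b j)
    have h0 := fun j => hC' (k j) f (hkt j) hf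
    have hkn : ∀ j p, ‖fourier (k j) p‖ ^ 2 = ⟪p, b j⟫_ℝ ^ 2 * ‖fourier h p‖ ^ 2 := fun j p =>
      hh.norm_fourier_lineDeriv_sq (b j) p
    have h2 : ∀ᵐ p, (powSymbol (1 / 2) h p * ‖v p‖) ^ 2
        = ∑ j, ‖fourier (k j) p‖ ^ 2 * ‖fourier f p‖ ^ 2 := by
      filter_upwards [hv, Measure.ae_ne volume (0 : Mom s)] with p hp hp0
      have hp1 : 0 < ‖p‖ := norm_pos_iff.2 hp0
      simp only [hkn]
      rw [← Finset.sum_mul, ← Finset.sum_mul, sum_sq_inner_basis]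
      rw [hp, norm_mul, Complex.norm_real, Real.norm_of_nonneg (by positivity), powSymbol,
        Sgn.exponent, mul_pow, mul_pow, mul_pow, hpow p hp1]
      norm_num
      ring
    have h1 : ∀ᵐ p, (powSymbol (-(1 / 2)) h p * ‖v p‖) ^ 2
        = ∑ j, (‖p‖ ^ 2)⁻¹ * (‖fourier (k j) p‖ ^ 2 * ‖fourier f p‖ ^ 2) := by
      filter_upwards [hv, Measure.ae_ne volume (0 : Mom s)] with p hp hp0
      have hp1 : 0 < ‖p‖ := norm_pos_iff.2 hp0
      simp only [hkn]
      rw [← Finset.mul_sum, ← Finset.sum_mul, ← Finset.sum_mul, sum_sq_inner_basis]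
      rw [hp, norm_mul, Complex.norm_real, Real.norm_of_nonneg (by positivity), powSymbol,
        Sgn.exponent, mul_pow, mul_pow, mul_pow, hpow p hp1, hpow p hp1]
      norm_num
      rw [Real.rpow_neg_one]
      field_simp
    have h3 : ∫ p, (((powSymbol (-(1 / 2)) h p * ‖v p‖) ^ 2 : ℝ) : ℂ) * planePhase x p
        = ∑ j, ∫ p, (((‖p‖ ^ 2)⁻¹ * (‖fourier (k j) p‖ ^ 2 * ‖fourier f p‖ ^ 2) : ℝ) : ℂ) *
          planePhase x p := by
      have hint : ∀ j, Integrable fun p =>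
          (((‖p‖ ^ 2)⁻¹ * (‖fourier (k j) p‖ ^ 2 * ‖fourier f p‖ ^ 2) : ℝ) : ℂ) *
            planePhase x p := fun j => (h0 j).1.ofReal.mul_bdd (c := 1)
        (continuous_planePhase _).aestronglyMeasurable
        (Filter.Eventually.of_forall fun p => (norm_planePhase _ p).le)
      rw [← integral_finsetSum _ fun j _ => hint j]
      refine integral_congr_ae ?_
      filter_upwards [h1] with p hp
      rw [hp, Complex.ofReal_sum, Finset.sum_mul]
    rw [integral_congr_ae h2, h3, integral_finsetSum _ fun j _ => (h0 j).2.1]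
    refine (norm_sum_le _ _).trans ?_
    rw [Finset.mul_sum, Finset.sum_mul]
    exact Finset.sum_le_sum fun j _ => (h0 j).2.2 x hx

/-! ### Translations of one-particle vectors and passage to the closed subspaces. -/

theorem norm_translateOne_sub {s : ℕ} (x : Spacetime s) (f g : OneParticle s) :
    ‖translateOne x f - translateOne x g‖ = ‖f - g‖ := by
  have h1 : ∀ᵐ p, ‖(translateOne x f - translateOne x g) p‖ = ‖(f - g) p‖ := by
    filter_upwards [Lp.coeFn_sub (translateOne x f) (translateOne x g), Lp.coeFn_sub f g,
      ae_translateOne x f, ae_translateOne x g] with p h1 h2 h3 h4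
    rw [h1, h2, Pi.sub_apply, Pi.sub_apply, h3, h4, ← mul_sub, norm_mul, norm_planePhase, one_mul]
  exact le_antisymm (Lp.norm_le_norm_of_ae_le (h1.mono fun p hp => hp.le))
    (Lp.norm_le_norm_of_ae_le (h1.mono fun p hp => hp.ge))

theorem continuous_translateOne {s : ℕ} (x : Spacetime s) :
    Continuous (translateOne (s := s) x) := by
  refine (Isometry.of_dist_eq fun f g => ?_).continuous
  rw [dist_eq_norm, dist_eq_norm, norm_translateOne_sub]

theorem inner_translateOne_self {s : ℕ} (x : Spacetime s) (f : OneParticle s) :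
    ⟪f, translateOne x f⟫_ℂ = ∫ p, ((‖f p‖ ^ 2 : ℝ) : ℂ) * planePhase x p := by
  rw [L2.inner_def]
  refine integral_congr_ae ?_
  filter_upwards [ae_translateOne x f] with p hp
  rw [hp, RCLike.inner_apply, mul_assoc, Complex.mul_conj, Complex.normSq_eq_norm_sq, mul_comm]

theorem inner_translateOne_translateOne {s : ℕ} (x y : Spacetime s) (f : OneParticle s) :
    ⟪translateOne x f, translateOne y f⟫_ℂ = ⟪f, translateOne (y - x) f⟫_ℂ := by
  rw [L2.inner_def, L2.inner_def]
  refine integral_congr_ae ?_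
  filter_upwards [ae_translateOne x f, ae_translateOne y f, ae_translateOne (y - x) f]
    with p h1 h2 h3
  rw [h1, h2, h3, RCLike.inner_apply, RCLike.inner_apply, ← conj_planePhase_mul, map_mul]
  ring

theorem localProj_of_mem {s : ℕ} {r : ℝ} {σ : Sgn} {v : OneParticle s}
    (hv : v ∈ localSubspace s r σ) : localProj s r σ v = v :=
  Submodule.starProjection_eq_self_iff.2 hv

theorem localProj_mem {s : ℕ} (r : ℝ) (σ : Sgn) (v : OneParticle s) :
    localProj s r σ v ∈ localSubspace s r σ :=
  Submodule.starProjection_apply_mem _ _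

theorem IsMulComp.apply_localProj {s : ℕ} {r : ℝ} {σ : Sgn} {m : Mom s → ℝ}
    {B : OneParticle s →L[ℂ] OneParticle s} (hB : IsMulComp m (localProj s r σ) B)
    (v : OneParticle s) : B (localProj s r σ v) = B v := by
  refine Lp.ext ?_
  filter_upwards [hB v, hB (localProj s r σ v)] with p h1 h2
  rw [h1, h2, localProj_of_mem (localProj_mem r σ v)]

/-- Both sides are continuous in `e` because `B₁` and `B₂` are bounded, so the estimate for single
test functions passes to the limit. -/
theorem norm_inner_translateOne_le {s : ℕ} (hs : 3 ≤ s) {r : ℝ} (hr : 0 < r) :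
    ∃ C, 0 < C ∧ ∀ (h : Mom s → ℂ), IsTestFunction r h → ∀ (σ : Sgn)
      (B₁ B₂ : OneParticle s →L[ℂ] OneParticle s),
      IsMulComp (powSymbol (-(1 / 2)) h) (localProj s r σ) B₁ →
      IsMulComp (powSymbol (1 / 2) h) (localProj s r σ) B₂ →
      ∀ (e : OneParticle s) (x : Spacetime s), 4 * r < ‖x.2‖ - |x.1| →
        ‖⟪B₁ e, translateOne x (B₁ e)⟫_ℂ‖ ≤
          C * ‖B₂ e‖ ^ 2 * ((‖x.2‖ - |x.1| - 4 * r) ^ (s - 2))⁻¹ := by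
  obtain ⟨C, hC, hC'⟩ := integral_planePhase_local_le hs hr
  refine ⟨C, hC, fun h hh σ B₁ B₂ hB₁ hB₂ e x hx => ?_⟩
  rw [← hB₁.apply_localProj, ← hB₂.apply_localProj]
  obtain ⟨u, hu, huv⟩ := exists_seq_isLocalVector (localProj_mem r σ e)
  have hn : ∀ n, ‖⟪B₁ (u n), translateOne x (B₁ (u n))⟫_ℂ‖ ≤
      C * ‖B₂ (u n)‖ ^ 2 * ((‖x.2‖ - |x.1| - 4 * r) ^ (s - 2))⁻¹ := by
    intro n
    have h1 := hC' h hh σ (u n) (hu n) x hx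
    have h0 : ∀ a : ℝ, ∀ p, 0 ≤ powSymbol a h p := fun a p => by
      unfold powSymbol
      positivity
    have h2 : ∫ p, ((‖B₁ (u n) p‖ ^ 2 : ℝ) : ℂ) * planePhase x p
        = ∫ p, (((powSymbol (-(1 / 2)) h p * ‖u n p‖) ^ 2 : ℝ) : ℂ) * planePhase x p := by
      refine integral_congr_ae ?_
      filter_upwards [hB₁ (u n)] with p hp
      rw [hp, localProj_of_mem (hu n).mem, norm_mul, Complex.norm_real,
        Real.norm_of_nonneg (h0 _ p)]
    have h3 : ∫ p, ‖B₂ (u n) p‖ ^ 2 = ∫ p, (powSymbol (1 / 2) h p * ‖u n p‖) ^ 2 := by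
      refine integral_congr_ae ?_
      filter_upwards [hB₂ (u n)] with p hp
      rw [hp, localProj_of_mem (hu n).mem, norm_mul, Complex.norm_real,
        Real.norm_of_nonneg (h0 _ p)]
    rw [inner_translateOne_self, norm_sq_eq_integral, h2, h3]
    exact h1
  have ht1 := ((B₁.continuous.tendsto _).comp huv)
  have ht2 := ((B₂.continuous.tendsto _).comp huv)
  have ht3 := (((continuous_translateOne x).tendsto _).comp ht1)
  exact le_of_tendsto_of_tendsto' (ht1.inner ht3).norm (((ht2.norm.pow 2).const_mul C).mul_const _) hn

theorem IsMulComp.norm_le_mul_norm {s : ℕ} {r : ℝ} {σ : Sgn} {m m' : Mom s → ℝ}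
    {B B' : OneParticle s →L[ℂ] OneParticle s} (hB : IsMulComp m (localProj s r σ) B)
    (hB' : IsMulComp m' (localProj s r σ) B') {A : ℝ} (hm : ∀ᵐ p, |m p| ≤ A * |m' p|)
    (v : OneParticle s) : ‖B v‖ ≤ A * ‖B' v‖ := by
  refine Lp.norm_le_mul_norm_of_ae_le_mul ?_
  filter_upwards [hB v, hB' v, hm] with p h1 h2 h3
  rw [h1, h2, norm_mul, norm_mul, Complex.norm_real, Complex.norm_real, Real.norm_eq_abs,
    Real.norm_eq_abs, ← mul_assoc]
  gcongr

theorem correlation_eq_inner {s : ℕ} {r : ℝ} {h : Mom s → ℂ} {σ : Sgn}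
    {B : OneParticle s →L[ℂ] OneParticle s}
    (hB : IsMulComp (powSymbol (-(1 / 2)) h) (localProj s r σ) B) (e : OneParticle s)
    (x : Spacetime s) : correlation r h σ e x = ⟪B e, translateOne x (B e)⟫_ℂ := by
  rw [inner_translateOne_self, correlation]
  refine integral_congr_ae ?_
  filter_upwards [hB e] with p hp
  have h0 : ∀ z w : ℂ, conj z * (w * z) = ((‖z‖ ^ 2 : ℝ) : ℂ) * w := fun z w => by
    rw [mul_left_comm, ← Complex.normSq_eq_conj_mul_self, Complex.normSq_eq_norm_sq, mul_comm]
  rw [h0, hp, planePhase]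
  congr 3
  rw [norm_mul, norm_mul, norm_mul, Complex.norm_real, Complex.norm_real, powSymbol, norm_mul,
    norm_norm]

/-! ## The symbols of the operators `T_{E,±}` and `T_{h,±}` -/

theorem measurable_powSymbol {s : ℕ} {r a : ℝ} {h : Mom s → ℂ} (hh : IsTestFunction r h) :
    Measurable (powSymbol (s := s) a h) :=
  (measurable_norm.pow_const a).mul hh.continuous_fourier.measurable.norm

theorem isTameSymbol_symbolE {s : ℕ} (hs : 3 ≤ s) (E : ℝ) : IsTameSymbol (symbolE (s := s) E) where
  measurable := by
    unfold symbolE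
    exact Measurable.ite (measurableSet_lt measurable_norm measurable_const)
      (measurable_norm.pow_const _) measurable_const
  bound := by
    have hs' : (3 : ℝ) ≤ s := by exact_mod_cast hs
    refine ⟨max E 0, 1, 1 / 2, le_max_right _ _, zero_le_one, by linarith, fun p _ => ?_,
      fun p hp => ?_⟩
    · unfold symbolE
      split_ifs
      · rw [abs_of_nonneg (by positivity), one_mul]
      · rw [abs_zero]
        positivity
    · rw [symbolE, if_neg (not_lt.2 ((le_max_left _ _).trans hp)), abs_zero]
      exact zero_le_one

theorem rpow_le_one_add_pow {x a : ℝ} {k : ℕ} (hx : 0 ≤ x) (ha : 0 ≤ a) (hak : a ≤ k) :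
    x ^ a ≤ (1 + x) ^ k := by
  rw [← Real.rpow_natCast]
  exact (Real.rpow_le_rpow hx (by linarith) ha).trans
    (Real.rpow_le_rpow_of_exponent_le (by linarith) hak)

theorem isTameSymbol_powSymbol_neg_half {s : ℕ} (hs : 3 ≤ s) {r : ℝ} {h : Mom s → ℂ}
    (hh : IsTestFunction r h) : IsTameSymbol (powSymbol (s := s) (-(1 / 2)) h) where
  measurable := measurable_powSymbol hh
  bound := by
    have hs' : (3 : ℝ) ≤ s := by exact_mod_cast hs
    obtain ⟨C, hC, hC'⟩ := hh.exists_fourier_decay 0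
    simp only [pow_zero, one_mul] at hC'
    refine ⟨1, C, 1 / 2, zero_le_one, hC.le, by linarith, fun p _ => ?_, fun p hp => ?_⟩
    · rw [powSymbol, abs_of_nonneg (by positivity), mul_comm]
      exact mul_le_mul_of_nonneg_right (hC' p) (by positivity)
    · rw [powSymbol, abs_of_nonneg (by positivity)]
      exact (mul_le_of_le_one_left (norm_nonneg _)
        (Real.rpow_le_one_of_one_le_of_nonpos hp (by norm_num))).trans (hC' p)

theorem isTameSymbol_powSymbol_half {s : ℕ} (hs : 3 ≤ s) {r : ℝ} {h : Mom s → ℂ}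
    (hh : IsTestFunction r h) : IsTameSymbol (powSymbol (s := s) (1 / 2) h) where
  measurable := measurable_powSymbol hh
  bound := by
    have hs' : (3 : ℝ) ≤ s := by exact_mod_cast hs
    obtain ⟨C, hC, hC'⟩ := hh.exists_fourier_decay 1
    refine ⟨0, C, 0, le_rfl, hC.le, by linarith,
      fun p hp => absurd hp (not_lt.2 (norm_nonneg p)), fun p _ => ?_⟩
    rw [powSymbol, abs_of_nonneg (by positivity)]
    refine le_trans ?_ (hC' p)
    gcongr
    exact rpow_le_one_add_pow (norm_nonneg p) (by norm_num) (by norm_num)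

theorem norm_fourier_eq_re {s : ℕ} {h : Mom s → ℂ} {p : Mom s}
    (hp : (fourier h p).im = 0 ∧ 0 < (fourier h p).re) : (fourier h p).re = ‖fourier h p‖ := by
  rw [← abs_of_pos hp.2]
  exact Complex.abs_re_eq_norm.2 hp.1

theorem isTameSymbol_symbolH {s : ℕ} {r : ℝ} {h : Mom s → ℂ}
    (hh : IsTestFunction r h) (h_pos : ∀ p, (fourier h p).im = 0 ∧ 0 < (fourier h p).re)
    {γ : ℝ} (hγ : 0 ≤ γ) (hγ' : γ < ((s : ℝ) - 1) / 2) : IsTameSymbol (symbolH (s := s) γ h) where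
  measurable := by
    unfold symbolH
    exact (measurable_norm.pow_const _).mul
      (Complex.measurable_re.comp hh.continuous_fourier.measurable).sqrt
  bound := by
    obtain ⟨C, hC, hC'⟩ := hh.exists_fourier_decay 0
    simp only [pow_zero, one_mul] at hC'
    have hC1 : ∀ p, √(fourier h p).re ≤ √C := fun p =>
      Real.sqrt_le_sqrt ((norm_fourier_eq_re (h_pos p)).trans_le (hC' p))
    refine ⟨1, √C, γ, zero_le_one, by positivity, by linarith, fun p _ => ?_, fun p hp => ?_⟩
    · rw [symbolH, abs_of_nonneg (by positivity), mul_comm]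
      exact mul_le_mul_of_nonneg_right (hC1 p) (by positivity)
    · rw [symbolH, abs_of_nonneg (by positivity)]
      exact (mul_le_of_le_one_left (Real.sqrt_nonneg _)
        (Real.rpow_le_one_of_one_le_of_nonpos hp (by linarith))).trans (hC1 p)

/-- One factor `h̃^{1/2}` is sacrificed to absorb `|p|^{a+γ}`, which is regular at the origin
because `a ≥ -1/2` and `γ ≥ 1/2`. -/
theorem exists_powSymbol_le_symbolH {s : ℕ} {r : ℝ} {h : Mom s → ℂ}
    (hh : IsTestFunction r h) (h_pos : ∀ p, (fourier h p).im = 0 ∧ 0 < (fourier h p).re)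
    {γ : ℝ} (hγ : 1 / 2 ≤ γ) (hγ' : γ < ((s : ℝ) - 1) / 2) :
    ∃ A, 0 < A ∧ ∀ a : ℝ, |a| ≤ 1 / 2 → ∀ᵐ p : Mom s, |powSymbol a h p| ≤ A * |symbolH γ h p| := by
  have : NeZero s := ⟨by
    rintro rfl
    rw [Nat.cast_zero] at hγ'
    linarith⟩
  -- The order `2s` is halved by the square root; `a + γ ≤ s` is then enough.
  obtain ⟨C, hC, hC'⟩ := hh.exists_fourier_decay (2 * s)
  refine ⟨√C, by positivity, fun a ha => ?_⟩
  filter_upwards [Measure.ae_ne volume (0 : Mom s)] with p hp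
  have hp0 : 0 < ‖p‖ := norm_pos_iff.2 hp
  rw [abs_le] at ha
  rw [powSymbol, symbolH, abs_of_nonneg (by positivity), abs_of_nonneg (by positivity),
    norm_fourier_eq_re (h_pos p)]
  have h1 : ‖p‖ ^ (a + γ) ≤ (1 + ‖p‖) ^ s :=
    rpow_le_one_add_pow hp0.le (by linarith) (by linarith)
  have h2 : (1 + ‖p‖) ^ s * √‖fourier h p‖ ≤ √C := by
    refine Real.le_sqrt_of_sq_le ?_
    rw [mul_pow, Real.sq_sqrt (norm_nonneg _), ← pow_mul, mul_comm s 2]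
    exact hC' p
  calc ‖p‖ ^ a * ‖fourier h p‖
      = (‖p‖ ^ (a + γ) * √‖fourier h p‖) * (‖p‖ ^ (-γ) * √‖fourier h p‖) := by
        nth_rewrite 1 [← Real.mul_self_sqrt (norm_nonneg (fourier h p))]
        have h3 : ‖p‖ ^ a = ‖p‖ ^ (a + γ) * ‖p‖ ^ (-γ) := by
          rw [← Real.rpow_add hp0]
          congr 1
          ring
        rw [h3]
        ring
    _ ≤ √C * (‖p‖ ^ (-γ) * √‖fourier h p‖) := by
        gcongr
        exact (mul_le_mul_of_nonneg_right h1 (Real.sqrt_nonneg _)).trans h2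

theorem isMulComp_mulComp {s : ℕ} {m : Mom s → ℝ} {A : OneParticle s →L[ℂ] OneParticle s}
    (H : ∃ B, IsMulComp m A B) : IsMulComp m A (mulComp m A) := by
  rw [mulComp, dif_pos H]
  exact H.choose_spec

/-! ## Eigenvectors of `T` and their correlations -/

theorem opSqrt_mul_self {H : Type*} [NormedAddCommGroup H] [InnerProductSpace ℂ H]
    [CompleteSpace H] {A : H →L[ℂ] H} (hA : 0 ≤ A) : opSqrt A * opSqrt A = A :=
  CFC.sqrt_mul_sqrt_self A hA

theorem absSq_nonneg {s : ℕ} (A : OneParticle s →L[ℂ] OneParticle s) : 0 ≤ absSq A :=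
  star_mul_self_nonneg A

theorem re_inner_absSq {s : ℕ} (A : OneParticle s →L[ℂ] OneParticle s) (e : OneParticle s) :
    (⟪e, absSq A e⟫_ℂ).re = ‖A e‖ ^ 2 := by
  rw [absSq, ContinuousLinearMap.comp_apply, ContinuousLinearMap.adjoint_inner_right,
    inner_self_eq_norm_sq_to_K]
  norm_cast

/-- Both sides are `⟨e, T² e⟩`. Each of the four norms is therefore at most `|t|`. -/
theorem sum_norm_sq_eq_of_eigenvector {s : ℕ} {r γ E t : ℝ} {h : Mom s → ℂ} {e : OneParticle s}
    (he : ‖e‖ = 1) (ht : opT s r γ h E e = (t : ℂ) • e) :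
    ‖opTE s r E Sgn.plus e‖ ^ 2 + ‖opTE s r E Sgn.minus e‖ ^ 2 + ‖opTh s r γ h Sgn.plus e‖ ^ 2
      + ‖opTh s r γ h Sgn.minus e‖ ^ 2 = t ^ 2 := by
  have h0 := opSqrt_mul_self
    (add_nonneg (add_nonneg (add_nonneg (absSq_nonneg (opTE s r E Sgn.plus))
      (absSq_nonneg (opTE s r E Sgn.minus))) (absSq_nonneg (opTh s r γ h Sgn.plus)))
      (absSq_nonneg (opTh s r γ h Sgn.minus)))
  have h1 : opT s r γ h E (opT s r γ h E e) = (absSq (opTE s r E Sgn.plus)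
      + absSq (opTE s r E Sgn.minus)
      + absSq (opTh s r γ h Sgn.plus) + absSq (opTh s r γ h Sgn.minus)) e :=
    congrArg (fun A : OneParticle s →L[ℂ] OneParticle s => A e) h0
  rw [ht, map_smul, ht, smul_smul] at h1
  have h2 := congrArg (fun v => (⟪e, v⟫_ℂ).re) h1
  simp only [add_apply, inner_add_right, Complex.add_re, re_inner_absSq,
    inner_smul_right, inner_self_eq_norm_sq_to_K, he] at h2
  rw [← h2]
  norm_cast
  simp [sq]

theorem norm_sq_opTE_le {s : ℕ} {r γ E t : ℝ} {h : Mom s → ℂ} {e : OneParticle s}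
    (he : ‖e‖ = 1) (ht : opT s r γ h E e = (t : ℂ) • e) (σ : Sgn) :
    ‖opTE s r E σ e‖ ^ 2 ≤ t ^ 2 := by
  rw [← sum_norm_sq_eq_of_eigenvector he ht]
  cases σ <;> linarith [sq_nonneg ‖opTE s r E Sgn.plus e‖, sq_nonneg ‖opTE s r E Sgn.minus e‖,
    sq_nonneg ‖opTh s r γ h Sgn.plus e‖, sq_nonneg ‖opTh s r γ h Sgn.minus e‖]

theorem norm_sq_opTh_le {s : ℕ} {r γ E t : ℝ} {h : Mom s → ℂ} {e : OneParticle s}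
    (he : ‖e‖ = 1) (ht : opT s r γ h E e = (t : ℂ) • e) (σ : Sgn) :
    ‖opTh s r γ h σ e‖ ^ 2 ≤ t ^ 2 := by
  rw [← sum_norm_sq_eq_of_eigenvector he ht]
  cases σ <;> linarith [sq_nonneg ‖opTE s r E Sgn.plus e‖, sq_nonneg ‖opTE s r E Sgn.minus e‖,
    sq_nonneg ‖opTh s r γ h Sgn.plus e‖, sq_nonneg ‖opTh s r γ h Sgn.minus e‖]

theorem norm_translateOne {s : ℕ} (x : Spacetime s) (f : OneParticle s) :
    ‖translateOne x f‖ = ‖f‖ := by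
  have h1 : ∀ᵐ p, ‖translateOne x f p‖ = ‖f p‖ := by
    filter_upwards [ae_translateOne x f] with p hp
    rw [hp, norm_mul, norm_planePhase, one_mul]
  exact le_antisymm (Lp.norm_le_norm_of_ae_le (h1.mono fun p hp => hp.le))
    (Lp.norm_le_norm_of_ae_le (h1.mono fun p hp => hp.ge))

/-- Far from the light cone the contour estimate applies; near it the trivial bound `‖B₁ e‖²`
suffices, as `d + 1` is bounded there. Both are controlled by `T_h` alone, so the constant does not
depend on `E`. -/
theorem exists_norm_correlation_le {s : ℕ} (hs : 3 ≤ s) {r : ℝ} (hr : 0 < r) {h : Mom s → ℂ}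
    (hh : IsTestFunction r h) (h_pos : ∀ p, (fourier h p).im = 0 ∧ 0 < (fourier h p).re)
    {γ : ℝ} (hγ : 1 / 2 ≤ γ) (hγ' : γ < ((s : ℝ) - 1) / 2) :
    ∃ c : ℝ, 0 < c ∧ ∀ (σ : Sgn) (e : OneParticle s) (x : Spacetime s), |x.1| ≤ ‖x.2‖ →
      ‖correlation r h σ e x‖ ≤
        c * ‖opTh s r γ h σ e‖ ^ 2 / (‖x.2‖ - |x.1| + 1) ^ (s - 2) := by
  obtain ⟨C, hC, hC'⟩ := norm_inner_translateOne_le hs hr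
  obtain ⟨A, hA, hA'⟩ := exists_powSymbol_le_symbolH hh h_pos hγ hγ'
  refine ⟨C * A ^ 2 * 2 ^ (s - 2) + A ^ 2 * (8 * r + 2) ^ (s - 2), by positivity,
    fun σ e x hx => ?_⟩
  obtain ⟨B₁, hB₁⟩ := (isTameSymbol_powSymbol_neg_half hs hh).exists_isMulComp (by omega) hr σ
  obtain ⟨B₂, hB₂⟩ := (isTameSymbol_powSymbol_half hs hh).exists_isMulComp (by omega) hr σ
  have hT : IsMulComp (symbolH γ h) (localProj s r σ) (opTh s r γ h σ) := isMulComp_mulComp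
    ((isTameSymbol_symbolH hh h_pos (by linarith) hγ').exists_isMulComp (by omega) hr σ)
  have h1 : ‖B₁ e‖ ^ 2 ≤ A ^ 2 * ‖opTh s r γ h σ e‖ ^ 2 := by
    rw [← mul_pow]
    gcongr
    exact hB₁.norm_le_mul_norm hT (hA' _ (by norm_num [abs_of_pos])) e
  have h2 : ‖B₂ e‖ ^ 2 ≤ A ^ 2 * ‖opTh s r γ h σ e‖ ^ 2 := by
    rw [← mul_pow]
    gcongr
    exact hB₂.norm_le_mul_norm hT (hA' _ (by norm_num [abs_of_pos])) e
  rw [correlation_eq_inner hB₁]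
  set d := ‖x.2‖ - |x.1| with hd
  have hd0 : 0 ≤ d := sub_nonneg.2 hx
  rw [le_div_iff₀ (by positivity), add_mul]
  -- The threshold is the value of `d` from which on `d + 1 ≤ 2(d - 4r)`.
  rcases le_or_gt (8 * r + 1) d with h3 | h3
  · have h4 := hC' h hh σ B₁ B₂ hB₁ hB₂ e x (by linarith)
    rw [← hd] at h4
    have h5 : 0 < d - 4 * r := by linarith
    have h6 : (d + 1) ^ (s - 2) ≤ 2 ^ (s - 2) * (d - 4 * r) ^ (s - 2) := by
      rw [← mul_pow]
      gcongr
      linarith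
    calc ‖⟪B₁ e, translateOne x (B₁ e)⟫_ℂ‖ * (d + 1) ^ (s - 2)
        ≤ (C * ‖B₂ e‖ ^ 2 * ((d - 4 * r) ^ (s - 2))⁻¹) * (2 ^ (s - 2) * (d - 4 * r) ^ (s - 2)) := by
          gcongr
      _ = C * ‖B₂ e‖ ^ 2 * 2 ^ (s - 2) := by
          field_simp
      _ ≤ C * (A ^ 2 * ‖opTh s r γ h σ e‖ ^ 2) * 2 ^ (s - 2) := by gcongr
      _ = C * A ^ 2 * 2 ^ (s - 2) * ‖opTh s r γ h σ e‖ ^ 2 := by ring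
      _ ≤ _ := le_add_of_nonneg_right (by positivity)
  · calc ‖⟪B₁ e, translateOne x (B₁ e)⟫_ℂ‖ * (d + 1) ^ (s - 2)
        ≤ ‖B₁ e‖ ^ 2 * (8 * r + 2) ^ (s - 2) := by
          refine mul_le_mul ?_ (pow_le_pow_left₀ (by linarith) (by linarith) _) (by positivity)
            (by positivity)
          refine (norm_inner_le_norm _ _).trans_eq ?_
          rw [norm_translateOne, sq]
      _ ≤ A ^ 2 * ‖opTh s r γ h σ e‖ ^ 2 * (8 * r + 2) ^ (s - 2) := by gcongr
      _ = A ^ 2 * (8 * r + 2) ^ (s - 2) * ‖opTh s r γ h σ e‖ ^ 2 := by ring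
      _ ≤ _ := le_add_of_nonneg_left (by positivity)

theorem rpow_sub_le_pow {s : ℕ} (hs : 3 ≤ s) {ε d : ℝ} (hε : 0 < ε) (hd : 0 ≤ d) :
    (d + 1) ^ ((s : ℝ) - 2 - ε) ≤ (d + 1) ^ (s - 2) := by
  rw [← Real.rpow_natCast, Nat.cast_sub (by omega)]
  exact Real.rpow_le_rpow_of_exponent_le (by linarith) (by push_cast; linarith)

/-- This is the purpose of `T_E`: with the multiplier `|p|^{-1/2}` one has `S = 1`, and the Gram
matrix is the single number `‖T_E e‖² ≤ t²`, without any loss from `h̃`. -/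
theorem lowEnergyBound_localProj {s : ℕ} (hs : 3 ≤ s) {r : ℝ} (hr : 0 < r) {h : Mom s → ℂ}
    {γ E t : ℝ} (hE : 0 ≤ E) {e : OneParticle s} (he : ‖e‖ = 1)
    (ht : opT s r γ h E e = (t : ℂ) • e) (σ : Sgn) :
    LowEnergyBound (fun _ : Unit => localProj s r σ e) E (ENNReal.ofReal (|t| ^ 2)) := by
  have hT : IsMulComp (symbolE E) (localProj s r σ) (opTE s r E σ) := isMulComp_mulComp
    ((isTameSymbol_symbolE hs E).exists_isMulComp (by omega) hr σ)
  rw [← mul_one (|t| ^ 2)]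
  refine lowEnergyBound_of_gram (g := fun _ => opTE s r E σ e) (isTameSymbol_symbolE hs E).measurable
    (fun _ => hT e) hE zero_le_one (by positivity) ?_ fun _ => ?_
  · have : NeZero s := ⟨by omega⟩
    filter_upwards [Measure.ae_ne volume (0 : Mom s)] with q hq hqE
    have hq0 : 0 < ‖q‖ := norm_pos_iff.2 hq
    rw [symbolE, if_pos hqE]
    refine ⟨by positivity, le_of_eq ?_⟩
    rw [← Real.rpow_natCast, ← Real.rpow_mul hq0.le]
    norm_num
    rw [Real.rpow_neg_one, inv_inv]
  · rw [Fintype.sum_unique, sq_abs]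
    refine (norm_inner_le_norm _ _).trans ?_
    rw [← sq]
    exact norm_sq_opTE_le he ht σ

/-! ### Low-energy bounds for families of translates. -/

theorem separation_le {s N : ℕ} (x : Fin N → Spacetime s) {i j : Fin N} (hij : i ≠ j) :
    separation x ≤ ‖(x i).2 - (x j).2‖ - |(x i).1 - (x j).1| :=
  ciInf_le (Set.finite_range _).bddBelow
    (⟨(i, j), hij⟩ : {ij : Fin N × Fin N // ij.1 ≠ ij.2})

/-- The Gram matrix entries are correlations at `xⱼ - xᵢ`. The diagonal one, at distance zero, gives
the `1`; the other `N - 1` are bounded through the separation. -/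
theorem sum_norm_gram_le {s : ℕ} {r c T : ℝ} (hcT : 0 ≤ c * T) {h : Mom s → ℂ} {σ : Sgn}
    {e : OneParticle s} {B : OneParticle s →L[ℂ] OneParticle s}
    (hB : IsMulComp (powSymbol (-(1 / 2)) h) (localProj s r σ) B)
    (hc : ∀ x : Spacetime s, |x.1| ≤ ‖x.2‖ →
      ‖correlation r h σ e x‖ ≤ c * T / (‖x.2‖ - |x.1| + 1) ^ (s - 2))
    {N : ℕ} {x : Fin N → Spacetime s} (hx : 0 ≤ separation x) (i : Fin N) :
    ∑ j, ‖⟪translateOne (x i) (B e), translateOne (x j) (B e)⟫_ℂ‖ ≤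
      c * T * (1 + ((N : ℝ) - 1) / (separation x + 1) ^ (s - 2)) := by
  simp only [inner_translateOne_translateOne, ← correlation_eq_inner hB]
  rw [← Finset.add_sum_erase _ _ (Finset.mem_univ i), mul_add, mul_one]
  refine add_le_add ?_ ?_
  · have h1 := hc (x i - x i) (by simp)
    simpa using h1
  · have h2 : ∀ j ∈ Finset.univ.erase i, ‖correlation r h σ e (x j - x i)‖ ≤
        c * T / (separation x + 1) ^ (s - 2) := by
      intro j hj
      have h3 := separation_le x (Finset.ne_of_mem_erase hj)
      refine (hc (x j - x i) ?_).trans ?_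
      · rw [Prod.fst_sub, Prod.snd_sub]
        linarith
      · rw [Prod.fst_sub, Prod.snd_sub]
        gcongr
    refine (Finset.sum_le_card_nsmul _ _ _ h2).trans_eq ?_
    have hN : 0 < N := i.pos
    rw [Finset.card_erase_of_mem (Finset.mem_univ i), Finset.card_univ, Fintype.card_fin,
      nsmul_eq_mul, Nat.cast_sub hN, Nat.cast_one]
    ring

/-- The closed ball is compact and `h̃` is continuous without zeros, so the set is bounded above and
`sSup` is a true supremum rather than its default value. -/
theorem inv_sq_norm_fourier_le_sSup {s : ℕ} {r : ℝ} {h : Mom s → ℂ} (hh : IsTestFunction r h)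
    (h0 : ∀ p, fourier h p ≠ 0) {E : ℝ} {q : Mom s} (hq : ‖q‖ ≤ E) :
    (‖fourier h q‖ ^ 2)⁻¹ ≤
      sSup ((fun p => (‖fourier h p‖ ^ 2)⁻¹) '' Metric.closedBall 0 E) := by
  refine le_csSup ?_ ⟨q, mem_closedBall_zero_iff.2 hq, rfl⟩
  refine ((isCompact_closedBall (0 : Mom s) E).image ?_).bddAbove
  exact (hh.continuous_fourier.norm.pow 2).inv₀ fun p => pow_ne_zero _ (norm_ne_zero_iff.2 (h0 p))

/-- Here the multiplier is `|p|^{-1/2}|h̃|`, which commutes with translations: the smoothing by `h̃`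
is what makes the Gram matrix decay, and removing it below energy `E` costs `sup |h̃|⁻²`. -/
theorem lowEnergyBound_translateOne_localProj {s : ℕ} (hs : 3 ≤ s) {r : ℝ} (hr : 0 < r)
    {h : Mom s → ℂ} (hh : IsTestFunction r h) (h0 : ∀ p, fourier h p ≠ 0)
    {c T E : ℝ} (hcT : 0 ≤ c * T) (hE : 0 ≤ E) {σ : Sgn} {e : OneParticle s}
    (hc : ∀ x : Spacetime s, |x.1| ≤ ‖x.2‖ →
      ‖correlation r h σ e x‖ ≤ c * T / (‖x.2‖ - |x.1| + 1) ^ (s - 2))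
    {N : ℕ} (hN : 1 ≤ N) {x : Fin N → Spacetime s} (hx : 0 ≤ separation x) :
    LowEnergyBound (fun k => translateOne (x k) (localProj s r σ e)) E (ENNReal.ofReal
      (c * T * (1 + ((N : ℝ) - 1) / (separation x + 1) ^ (s - 2)) *
        sSup ((fun p => (‖fourier h p‖ ^ 2)⁻¹) '' Metric.closedBall 0 E))) := by
  have hN' : (0 : ℝ) ≤ N - 1 := sub_nonneg.2 (by exact_mod_cast hN)
  have : NeZero s := ⟨by omega⟩
  obtain ⟨B, hB⟩ := (isTameSymbol_powSymbol_neg_half hs hh).exists_isMulComp (by omega) hr σ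
  refine lowEnergyBound_of_gram (g := fun k => translateOne (x k) (B e))
    (measurable_powSymbol (a := -(1 / 2)) hh) (fun k => ?_) hE ?_
    (by positivity) ?_ fun i => sum_norm_gram_le hcT hB hc hx i
  · filter_upwards [ae_translateOne (x k) (B e), ae_translateOne (x k) (localProj s r σ e), hB e]
      with p h1 h2 h3
    rw [h1, h2, h3, mul_left_comm]
  · exact Real.sSup_nonneg (by rintro _ ⟨p, -, rfl⟩; positivity)
  · filter_upwards [Measure.ae_ne volume (0 : Mom s)] with q hq hqE
    have hq0 : 0 < ‖q‖ := norm_pos_iff.2 hq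
    have hq1 : 0 < ‖fourier h q‖ := norm_pos_iff.2 (h0 q)
    refine ⟨by unfold powSymbol; positivity, ?_⟩
    rw [powSymbol, mul_pow, ← Real.rpow_natCast, ← Real.rpow_mul hq0.le, mul_inv, mul_comm]
    norm_num
    rw [Real.rpow_neg_one, inv_inv]
    exact mul_le_mul_of_nonneg_right (inv_sq_norm_fourier_le_sSup hh h0 hqE.le) hq0.le

end MasslessField

end

/-! ### The proposition: assembling the one-particle and Fock space estimates. -/

open MasslessField in
theorem mainTheorem2 (s : ℕ) (hs : 3 ≤ s) (r : ℝ) (hr : 0 < r)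
    (h : Mom s → ℂ) (h_test : IsTestFunction r h) (h_real : ∀ y, (h y).im = 0)
    (h_pos : ∀ p, (fourier h p).im = 0 ∧ 0 < (fourier h p).re)
    (γ : ℝ) (hγ : 1 / 2 ≤ γ) (hγ' : γ < ((s : ℝ) - 1) / 2) (ε : ℝ) (hε : 0 < ε) :
    (∀ σ : Sgn, (∃ B, IsMulComp (symbolH γ h) (localProj s r σ) B) ∧
      ∀ E : ℝ, ∃ B, IsMulComp (symbolE E) (localProj s r σ) B) ∧
    ∃ c : ℝ, 0 < c ∧
      (∀ (E : ℝ), 0 ≤ E → ∀ (e : OneParticle s) (t : ℝ), ‖e‖ = 1 → IsJInvariant e →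
        opT s r γ h E e = (t : ℂ) • e →
        ∀ (σ : Sgn) (x : Spacetime s), |x.1| ≤ ‖x.2‖ →
          ‖correlation r h σ e x‖ ≤ c * t ^ 2 / (‖x.2‖ - |x.1| + 1) ^ ((s : ℝ) - 2 - ε)) ∧
      ∀ (E : ℝ), 0 ≤ E → ∀ (e : HilbertBasis ℕ ℂ (OneParticle s)) (t : ℕ → ℝ),
        (∀ j, IsJInvariant (e j)) → (∀ j, opT s r γ h E (e j) = (t j : ℂ) • e j) →
        (∀ μ : MultiPair, ∃ B, IsAnnihilator E (μ.args r e) B) ∧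
        ∀ (N : ℕ), 1 ≤ N → ∀ x : Fin N → Spacetime s, 0 ≤ separation x →
          ∀ μ ν : MultiPair,
            multiNorm (centeredFunctionals s E) x (functionalS r E e μ ν) ^ 2 ≤
              ENNReal.ofReal
                (16 * c * sSup ((fun p => (‖fourier h p‖ ^ 2)⁻¹) '' Metric.closedBall 0 E) *
                  E ^ (μ.size + ν.size) * (μ.pow t * ν.pow t) ^ 2 *
                  (1 + ((N : ℝ) - 1) / (separation x + 1) ^ ((s : ℝ) - 2 - ε))) := by
  have h0 : ∀ p, fourier h p ≠ 0 := fun p hp => by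
    have h1 := (h_pos p).2
    rw [hp, Complex.zero_re] at h1
    exact lt_irrefl _ h1
  obtain ⟨c, hc, hc'⟩ := exists_norm_correlation_le hs hr h_test h_pos hγ hγ'
  have hcorr : ∀ {E t : ℝ} {e : OneParticle s}, ‖e‖ = 1 → opT s r γ h E e = (t : ℂ) • e →
      ∀ (σ : Sgn) (x : Spacetime s), |x.1| ≤ ‖x.2‖ →
        ‖correlation r h σ e x‖ ≤ c * t ^ 2 / (‖x.2‖ - |x.1| + 1) ^ (s - 2) := by
    intro E t e he ht σ x hx
    refine (hc' σ e x hx).trans ?_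
    have hx' : 0 ≤ ‖x.2‖ - |x.1| := sub_nonneg.2 hx
    exact div_le_div_of_nonneg_right
      (mul_le_mul_of_nonneg_left (norm_sq_opTh_le he ht σ) hc.le) (by positivity)
  refine ⟨fun σ => ⟨(isTameSymbol_symbolH h_test h_pos (by linarith) hγ').exists_isMulComp
    (by omega) hr σ, fun E => (isTameSymbol_symbolE hs E).exists_isMulComp (by omega) hr σ⟩,
    c, hc, fun E hE e t he _ ht σ x hx => ?_, fun E hE e t _ ht => ?_⟩
  · refine (hcorr he ht σ x hx).trans ?_
    have hx' : 0 ≤ ‖x.2‖ - |x.1| := sub_nonneg.2 hx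
    -- The decay has been shown with exponent `s - 2`; since the base is at least one, `ε` only
    -- weakens it.
    exact div_le_div_of_nonneg_left (by positivity) (by positivity) (rpow_sub_le_pow hs hε hx')
  · have he : ∀ j, ‖e j‖ = 1 := e.orthonormal.1
    have hf : ∀ σ j, LowEnergyBound (fun _ : Unit => localProj s r σ (e j)) E
        (ENNReal.ofReal (|t j| ^ 2)) :=
      fun σ j => lowEnergyBound_localProj hs hr hE (he j) (ht j) σ
    refine ⟨fun μ => exists_isAnnihilator_args hE hf μ, fun N hN x hx μ ν => ?_⟩
    have hN' : (0 : ℝ) ≤ N - 1 := sub_nonneg.2 (by exact_mod_cast hN)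
    set S := sSup ((fun p => (‖fourier h p‖ ^ 2)⁻¹) '' Metric.closedBall 0 E) with hS
    have hS0 : 0 ≤ S := Real.sSup_nonneg (by rintro _ ⟨p, -, rfl⟩; positivity)
    set D := 1 + ((N : ℝ) - 1) / (separation x + 1) ^ (s - 2) with hD
    have hD0 : 0 ≤ D := by positivity
    have hD1 : D ≤ 1 + ((N : ℝ) - 1) / (separation x + 1) ^ ((s : ℝ) - 2 - ε) := by
      have h1 := rpow_sub_le_pow hs hε hx
      have h2 : 0 < (separation x + 1) ^ ((s : ℝ) - 2 - ε) := by positivity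
      rw [hD]
      gcongr
    -- `K` collects the correlation constant, the cost of removing `h̃`, and the row sum of the Gram
    -- matrix.
    refine (multiNorm_functionalS_sq_le (K := c * S * D) hE (by positivity) hf
      (fun σ j => ?_) μ ν).trans (ENNReal.ofReal_le_ofReal ?_)
    · have h1 := lowEnergyBound_translateOne_localProj hs hr h_test h0 (T := t j ^ 2)
        (by positivity) hE (hcorr (he j) (ht j) σ) hN hx
      have h2 : t j ^ 2 * (c * S * D) = c * t j ^ 2 * D * S := by ring
      rw [h2]
      exact h1
    · calc c * S * D * E ^ (μ.size + ν.size) * (μ.pow t * ν.pow t) ^ 2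
          = 1 * (c * S * E ^ (μ.size + ν.size) * (μ.pow t * ν.pow t) ^ 2 * D) := by ring
        -- The argument yields the constant `1` in place of `16`.
        _ ≤ 16 * (c * S * E ^ (μ.size + ν.size) * (μ.pow t * ν.pow t) ^ 2 *
            (1 + ((N : ℝ) - 1) / (separation x + 1) ^ ((s : ℝ) - 2 - ε))) := by
          gcongr
          norm_num
        _ = _ := by ring
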